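/- Let $0<r_i<r_e$, write $B_r=\{x\in\mathbb R^2:|x|<r\}$, and put $D=B_{r_i}$, $\Omega=B_{r_e}$, $\rho=r_i/r_e$ and $r_*=\sqrt{r_e^3/r_i}$. For $\delta>0$ let $\epsilon_\delta=-1+i\delta$ in the shell $\Omega\setminus\overline D$ and $\epsilon_\delta=1$ in $D$ and in $\mathbb R^2\setminus\overline\Omega$. Let $f$ be an integrable (real- or complex-valued) function with compact support contained in $\mathbb R^2\setminus\overline{B_{r_e}}$ and $\int_{\mathbb R^2} f\,dx=0$, and let $$F(x)=\frac1{2\pi}\int_{\mathbb R^2}\ln|x-y|\,f(y)\,dy$$ be its Newtonian potential. For each $\delta>0$ let $V_\delta\in W^{1,1}_{\mathrm{loc}}(\mathbb R^2;\mathbb C)$ be the weak solution of $$\nabla\cdot(\epsilon_\delta\nabla V_\delta)=f\ \text{ in }\mathbb R^2,\qquad V_\delta(x)\to0\ \text{ as }|x|\to\infty,$$ and let $$E_\delta=\int_{\Omega\setminus\overline D}\delta\,|\nabla V_\delta|^2\,dx .$$ Since $F$ is harmonic in a neighbourhood of $\overline{B_{r_e}}$, it has there an expansion $F=c-\sum_{n\in\mathbb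 Z,\,n\ne0}a_n r^{|n|}e^{in\theta}$ for $r\le r_e$. Statements about a harmonic extension of $F$ refer to the restriction of $F$ to $B_{r_e}$. Bounds on functions are understood almost everywhere. Consider the boundedness property (B) if $F$ is bounded on $\{|x|>r_e^2/r_i\}$ (which is automatic if $f$ is supported in $B_{r_*}$), then there is a constant $C$ with $|V_\delta(x)|\le C$ for all $\delta>0$ and all $|x|>r_e^2/r_i$. (i) If $F$ does not extend as a harmonic function to $B_{r_*}$, then $\limsup_{\delta\to0^+}E_\delta=\infty$ and (B) holds (weak CALR, cloaking due to anomalous localized resonance). (ii) If the coefficients $a_n$ satisfy the gap condition, i.e. there are integers $n_1,n_2,\dots$ with $|n_1|<|n_2|<\cdots$ and $$\lim_{k\to\infty}\rho^{|n_{k+1}|-|n_k|}\,|n_k|\,|a_{n_k}|^2\,r_*^{2|n_k|}=\infty,$$ then $\lim_{\delta\to0^+}E_\delta=\infty$ and (B) holds (CALR). (iii) If $F$ extends as a harmonic function to an open neighbourhood of $\overline{B_{r_*}}$, then there is a constant $C$ with $E_\delta<C$ for all $\delta>0$. -/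

import Mathlib

open MeasureTheory Filter Topology Metric
open scoped ContDiff ENNReal

noncomputable section

/-- The Euclidean plane `ℝ²`. -/
abbrev Plane : Type := EuclideanSpace ℝ (Fin 2)

/-- Smooth compactly supported real test functions on the plane. -/
def IsTestFunction (φ : Plane → ℝ) : Prop :=
  ContDiff ℝ ∞ φ ∧ HasCompactSupport φ

/-- The partial derivative of `φ` in the `j`-th coordinate direction. -/
def partialDeriv (j : Fin 2) (φ : Plane → ℝ) (x : Plane) : ℝ :=
  fderiv ℝ φ x (EuclideanSpace.single j 1)

/-- `u` is in `W^{1,1}_loc(ℝ²; ℂ)` and `Du = (Du 0, Du 1)` is its weak gradient. -/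
def HasWeakGradient (u : Plane → ℂ) (Du : Fin 2 → Plane → ℂ) : Prop :=
  LocallyIntegrable u ∧ ∀ j, LocallyIntegrable (Du j) ∧
    ∀ φ, IsTestFunction φ →
      ∫ x, u x * (partialDeriv j φ x : ℂ) = - ∫ x, Du j x * (φ x : ℂ)

/-- The open annulus `B_{r_e} \ closure B_{r_i}` (the shell). -/
def shell (ri re : ℝ) : Set Plane := {x | ri < ‖x‖ ∧ ‖x‖ < re}

open Classical in
/-- The permittivity: `-1 + iδ` in the shell and `1` in the core and in the exterior (the two
circles form a null set, where the value is immaterial). -/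
def permittivity (ri re δ : ℝ) (x : Plane) : ℂ :=
  if x ∈ shell ri re then -1 + Complex.I * (δ : ℂ) else 1

/-- `V`, with weak gradient `DV`, is a weak solution of `∇ · (ε_δ ∇V) = f` in `ℝ²` with
`V(x) → 0` as `|x| → ∞`. As `V` is an almost-everywhere class, the limit at infinity
disregards null sets. -/
def IsDielectricSolution (ri re δ : ℝ) (f V : Plane → ℂ) (DV : Fin 2 → Plane → ℂ) : Prop :=
  HasWeakGradient V DV ∧
  (∀ φ, IsTestFunction φ →
    ∫ x, permittivity ri re δ x * ∑ j, DV j x * (partialDeriv j φ x : ℂ)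
      = - ∫ x, f x * (φ x : ℂ)) ∧
  Tendsto V (cocompact Plane ⊓ ae volume) (𝓝 0)

/-- The dissipated power `E_δ = ∫_{shell} δ |∇V|²`, as an extended nonnegative number. -/
def dissipation (ri re δ : ℝ) (DV : Fin 2 → Plane → ℂ) : ℝ≥0∞ :=
  ENNReal.ofReal δ * ∫⁻ x in shell ri re, ∑ j, ‖DV j x‖ₑ ^ 2

/-- The fundamental solution `(1 / 2π) log |x|` of the Laplacian in the plane. -/
def fundamentalSolution (x : Plane) : ℝ := 1 / (2 * Real.pi) * Real.log ‖x‖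

/-- The Newtonian potential of `f`. -/
def newtonianPotential (f : Plane → ℂ) (x : Plane) : ℂ :=
  ∫ y, (fundamentalSolution (x - y) : ℂ) * f y

/-- The critical radius `r_* = √(r_e³ / r_i)`. -/
def criticalRadius (ri re : ℝ) : ℝ := Real.sqrt (re ^ 3 / ri)

/-- The restriction of `F` to the disk `B_{r}` extends to a function that is harmonic in `U`. -/
def ExtendsHarmonically (r : ℝ) (F : Plane → ℂ) (U : Set Plane) : Prop :=
  ∃ H : Plane → ℂ, InnerProductSpace.HarmonicOnNhd H U ∧ Set.EqOn H F (ball 0 r)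

/-- The coefficients `a_n`, `n ≠ 0`, of the expansion `F = c - ∑_{n ≠ 0} a_n r^{|n|} e^{inθ}` of
a function `F` that is harmonic in a neighbourhood of the closed disk of radius `r₀`, as Fourier
coefficients on the circle of radius `r₀`. -/
def harmonicCoeff (r₀ : ℝ) (F : Plane → ℂ) (n : ℤ) : ℂ :=
  - (((r₀ ^ n.natAbs)⁻¹ * (1 / (2 * Real.pi)) : ℝ) : ℂ) *
    ∫ θ in (0 : ℝ)..(2 * Real.pi),
      F !₂[r₀ * Real.cos θ, r₀ * Real.sin θ] * Complex.exp (-(Complex.I * (n : ℂ) * (θ : ℂ)))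

/-- The gap condition on the coefficients `a_n`: there are `n_k` with `|n_1| < |n_2| < ⋯` and
`ρ^{|n_{k+1}| - |n_k|} |n_k| |a_{n_k}|² r_*^{2|n_k|} → ∞`, where `ρ = r_i / r_e`. -/
def GapCondition (ri re : ℝ) (a : ℤ → ℂ) : Prop :=
  ∃ n : ℕ → ℤ, StrictMono (fun k => (n k).natAbs) ∧
    Tendsto (fun k => (ri / re) ^ ((n (k + 1)).natAbs - (n k).natAbs) * ((n k).natAbs : ℝ) *
      ‖a (n k)‖ ^ 2 * criticalRadius ri re ^ (2 * (n k).natAbs)) atTop atTop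

/-- `u` is (essentially) bounded on `{|x| > a}` by the constant `C`. -/
def BoundedOutsideBy (a C : ℝ) (u : Plane → ℂ) : Prop :=
  ∀ᵐ x : Plane, a < ‖x‖ → ‖u x‖ ≤ C

/-- The family `V_δ`, `δ > 0`, is bounded on `{|x| > a}` by a constant independent of `δ`. -/
def UniformlyBoundedOutside (a : ℝ) (V : ℝ → Plane → ℂ) : Prop :=
  ∃ C : ℝ, ∀ δ, 0 < δ → BoundedOutsideBy a C (V δ)

end

/-! The permittivity is radial, so the problem splits into ordinary differential equations. Let v
and p be the n-th Fourier modes of V and of r∂_r V on the circle of radius r. Weakly on (0, ∞) they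
satisfy r v' = p and (εp)' = n² ε v / r + r f_n. Put m = |n|. Where ε is constant, p + m v and p - m
v can be integrated explicitly. Local integrability of the gradient excludes r^{-m} in the core,
decay at infinity fixes the growing part outside, and continuity of v and of the flux εp across the
two circles fixes the remaining constants (`IsRadialSolution.exists_shell_and_ext`,
`transmission_solution`). The mode n = 0 is harmless because the total charge vanishes
(`IsRadialSolution.shell_and_ext_zero`).

Write x = r_i^m and y = r_e^m. The shell amplitudes B of r^m and C of r^{-m}, and the exterior
correction D r^{-m} to the Newtonian potential, are explicit multiples of a_n divided by a
determinant of size δ²y² + x². Hence the mode n resonates near δ = ρ^m.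

Boundedness (B): since 2δxy ≤ δ²y² + x², the quantity |D| x / y² is at most a constant times |a_n|
y, uniformly in δ (`IsTransmissionSolution.norm_D_mul_le`). The weight x / y² is the value of r^{-m}
at r = r_e²/r_i. As the source keeps a positive distance from the disk, |a_n| y decays
geometrically, so the modes of V - F are summable for |x| > r_e²/r_i.

Blow-up: one mode alone gives E_δ ≥ c δ m y² |a_n|² / (δ² + ρ^{2m}) for δ ≤ 1
(`IsDielectricSolution.le_dissipation`). At δ = ρ^m this is a constant times m (|a_n| r_*^m)². If F
does not extend to the critical disk, the numbers |a_n| r_*^m are unbounded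
(`IsSource.extendsHarmonically`), which gives the limsup. Under the gap condition every small δ lies
between ρ^{|n_{k+1}|} and ρ^{|n_k|} for some k, and the mode n_k already dissipates enough.

Bounded energy: an extension beyond the critical disk bounds |a_n| t^m for some t > r_*
(`IsSource.exists_norm_sourceCoeff_le`). Then √δ times the n-th mode of the gradient in the shell is
at most of order m (r_*/t)^m. Summing over n bounds √δ |∇V| uniformly in the shell. -/

/-! ### Weak derivatives on open subsets of the line -/

/-- `h` is the weak derivative of `w` on the open set `U ⊆ ℝ`. -/
def HasWeakDerivOn (U : Set ℝ) (w h : ℝ → ℂ) : Prop :=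
  ∀ ξ : ℝ → ℝ, ContDiff ℝ ∞ ξ → HasCompactSupport ξ → tsupport ξ ⊆ U →
    ∫ x, w x * ((deriv ξ x : ℝ) : ℂ) = - ∫ x, h x * (ξ x : ℂ)

theorem MeasureTheory.LocallyIntegrableOn.integrable_mul_of_tsupport_subset {U : Set ℝ} {w : ℝ → ℂ}
    (hw : LocallyIntegrableOn w U) {ξ : ℝ → ℝ} (hξ : Continuous ξ) (hc : HasCompactSupport ξ)
    (hU : tsupport ξ ⊆ U) : Integrable (fun x => w x * (ξ x : ℂ)) := by
  have h1 : IntegrableOn w (tsupport ξ) := hw.integrableOn_compact_subset hU hc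
  have h2 : IntegrableOn (fun x => w x * (ξ x : ℂ)) (tsupport ξ) :=
    h1.mul_continuousOn (Complex.continuous_ofReal.comp hξ).continuousOn hc
  rw [← integrableOn_iff_integrable_of_support_subset (s := tsupport ξ)]
  · exact h2
  · intro x hx
    apply subset_tsupport
    intro h0
    simp [h0] at hx

theorem HasCompactSupport.of_tsupport_subset {ξ ζ : ℝ → ℝ} (hc : HasCompactSupport ξ)
    (h : tsupport ζ ⊆ tsupport ξ) : HasCompactSupport ζ :=
  hc.of_isClosed_subset (isClosed_tsupport _) h

theorem HasWeakDerivOn.mono {U U' : Set ℝ} {w h : ℝ → ℂ} (H : HasWeakDerivOn U w h)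
    (hU : U' ⊆ U) : HasWeakDerivOn U' w h :=
  fun ξ h1 h2 h3 => H ξ h1 h2 (h3.trans hU)

theorem mul_eq_mul_of_tsupport {U : Set ℝ} {w w' : ℝ → ℂ} {x : ℝ} (hx : x ∈ U → w x = w' x)
    {ξ : ℝ → ℝ} (hU : tsupport ξ ⊆ U) : w x * (ξ x : ℂ) = w' x * (ξ x : ℂ) := by
  by_cases hxU : x ∈ U
  · rw [hx hxU]
  · have : ξ x = 0 := image_eq_zero_of_notMem_tsupport (fun h => hxU (hU h))
    simp [this]

theorem HasWeakDerivOn.congr {U : Set ℝ} {w h w' h' : ℝ → ℂ} (H : HasWeakDerivOn U w h)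
    (hw : ∀ᵐ x, x ∈ U → w x = w' x) (hh : ∀ᵐ x, x ∈ U → h x = h' x) :
    HasWeakDerivOn U w' h' := by
  intro ξ h1 h2 h3
  have e1 : ∫ x, w' x * ((deriv ξ x : ℝ) : ℂ) = ∫ x, w x * ((deriv ξ x : ℝ) : ℂ) := by
    apply integral_congr_ae
    filter_upwards [hw] with x hx
    exact (mul_eq_mul_of_tsupport hx ((tsupport_deriv_subset).trans h3)).symm
  have e2 : ∫ x, h' x * (ξ x : ℂ) = ∫ x, h x * (ξ x : ℂ) := by
    apply integral_congr_ae
    filter_upwards [hh] with x hx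
    exact (mul_eq_mul_of_tsupport hx h3).symm
  rw [e1, e2]
  exact H ξ h1 h2 h3

theorem HasWeakDerivOn.const_mul {U : Set ℝ} {w h : ℝ → ℂ} (H : HasWeakDerivOn U w h) (c : ℂ) :
    HasWeakDerivOn U (fun x => c * w x) (fun x => c * h x) := by
  intro ξ h1 h2 h3
  simp only [mul_assoc, integral_const_mul, H ξ h1 h2 h3, mul_neg]

theorem HasWeakDerivOn.add {U : Set ℝ} {w h w' h' : ℝ → ℂ} (H : HasWeakDerivOn U w h)
    (H' : HasWeakDerivOn U w' h') (iw : LocallyIntegrableOn w U) (ih : LocallyIntegrableOn h U)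
    (iw' : LocallyIntegrableOn w' U) (ih' : LocallyIntegrableOn h' U) :
    HasWeakDerivOn U (fun x => w x + w' x) (fun x => h x + h' x) := by
  intro ξ h1 h2 h3
  have hd : Continuous (deriv ξ) := h1.continuous_deriv (by simp)
  have hdc : HasCompactSupport (deriv ξ) := h2.deriv
  have hds : tsupport (deriv ξ) ⊆ U := (tsupport_deriv_subset).trans h3
  simp only [add_mul]
  rw [integral_add (iw.integrable_mul_of_tsupport_subset hd hdc hds)
      (iw'.integrable_mul_of_tsupport_subset hd hdc hds),
    integral_add (ih.integrable_mul_of_tsupport_subset h1.continuous h2 h3)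
      (ih'.integrable_mul_of_tsupport_subset h1.continuous h2 h3), H ξ h1 h2 h3, H' ξ h1 h2 h3]
  ring

/-- Near a point outside `U` the product vanishes identically, so `c` may be singular there. This
admits factors such as r⁻¹, r^s and log r, which are smooth only away from the origin. -/
theorem contDiff_mul_of_tsupport_subset {U : Set ℝ} (hUo : IsOpen U) {ξ c : ℝ → ℝ}
    (h1 : ContDiff ℝ ∞ ξ) (h3 : tsupport ξ ⊆ U) (hc : ContDiffOn ℝ ∞ c U) :
    ContDiff ℝ ∞ (fun x => c x * ξ x) := by
  rw [contDiff_iff_contDiffAt]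
  intro x
  by_cases hx : x ∈ U
  · exact (hc.contDiffAt (hUo.mem_nhds hx)).mul h1.contDiffAt
  · have hx' : x ∉ tsupport ξ := fun h => hx (h3 h)
    have : (fun x => c x * ξ x) =ᶠ[𝓝 x] fun _ => 0 := by
      filter_upwards [notMem_tsupport_iff_eventuallyEq.1 hx'] with y hy
      simp [hy]
    exact contDiffAt_const.congr_of_eventuallyEq this

/-- The Leibniz rule for the product with a smooth function. -/
theorem HasWeakDerivOn.smooth_mul {U : Set ℝ} (hUo : IsOpen U) {w h : ℝ → ℂ}
    (H : HasWeakDerivOn U w h) (iw : LocallyIntegrableOn w U) (ih : LocallyIntegrableOn h U)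
    {c : ℝ → ℝ} (hc : ContDiffOn ℝ ∞ c U) :
    HasWeakDerivOn U (fun x => c x * w x) (fun x => c x * h x + deriv c x * w x) := by
  intro ξ h1 h2 h3
  have hζ := contDiff_mul_of_tsupport_subset hUo h1 h3 hc
  have hsub : tsupport (fun x => c x * ξ x) ⊆ tsupport ξ := tsupport_mul_subset_right
  have hζc : HasCompactSupport (fun x => c x * ξ x) := h2.of_tsupport_subset hsub
  -- Test with `c ξ` in place of `ξ`; the term in which the derivative falls on `c` is moved to the
  -- other side.
  have hH := H _ hζ hζc (hsub.trans h3)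
  have hdc : ContDiffOn ℝ ∞ (deriv c) U := hc.deriv_of_isOpen hUo (by simp)
  have hζ2 := contDiff_mul_of_tsupport_subset hUo h1 h3 hdc
  have hsub2 : tsupport (fun x => deriv c x * ξ x) ⊆ tsupport ξ := tsupport_mul_subset_right
  have key : ∀ x, w x * ((deriv (fun x => c x * ξ x) x : ℝ) : ℂ)
      = c x * w x * ((deriv ξ x : ℝ) : ℂ) + w x * ((deriv c x * ξ x : ℝ) : ℂ) := by
    intro x
    by_cases hx : x ∈ U
    · have hcx : DifferentiableAt ℝ c x :=
        (hc.contDiffAt (hUo.mem_nhds hx)).differentiableAt (by simp)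
      have hξx : DifferentiableAt ℝ ξ x := h1.contDiffAt.differentiableAt (by simp)
      rw [deriv_fun_mul hcx hξx]
      push_cast
      ring
    · have z1 : deriv (fun x => c x * ξ x) x = 0 := image_eq_zero_of_notMem_tsupport
        (fun hh => hx (h3 (hsub (tsupport_deriv_subset hh))))
      have z2 : deriv ξ x = 0 := image_eq_zero_of_notMem_tsupport
        (fun hh => hx (h3 (tsupport_deriv_subset hh)))
      have z3 : ξ x = 0 := image_eq_zero_of_notMem_tsupport (fun hh => hx (h3 hh))
      simp [z1, z2, z3]
  have i2 : Integrable (fun x => w x * ((deriv c x * ξ x : ℝ) : ℂ)) :=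
    iw.integrable_mul_of_tsupport_subset hζ2.continuous (h2.of_tsupport_subset hsub2)
      (hsub2.trans h3)
  have i0 : Integrable (fun x => w x * ((deriv (fun x => c x * ξ x) x : ℝ) : ℂ)) :=
    iw.integrable_mul_of_tsupport_subset (hζ.continuous_deriv (by simp)) hζc.deriv
      ((tsupport_deriv_subset).trans (hsub.trans h3))
  have i3 : Integrable (fun x => h x * ((c x * ξ x : ℝ) : ℂ)) :=
    ih.integrable_mul_of_tsupport_subset hζ.continuous hζc (hsub.trans h3)
  have e1 : ∫ x, c x * w x * ((deriv ξ x : ℝ) : ℂ)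
      = (∫ x, w x * ((deriv (fun x => c x * ξ x) x : ℝ) : ℂ))
        - ∫ x, w x * ((deriv c x * ξ x : ℝ) : ℂ) := by
    rw [← integral_sub i0 i2]
    congr 1; ext x; rw [key]; ring
  rw [e1, hH, ← neg_add', ← integral_add i3 i2]
  congr 2; ext x; push_cast; ring

/-- Integration by parts against a primitive of an integrable function. -/
theorem integral_primitive_mul_deriv {a b : ℝ} (hab : a ≤ b) {h : ℝ → ℂ}
    (hh : IntegrableOn h (Set.Icc a b)) {ξ : ℝ → ℝ} (hξ : ContDiff ℝ 1 ξ) (hb : ξ b = 0) :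
    ∫ x in a..b, (∫ s in a..x, h s) * ((deriv ξ x : ℝ) : ℂ) = - ∫ x in a..b, h x * (ξ x : ℂ) := by
  have hh' : Integrable h (volume.restrict (Set.Ioc a b)) := hh.mono_set Set.Ioc_subset_Icc_self
  have hdc : Continuous (deriv ξ) := hξ.continuous_deriv le_rfl
  have hd' : Integrable (fun x => ((deriv ξ x : ℝ) : ℂ)) (volume.restrict (Set.Ioc a b)) :=
    (Complex.continuous_ofReal.comp hdc).integrableOn_Ioc
  -- As `h` is merely integrable, the integrals are exchanged over the triangle s ≤ x; the inner
  -- integral of ξ' over [s, b] is -ξ(s) because ξ(b) = 0.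
  let S : Set (ℝ × ℝ) := {q | q.2 ≤ q.1}
  have hS : MeasurableSet S := measurableSet_le measurable_snd measurable_fst
  have hprod : Integrable (Function.uncurry fun x s : ℝ =>
      Set.indicator S (fun q => h q.2 * ((deriv ξ q.1 : ℝ) : ℂ)) (x, s))
      ((volume.restrict (Set.Ioc a b)).prod (volume.restrict (Set.Ioc a b))) := by
    have := (hd'.mul_prod hh').indicator hS
    refine this.congr (Eventually.of_forall ?_)
    rintro ⟨x, s⟩
    simp [Function.uncurry, Set.indicator, mul_comm]
  rw [intervalIntegral.integral_of_le hab, intervalIntegral.integral_of_le hab]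
  calc ∫ x in Set.Ioc a b, (∫ s in a..x, h s) * ((deriv ξ x : ℝ) : ℂ)
      = ∫ x in Set.Ioc a b, ∫ s in Set.Ioc a b,
          Set.indicator S (fun q => h q.2 * ((deriv ξ q.1 : ℝ) : ℂ)) (x, s) := by
        apply setIntegral_congr_fun measurableSet_Ioc
        intro x hx
        have : ∀ s, Set.indicator S (fun q => h q.2 * ((deriv ξ q.1 : ℝ) : ℂ)) (x, s)
            = Set.indicator (Set.Iic x) h s * ((deriv ξ x : ℝ) : ℂ) := by
          intro s; by_cases hs : s ≤ x <;> simp [Set.indicator, S, hs]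
        simp only [this]
        rw [integral_mul_const, setIntegral_indicator measurableSet_Iic,
          intervalIntegral.integral_of_le hx.1.le]
        congr 3
        ext s; simp only [Set.mem_Ioc, Set.mem_inter_iff, Set.mem_Iic]
        exact ⟨fun hs => ⟨⟨hs.1, hs.2.trans hx.2⟩, hs.2⟩, fun hs => ⟨hs.1.1, hs.2⟩⟩
    _ = ∫ s in Set.Ioc a b, ∫ x in Set.Ioc a b,
          Set.indicator S (fun q => h q.2 * ((deriv ξ q.1 : ℝ) : ℂ)) (x, s) :=
        integral_integral_swap hprod
    _ = ∫ s in Set.Ioc a b, - (h s * (ξ s : ℂ)) := by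
        apply setIntegral_congr_fun measurableSet_Ioc
        intro s hs
        have : ∀ x, Set.indicator S (fun q => h q.2 * ((deriv ξ q.1 : ℝ) : ℂ)) (x, s)
            = h s * Set.indicator (Set.Ici s) (fun x => ((deriv ξ x : ℝ) : ℂ)) x := by
          intro x; by_cases hs : s ≤ x <;> simp [Set.indicator, S, hs]
        simp only [this]
        rw [integral_const_mul, setIntegral_indicator measurableSet_Ici]
        have e : Set.Ioc a b ∩ Set.Ici s = Set.Icc s b := by
          ext x; simp only [Set.mem_Ioc, Set.mem_inter_iff, Set.mem_Ici, Set.mem_Icc]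
          exact ⟨fun h => ⟨h.2, h.1.2⟩, fun h => ⟨⟨hs.1.trans_le h.1, h.2⟩, h.1⟩⟩
        have e2 : ∫ x in Set.Icc s b, ((deriv ξ x : ℝ) : ℂ) = - (ξ s : ℂ) := by
          rw [integral_complex_ofReal, integral_Icc_eq_integral_Ioc,
            ← intervalIntegral.integral_of_le hs.2,
            intervalIntegral.integral_deriv_eq_sub
              (fun x _ => (hξ.differentiable one_ne_zero) x) (hdc.intervalIntegrable _ _), hb]
          simp
        rw [e, e2, mul_neg]
    _ = _ := integral_neg _

/-- The primitive taken from the left end of the support is zero to the left of it, and zero again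
to the right because the total integral vanishes. Order-connectedness of `U` keeps the interval hull
of the support inside `U`. -/
theorem exists_primitive_of_integral_eq_zero {U : Set ℝ} (hU : U.OrdConnected) {ψ : ℝ → ℝ}
    (h1 : ContDiff ℝ ∞ ψ) (h2 : HasCompactSupport ψ) (h3 : tsupport ψ ⊆ U)
    (h0 : ∫ x, ψ x = 0) :
    ∃ η : ℝ → ℝ, ContDiff ℝ ∞ η ∧ HasCompactSupport η ∧ tsupport η ⊆ U ∧ deriv η = ψ := by
  by_cases hne : (tsupport ψ).Nonempty
  swap
  · have hψ : ψ = 0 := by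
      rw [Set.not_nonempty_iff_eq_empty, tsupport_eq_empty_iff] at hne
      exact hne
    exact ⟨0, contDiff_const, HasCompactSupport.zero, by simp [tsupport], by simp [hψ]⟩
  obtain ⟨a, haS, hamin⟩ := IsCompact.exists_isMinOn h2 hne continuousOn_id
  obtain ⟨b, hbS, hbmax⟩ := IsCompact.exists_isMaxOn h2 hne continuousOn_id
  have hsub : tsupport ψ ⊆ Set.Icc a b := fun x hx => ⟨hamin hx, hbmax hx⟩
  have hab : a ≤ b := hamin hbS
  have hz : ∀ x, x ∉ Set.Icc a b → ψ x = 0 := fun x hx =>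
    image_eq_zero_of_notMem_tsupport (fun h => hx (hsub h))
  have hderiv : ∀ x, HasDerivAt (fun x => ∫ s in a..x, ψ s) (ψ x) x := fun x =>
    intervalIntegral.integral_hasDerivAt_right (h1.continuous.intervalIntegrable _ _)
      (h1.continuous.stronglyMeasurableAtFilter _ _) h1.continuous.continuousAt
  have hde : deriv (fun x => ∫ s in a..x, ψ s) = ψ := funext fun x => (hderiv x).deriv
  have hab0 : ∫ s in a..b, ψ s = 0 := by
    rw [intervalIntegral.integral_of_le hab, ← integral_Icc_eq_integral_Ioc, ← h0]
    exact setIntegral_eq_integral_of_forall_compl_eq_zero hz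
  have hηz : ∀ x, x ∉ Set.Icc a b → ∫ s in a..x, ψ s = 0 := by
    intro x hx
    rcases lt_or_ge x a with hxa | hxa
    · rw [intervalIntegral.integral_symm, intervalIntegral.integral_of_le hxa.le,
        ← integral_Ico_eq_integral_Ioc, setIntegral_eq_zero_of_forall_eq_zero, neg_zero]
      intro y hy
      exact hz y (fun h => absurd h.1 (not_le.2 hy.2))
    · have hxb : b < x := by
        by_contra hxb; exact hx ⟨hxa, not_lt.1 hxb⟩
      rw [← intervalIntegral.integral_add_adjacent_intervals
        (h1.continuous.intervalIntegrable a b) (h1.continuous.intervalIntegrable b x), hab0,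
        zero_add, intervalIntegral.integral_of_le hxb.le, setIntegral_eq_zero_of_forall_eq_zero]
      intro y hy
      exact hz y (fun h => absurd h.2 (not_le.2 hy.1))
  have hts : tsupport (fun x => ∫ s in a..x, ψ s) ⊆ Set.Icc a b := by
    apply closure_minimal _ isClosed_Icc
    intro x hx
    by_contra hx'
    exact hx (hηz x hx')
  refine ⟨fun x => ∫ s in a..x, ψ s, ?_, ?_, ?_, hde⟩
  · rw [contDiff_infty_iff_deriv, hde]
    exact ⟨fun x => (hderiv x).differentiableAt, h1⟩
  · exact isCompact_Icc.of_isClosed_subset (isClosed_tsupport _) hts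
  · exact hts.trans (hU.out (h3 haS) (h3 hbS))

theorem exists_test_integral_eq_one {U : Set ℝ} (hUo : IsOpen U) (hne : U.Nonempty) :
    ∃ ψ : ℝ → ℝ, ContDiff ℝ ∞ ψ ∧ HasCompactSupport ψ ∧ tsupport ψ ⊆ U ∧ ∫ x, ψ x = 1 := by
  obtain ⟨c, hc⟩ := hne
  obtain ⟨ε, hε, hsub⟩ := Metric.isOpen_iff.1 hUo c hc
  let f : ContDiffBump c := ⟨ε / 4, ε / 2, by positivity, by linarith⟩
  refine ⟨f.normed volume, f.contDiff_normed, f.hasCompactSupport_normed, ?_, f.integral_normed⟩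
  rw [f.tsupport_normed_eq]
  refine (Metric.closedBall_subset_ball ?_).trans hsub
  change ε / 2 < ε
  linarith

/-- The du Bois-Reymond lemma. -/
theorem HasWeakDerivOn.ae_eq_const {U : Set ℝ} (hUo : IsOpen U) (hU : U.OrdConnected)
    (hne : U.Nonempty) {w : ℝ → ℂ} (iw : LocallyIntegrableOn w U)
    (H : HasWeakDerivOn U w 0) : ∃ C : ℂ, ∀ᵐ x, x ∈ U → w x = C := by
  obtain ⟨ψ, p1, p2, p3, p4⟩ := exists_test_integral_eq_one hUo hne
  refine ⟨∫ x, w x * (ψ x : ℂ), ?_⟩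
  set C := ∫ x, w x * (ψ x : ℂ) with hC
  suffices ∀ᵐ x, x ∈ U → w x - C = 0 by
    filter_upwards [this] with x hx hxU
    exact sub_eq_zero.1 (hx hxU)
  refine hUo.ae_eq_zero_of_integral_contDiff_smul_eq_zero
    (iw.sub (locallyIntegrableOn_const C)) ?_
  intro g g1 g2 g3
  -- Subtracting `c ψ` leaves a test function of integral zero. It is the derivative of a test
  -- function, so the hypothesis applies to it.
  set c := ∫ x, g x with hcdef
  have q1 : ContDiff ℝ ∞ (fun x => g x - c * ψ x) := g1.sub (contDiff_const.mul p1)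
  have q2 : HasCompactSupport (fun x => g x - c * ψ x) := g2.sub (p2.mul_left (f := fun _ => c))
  have q3 : tsupport (fun x => g x - c * ψ x) ⊆ U := by
    refine (tsupport_sub g (fun x => c * ψ x)).trans (Set.union_subset g3 ?_)
    exact (tsupport_mul_subset_right (f := fun _ => c)).trans p3
  have ig : Integrable g := g1.continuous.integrable_of_hasCompactSupport g2
  have iψ : Integrable ψ := p1.continuous.integrable_of_hasCompactSupport p2
  have q4 : ∫ x, (g x - c * ψ x) = 0 := by
    rw [integral_sub ig (iψ.const_mul c), integral_const_mul, p4]; simp [c]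
  obtain ⟨η, e1, e2, e3, e4⟩ := exists_primitive_of_integral_eq_zero hU q1 q2 q3 q4
  have hη := H η e1 e2 e3
  have iwg := iw.integrable_mul_of_tsupport_subset g1.continuous g2 g3
  have iwψ := iw.integrable_mul_of_tsupport_subset p1.continuous p2 p3
  have hη' : (∫ x, w x * (g x : ℂ)) - c * C = 0 := by
    rw [e4] at hη
    simp only [Pi.zero_apply, zero_mul, integral_zero, neg_zero] at hη
    rw [← hη, hC, ← integral_const_mul, ← integral_sub iwg (iwψ.const_mul _)]
    congr 1; ext x; push_cast; ring
  have e5 : ∀ x, g x • (w x - C) = w x * (g x : ℂ) - C * (g x : ℂ) := by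
    intro x; rw [Complex.real_smul]; ring
  have e6 : ∫ x, (w x * (g x : ℂ) - C * (g x : ℂ)) = 0 := by
    have igc : Integrable (fun x => C * (g x : ℂ)) := ig.ofReal.const_mul C
    rw [integral_sub iwg igc, integral_const_mul, integral_complex_ofReal,
      ← hcdef, mul_comm C]
    exact hη'
  simp only [e5]
  exact e6

theorem intervalIntegrable_of_locallyIntegrableOn {U : Set ℝ} (hU : U.OrdConnected) {h : ℝ → ℂ}
    (ih : LocallyIntegrableOn h U) {a b : ℝ} (ha : a ∈ U) (hb : b ∈ U) :
    IntervalIntegrable h volume a b :=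
  (ih.integrableOn_compact_subset (hU.uIcc_subset ha hb) isCompact_uIcc).intervalIntegrable

theorem continuousOn_primitive_of_locallyIntegrableOn {U : Set ℝ} (hUo : IsOpen U)
    (hU : U.OrdConnected) {h : ℝ → ℂ} (ih : LocallyIntegrableOn h U) {c : ℝ} (hc : c ∈ U) :
    ContinuousOn (fun x => ∫ s in c..x, h s) U := by
  have hII := fun a (ha : a ∈ U) b (hb : b ∈ U) =>
    intervalIntegrable_of_locallyIntegrableOn hU ih ha hb
  intro x hx
  obtain ⟨ε, hε, hsub⟩ := Metric.isOpen_iff.1 hUo x hx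
  have ha : x - ε / 2 ∈ U := hsub (by simp [abs_of_pos hε]; linarith)
  have hb : x + ε / 2 ∈ U := hsub (by simp [abs_of_pos hε]; linarith)
  have h1 : ContinuousOn (fun y => ∫ s in (x - ε / 2)..y, h s)
      (Set.Icc (x - ε / 2) (x + ε / 2)) :=
    intervalIntegral.continuousOn_primitive_interval
      (ih.integrableOn_compact_subset (hU.uIcc_subset ha hb) isCompact_uIcc) |>.mono
      Set.Icc_subset_uIcc
  have h2 : ContinuousAt (fun y => ∫ s in (x - ε / 2)..y, h s) x :=
    h1.continuousAt (Icc_mem_nhds (by linarith) (by linarith))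
  have h3 : (fun y => ∫ s in c..y, h s)
      =ᶠ[𝓝 x] fun y => (∫ s in c..(x - ε / 2), h s) + ∫ s in (x - ε / 2)..y, h s := by
    filter_upwards [hUo.mem_nhds hx] with y hy
    exact (intervalIntegral.integral_add_adjacent_intervals (hII _ hc _ ha)
      (hII _ ha _ hy)).symm
  exact ((continuousAt_const.add h2).congr h3.symm).continuousWithinAt

/-- A function with a locally integrable weak derivative is a primitive of that derivative. -/
theorem HasWeakDerivOn.ae_eq_primitive {U : Set ℝ} (hUo : IsOpen U) (hU : U.OrdConnected)
    {w h : ℝ → ℂ} (iw : LocallyIntegrableOn w U) (ih : LocallyIntegrableOn h U)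
    (H : HasWeakDerivOn U w h) {c : ℝ} (hc : c ∈ U) :
    ∃ C : ℂ, ∀ᵐ x, x ∈ U → w x = C + ∫ s in c..x, h s := by
  have hII := fun a (ha : a ∈ U) b (hb : b ∈ U) =>
    intervalIntegrable_of_locallyIntegrableOn hU ih ha hb
  have hcont := continuousOn_primitive_of_locallyIntegrableOn hUo hU ih hc
  have iW : LocallyIntegrableOn (fun x => ∫ s in c..x, h s) U :=
    hcont.locallyIntegrableOn hUo.measurableSet
  have HW : HasWeakDerivOn U (fun x => ∫ s in c..x, h s) h := by
    intro ξ h1 h2 h3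
    by_cases hne : (tsupport ξ).Nonempty
    swap
    · have hξ : ξ = 0 := by
        rw [Set.not_nonempty_iff_eq_empty, tsupport_eq_empty_iff] at hne
        exact hne
      simp [hξ]
    obtain ⟨a, haS, hamin⟩ := IsCompact.exists_isMinOn h2 hne continuousOn_id
    obtain ⟨b, hbS, hbmax⟩ := IsCompact.exists_isMaxOn h2 hne continuousOn_id
    have haU := h3 haS
    have hbU := h3 hbS
    obtain ⟨ε, hε, hsub⟩ := Metric.isOpen_iff.1 hUo b hbU
    obtain ⟨ε', hε', hsub'⟩ := Metric.isOpen_iff.1 hUo a haU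
    -- Enlarging the hull of the support slightly within `U` makes `ξ` vanish at both end points.
    set b' := b + ε / 2 with hb'
    set a' := a - ε' / 2 with ha'
    have hb'U : b' ∈ U := hsub (by simp [b', abs_of_pos hε]; linarith)
    have ha'U : a' ∈ U := hsub' (by simp [a', abs_of_pos hε']; linarith)
    have hab : a ≤ b := hamin hbS
    have hab' : a' ≤ b' := by simp only [a', b']; linarith
    have hz : ∀ x, x ∉ Set.Ioc a' b' → x ∉ tsupport ξ := by
      intro x hx hx'
      have h1 : a ≤ x := hamin hx'
      have h2 : x ≤ b := hbmax hx'
      exact hx ⟨by simp only [a']; linarith, by simp only [b']; linarith⟩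
    have hξb : ξ b' = 0 := by
      apply image_eq_zero_of_notMem_tsupport
      intro hx'
      have h2 : b' ≤ b := hbmax hx'
      simp only [b'] at h2; linarith
    have hξa : ξ a' = 0 := image_eq_zero_of_notMem_tsupport
      (hz a' (fun h => lt_irrefl _ h.1))
    have toI : ∀ (k : ℝ → ℂ) (ζ : ℝ → ℝ), tsupport ζ ⊆ tsupport ξ →
        ∫ x, k x * (ζ x : ℂ) = ∫ x in a'..b', k x * (ζ x : ℂ) := by
      intro k ζ hζ
      rw [intervalIntegral.integral_of_le hab']
      symm
      apply setIntegral_eq_integral_of_forall_compl_eq_zero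
      intro x hx
      simp [image_eq_zero_of_notMem_tsupport (fun h => hz x hx (hζ h))]
    rw [toI _ _ (tsupport_deriv_subset), toI _ _ subset_rfl]
    have hIc : IntegrableOn h (Set.Icc a' b') :=
      ih.integrableOn_compact_subset (hU.out ha'U hb'U) isCompact_Icc
    rw [← integral_primitive_mul_deriv hab' hIc (h1.of_le (by simp)) hξb]
    have hd : Continuous (deriv ξ) := h1.continuous_deriv (by simp)
    have e1 : ∫ x in a'..b', (∫ s in c..x, h s) * ((deriv ξ x : ℝ) : ℂ)
        = ∫ x in a'..b', ((∫ s in c..a', h s) * ((deriv ξ x : ℝ) : ℂ)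
          + (∫ s in a'..x, h s) * ((deriv ξ x : ℝ) : ℂ)) := by
      apply intervalIntegral.integral_congr
      intro x hx
      rw [Set.uIcc_of_le hab'] at hx
      have hxU := hU.out ha'U hb'U hx
      simp only
      rw [← add_mul, intervalIntegral.integral_add_adjacent_intervals (hII _ hc _ ha'U)
        (hII _ ha'U _ hxU)]
    rw [e1, intervalIntegral.integral_add]
    · rw [intervalIntegral.integral_const_mul, intervalIntegral.integral_ofReal,
        intervalIntegral.integral_deriv_eq_sub
          (fun x _ => (h1.differentiable (by simp)) x) (hd.intervalIntegrable _ _), hξa, hξb]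
      simp
    · exact ((continuous_const.mul (Complex.continuous_ofReal.comp hd)).intervalIntegrable _ _)
    · apply ContinuousOn.intervalIntegrable
      apply ContinuousOn.mul _ (Complex.continuous_ofReal.comp hd).continuousOn
      exact intervalIntegral.continuousOn_primitive_interval
        (by rwa [Set.uIcc_of_le hab'])
  have Hd : HasWeakDerivOn U (fun x => w x + (-1) * ∫ s in c..x, h s) 0 := by
    refine (H.add (HW.const_mul (-1)) iw ih (iW.smul (-1 : ℂ)) (ih.smul (-1 : ℂ))).congr
      (Eventually.of_forall fun x _ => rfl) (Eventually.of_forall fun x _ => by simp)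
  obtain ⟨C, hC⟩ := Hd.ae_eq_const hUo hU ⟨c, hc⟩ (iw.add (iW.smul (-1 : ℂ)))
  refine ⟨C, ?_⟩
  filter_upwards [hC] with x hx hxU
  have := hx hxU
  simp only [Pi.add_apply, Pi.smul_apply, smul_eq_mul] at this
  rw [← this]; ring

theorem HasWeakDerivOn.exists_continuousOn {U : Set ℝ} (hUo : IsOpen U) (hU : U.OrdConnected)
    {w h : ℝ → ℂ} (iw : LocallyIntegrableOn w U) (ih : LocallyIntegrableOn h U)
    (H : HasWeakDerivOn U w h) {c : ℝ} (hc : c ∈ U) :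
    ∃ φ : ℝ → ℂ, ContinuousOn φ U ∧ ∀ᵐ x, x ∈ U → w x = φ x := by
  obtain ⟨C, hC⟩ := H.ae_eq_primitive hUo hU iw ih hc
  exact ⟨_, continuousOn_const.add (continuousOn_primitive_of_locallyIntegrableOn hUo hU ih hc), hC⟩

/-- If the two values differed, the functions would differ on a whole interval to the left of `x`,
which has positive measure. In this way the value at an interface is read off from a formula valid
almost everywhere on one side. -/
theorem eq_of_continuousAt_of_ae_eq_left {φ f : ℝ → ℂ} {a x : ℝ} (hax : a < x)
    (hφ : ContinuousAt φ x) (hf : ContinuousAt f x)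
    (h : ∀ᵐ y, y ∈ Set.Ioo a x → φ y = f y) : φ x = f x := by
  by_contra hne
  have h1 : ∀ᶠ y in 𝓝 x, φ y - f y ≠ 0 := (hφ.sub hf).eventually_ne (sub_ne_zero.2 hne)
  obtain ⟨ε, hε, hb⟩ := Metric.eventually_nhds_iff.1 h1
  have hsub : Set.Ioo (max a (x - ε)) x ⊆ {y | ¬ (y ∈ Set.Ioo a x → φ y = f y)} := by
    intro y hy hy'
    have hy1 : y ∈ Set.Ioo a x := ⟨(le_max_left _ _).trans_lt hy.1, hy.2⟩
    refine hb ?_ (sub_eq_zero.2 (hy' hy1))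
    have := (le_max_right a (x - ε)).trans_lt hy.1
    rw [Real.dist_eq, abs_lt]
    constructor <;> linarith [hy.2]
  have h0 := measure_mono_null hsub (ae_iff.1 h)
  rw [Real.volume_Ioo, ENNReal.ofReal_eq_zero] at h0
  have : max a (x - ε) < x := max_lt hax (by linarith)
  linarith

theorem eq_of_continuousAt_of_ae_eq_right {φ f : ℝ → ℂ} {b x : ℝ} (hxb : x < b)
    (hφ : ContinuousAt φ x) (hf : ContinuousAt f x)
    (h : ∀ᵐ y, y ∈ Set.Ioo x b → φ y = f y) : φ x = f x := by
  by_contra hne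
  have h1 : ∀ᶠ y in 𝓝 x, φ y - f y ≠ 0 := (hφ.sub hf).eventually_ne (sub_ne_zero.2 hne)
  obtain ⟨ε, hε, hb⟩ := Metric.eventually_nhds_iff.1 h1
  have hsub : Set.Ioo x (min b (x + ε)) ⊆ {y | ¬ (y ∈ Set.Ioo x b → φ y = f y)} := by
    intro y hy hy'
    have hy1 : y ∈ Set.Ioo x b := ⟨hy.1, hy.2.trans_le (min_le_left _ _)⟩
    refine hb ?_ (sub_eq_zero.2 (hy' hy1))
    have := hy.2.trans_le (min_le_right b (x + ε))
    rw [Real.dist_eq, abs_lt]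
    constructor <;> linarith [hy.1]
  have h0 := measure_mono_null hsub (ae_iff.1 h)
  rw [Real.volume_Ioo, ENNReal.ofReal_eq_zero] at h0
  have : x < min b (x + ε) := lt_min hxb (by linarith)
  linarith

/-! ### Polar coordinates in the plane and angular Fourier modes -/

/-- The point of the plane with polar coordinates `q = (r, θ)`. -/
noncomputable def polarMap (q : ℝ × ℝ) : Plane := !₂[q.1 * Real.cos q.2, q.1 * Real.sin q.2]

/-- The measure `r dr` on the half-line. -/
noncomputable def radialMeasure : Measure ℝ :=
  (volume.restrict (Set.Ioi 0)).withDensity fun r => ENNReal.ofReal r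

/-- The measure `dθ` on `(-π, π)`. -/
noncomputable def angularMeasure : Measure ℝ := volume.restrict (Set.Ioo (-Real.pi) Real.pi)

instance : SFinite radialMeasure := by unfold radialMeasure; infer_instance

instance : IsFiniteMeasure angularMeasure := by unfold angularMeasure; infer_instance

theorem measurable_polarMap : Measurable polarMap := by
  unfold polarMap
  have : Continuous fun q : ℝ × ℝ => (!₂[q.1 * Real.cos q.2, q.1 * Real.sin q.2] : Plane) := by
    fun_prop
  exact this.measurable

theorem norm_polarMap (q : ℝ × ℝ) : ‖polarMap q‖ = |q.1| := by
  rw [polarMap, EuclideanSpace.norm_eq, ← Real.sqrt_sq_eq_abs]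
  congr 1
  simp [Fin.sum_univ_two]
  nlinarith [Real.sin_sq_add_cos_sq q.2]

theorem radial_prod_angular :
    radialMeasure.prod angularMeasure =
      ((volume : Measure (ℝ × ℝ)).restrict (Set.Ioi 0 ×ˢ Set.Ioo (-Real.pi) Real.pi)).withDensity
        fun q => ENNReal.ofReal q.1 := by
  rw [radialMeasure, angularMeasure, prod_withDensity_left ENNReal.measurable_ofReal,
    Measure.prod_restrict, ← Measure.volume_eq_prod]

/-- This is the polar change of variables of the complex plane, carried over by an isometry. With
the Jacobian r built into `radialMeasure`, the map preserves measure and Fubini applies on a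
product. -/
theorem measurePreserving_polarMap :
    MeasurePreserving polarMap (radialMeasure.prod angularMeasure) volume := by
  refine ⟨measurable_polarMap, ?_⟩
  ext s hs
  have hmp := Complex.orthonormalBasisOneI.repr.measurePreserving
  have hs' : MeasurableSet (Complex.orthonormalBasisOneI.repr ⁻¹' s) := hmp.measurable hs
  rw [Measure.map_apply measurable_polarMap hs, radial_prod_angular,
    withDensity_apply _ (measurable_polarMap hs), ← hmp.measure_preimage hs.nullMeasurableSet,
    ← lintegral_indicator_one hs', ← Complex.lintegral_comp_polarCoord_symm,
    ← lintegral_indicator (measurable_polarMap hs)]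
  apply lintegral_congr
  intro q
  have e : polarMap q = Complex.orthonormalBasisOneI.repr (Complex.polarCoord.symm q) := by
    ext i
    rw [Complex.orthonormalBasisOneI_repr_apply]
    fin_cases i <;> simp [polarMap] <;> exact Or.inl rfl
  by_cases hq : polarMap q ∈ s
  · rw [Set.indicator_of_mem (show q ∈ polarMap ⁻¹' s from hq),
      Set.indicator_of_mem (show _ ∈ _ ⁻¹' s by rw [Set.mem_preimage, ← e]; exact hq)]
    simp
  · rw [Set.indicator_of_notMem (show q ∉ polarMap ⁻¹' s from hq),
      Set.indicator_of_notMem (show _ ∉ _ ⁻¹' s by rw [Set.mem_preimage, ← e]; exact hq)]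
    simp

/-- The density r is positive on the half-line, so the null sets there are those of Lebesgue
measure. -/
theorem ae_radialMeasure_iff {p : ℝ → Prop} :
    (∀ᵐ r ∂radialMeasure, p r) ↔ ∀ᵐ r, r ∈ Set.Ioi (0 : ℝ) → p r := by
  rw [radialMeasure, ae_withDensity_iff ENNReal.measurable_ofReal,
    ae_restrict_iff' measurableSet_Ioi]
  apply eventually_congr
  refine Eventually.of_forall fun r => ⟨fun h hr => h hr ?_, fun h hr _ => h hr⟩
  simpa using hr

/-- A property that holds almost everywhere in the plane holds at almost all angles of almost all
circles centred at the origin. -/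
theorem ae_ae_polarMap {p : Plane → Prop} (hp : ∀ᵐ x, p x) :
    ∀ᵐ r, r ∈ Set.Ioi (0 : ℝ) → ∀ᵐ θ ∂angularMeasure, p (polarMap (r, θ)) := by
  rw [← ae_radialMeasure_iff]
  exact Measure.ae_ae_of_ae_prod (measurePreserving_polarMap.quasiMeasurePreserving.ae hp)

theorem ae_of_ae_ae_polarMap {p : Plane → Prop} (hm : MeasurableSet {x | p x})
    (hp : ∀ᵐ r, r ∈ Set.Ioi (0 : ℝ) → ∀ᵐ θ ∂angularMeasure, p (polarMap (r, θ))) :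
    ∀ᵐ x, p x := by
  rw [← ae_radialMeasure_iff] at hp
  rw [← measurePreserving_polarMap.map_eq, ae_map_iff measurable_polarMap.aemeasurable hm]
  exact (Measure.ae_prod_iff_ae_ae (measurable_polarMap hm)).2 hp

theorem integrable_radialMeasure_iff {g : ℝ → ℂ} :
    Integrable g radialMeasure ↔ IntegrableOn (fun r : ℝ => (r : ℂ) * g r) (Set.Ioi 0) := by
  rw [radialMeasure, integrable_withDensity_iff_integrable_smul' ENNReal.measurable_ofReal
    (by simp)]
  apply integrable_congr
  filter_upwards [ae_restrict_mem measurableSet_Ioi] with r hr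
  rw [ENNReal.toReal_ofReal (le_of_lt hr), Complex.real_smul]

theorem integral_radialMeasure (g : ℝ → ℂ) :
    ∫ r, g r ∂radialMeasure = ∫ r in Set.Ioi (0 : ℝ), (r : ℂ) * g r := by
  rw [radialMeasure, integral_withDensity_eq_integral_toReal_smul ENNReal.measurable_ofReal
    (by simp)]
  apply setIntegral_congr_fun measurableSet_Ioi
  intro r hr
  simp only
  rw [ENNReal.toReal_ofReal (le_of_lt hr), Complex.real_smul]

/-- The point of the complex plane with the same coordinates. -/
noncomputable def toComplex (x : Plane) : ℂ := Complex.orthonormalBasisOneI.repr.symm x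

theorem toComplex_re (x : Plane) : (toComplex x).re = x 0 := by
  simp [toComplex, Complex.orthonormalBasisOneI_repr_symm_apply]

theorem toComplex_im (x : Plane) : (toComplex x).im = x 1 := by
  simp [toComplex, Complex.orthonormalBasisOneI_repr_symm_apply]

theorem norm_toComplex (x : Plane) : ‖toComplex x‖ = ‖x‖ :=
  LinearIsometryEquiv.norm_map _ _

theorem toComplex_polarMap (r θ : ℝ) :
    toComplex (polarMap (r, θ)) = r * Complex.exp (θ * Complex.I) := by
  apply Complex.ext
  · rw [toComplex_re]
    simp [polarMap, Complex.exp_re]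
  · rw [toComplex_im]
    simp [polarMap, Complex.exp_im]

/-- The function `e^{-inθ}` on the punctured plane. -/
noncomputable def angularMode (n : ℤ) (x : Plane) : ℂ :=
  ((starRingEnd ℂ) (toComplex x) / (‖x‖ : ℂ)) ^ n

theorem angularMode_polarMap (n : ℤ) {r : ℝ} (hr : 0 < r) (θ : ℝ) :
    angularMode n (polarMap (r, θ)) = Complex.exp (-(Complex.I * n * θ)) := by
  have hr' : (r : ℂ) ≠ 0 := by exact_mod_cast hr.ne'
  rw [angularMode, toComplex_polarMap, norm_polarMap]
  simp only [abs_of_pos hr, map_mul, Complex.conj_ofReal]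
  rw [mul_div_cancel_left₀ _ hr', ← Complex.exp_conj, ← Complex.exp_int_mul]
  congr 1
  simp
  ring

theorem norm_angularMode {x : Plane} (hx : x ≠ 0) (n : ℤ) : ‖angularMode n x‖ = 1 := by
  have : ‖x‖ ≠ 0 := norm_ne_zero_iff.2 hx
  rw [angularMode, norm_zpow, norm_div, RCLike.norm_conj, norm_toComplex, Complex.norm_real,
    norm_norm, div_self this, one_zpow]

theorem norm_exp_neg_I_mul (n : ℤ) (θ : ℝ) : ‖Complex.exp (-(Complex.I * n * θ))‖ = 1 := by
  rw [Complex.norm_exp]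
  simp

theorem continuous_exp_neg_I_mul (n : ℤ) :
    Continuous fun θ : ℝ => Complex.exp (-(Complex.I * n * θ)) := by fun_prop

/-- The `n`-th Fourier integral of `h` over the circle of radius `r`. -/
noncomputable def fourierMode (n : ℤ) (h : Plane → ℂ) (r : ℝ) : ℂ :=
  ∫ θ, h (polarMap (r, θ)) * Complex.exp (-(Complex.I * n * θ)) ∂angularMeasure

theorem Integrable.comp_polarMap_mul_exp {h : Plane → ℂ} (hh : Integrable h) (n : ℤ) :
    Integrable (fun q : ℝ × ℝ => h (polarMap q) * Complex.exp (-(Complex.I * n * q.2)))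
      (radialMeasure.prod angularMeasure) := by
  have h1 : Integrable (fun q => h (polarMap q)) (radialMeasure.prod angularMeasure) :=
    (measurePreserving_polarMap.integrable_comp hh.aestronglyMeasurable).2 hh
  refine h1.mul_bdd (c := 1) ?_ ?_
  · exact ((continuous_exp_neg_I_mul n).comp continuous_snd).aestronglyMeasurable
  · exact Eventually.of_forall fun q => (norm_exp_neg_I_mul n q.2).le

/-- Fubini yields integrability against r dr only. Hence the factor r that accompanies modes of
merely integrable functions. -/
theorem integrableOn_mul_fourierMode {h : Plane → ℂ} (hh : Integrable h) (n : ℤ) :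
    IntegrableOn (fun r : ℝ => (r : ℂ) * fourierMode n h r) (Set.Ioi 0) := by
  rw [← integrable_radialMeasure_iff]
  exact (Integrable.comp_polarMap_mul_exp hh n).integral_prod_left

theorem MeasureTheory.LocallyIntegrable.integrable_indicator_ball {h : Plane → ℂ}
    (hh : LocallyIntegrable h) (R : ℝ) : Integrable ((ball (0 : Plane) R).indicator h) := by
  rw [integrable_indicator_iff measurableSet_ball]
  exact (hh.integrableOn_isCompact (isCompact_closedBall (0 : Plane) R)).mono_set
    ball_subset_closedBall

theorem fourierMode_indicator_ball {h : Plane → ℂ} {R r : ℝ} (h0 : 0 < r) (hr : r < R) (n : ℤ) :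
    fourierMode n ((ball (0 : Plane) R).indicator h) r = fourierMode n h r := by
  unfold fourierMode
  congr 1; ext θ
  rw [Set.indicator_of_mem]
  rw [mem_ball_zero_iff, norm_polarMap, abs_of_pos h0]
  exact hr

theorem integrableOn_Ioo_mul_fourierMode {h : Plane → ℂ} (hh : LocallyIntegrable h) (n : ℤ)
    (R : ℝ) : IntegrableOn (fun r : ℝ => (r : ℂ) * fourierMode n h r) (Set.Ioo 0 R) := by
  have h1 : IntegrableOn (fun r : ℝ => (r : ℂ) * fourierMode n ((ball (0 : Plane) R).indicator h) r)
      (Set.Ioo 0 R) := by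
    have h2 := integrableOn_mul_fourierMode (hh.integrable_indicator_ball R) n
    exact h2.mono_set Set.Ioo_subset_Ioi_self
  refine h1.congr_fun ?_ measurableSet_Ioo
  intro r hr
  simp only
  rw [fourierMode_indicator_ball hr.1 hr.2]

theorem locallyIntegrableOn_of_mul {w : ℝ → ℂ}
    (hw : ∀ R, IntegrableOn (fun r : ℝ => (r : ℂ) * w r) (Set.Ioo 0 R)) :
    LocallyIntegrableOn w (Set.Ioi 0) := by
  rw [locallyIntegrableOn_iff (isOpen_Ioi.isLocallyClosed)]
  intro K hK hKc
  obtain ⟨R, hR⟩ := hKc.isBounded.subset_ball 0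
  have hsub : K ⊆ Set.Ioo 0 R := fun x hx => ⟨hK hx, by
    have := hR hx
    rw [mem_ball_zero_iff, Real.norm_eq_abs] at this
    exact (abs_lt.1 this).2⟩
  have h1 : IntegrableOn (fun r : ℝ => (r : ℂ)⁻¹ * ((r : ℂ) * w r)) K := by
    refine IntegrableOn.continuousOn_mul ?_ ((hw R).mono_set hsub) hKc
    apply ContinuousOn.inv₀ Complex.continuous_ofReal.continuousOn
    intro x hx
    have : (0 : ℝ) < x := hK hx
    exact_mod_cast this.ne'
  refine h1.congr_fun ?_ hKc.measurableSet
  intro r hr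
  have : (0 : ℝ) < r := hK hr
  have : (r : ℂ) ≠ 0 := by exact_mod_cast this.ne'
  simp only
  field_simp

theorem locallyIntegrableOn_fourierMode {h : Plane → ℂ} (hh : LocallyIntegrable h) (n : ℤ) :
    LocallyIntegrableOn (fourierMode n h) (Set.Ioi 0) :=
  locallyIntegrableOn_of_mul fun R => integrableOn_Ioo_mul_fourierMode hh n R

theorem measurable_toComplex : Measurable toComplex :=
  (LinearIsometryEquiv.continuous _).measurable

theorem measurable_angularMode (n : ℤ) : Measurable (angularMode n) := by
  unfold angularMode
  exact ((Complex.continuous_conj.measurable.comp measurable_toComplex).div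
    (Complex.measurable_ofReal.comp measurable_norm)).pow_const n

theorem norm_angularMode_le {x : Plane} (n : ℤ) : ‖angularMode n x‖ ≤ 1 := by
  by_cases hx : x = 0
  · subst hx
    rw [angularMode]
    by_cases hn : n = 0
    · simp [hn]
    · simp [zero_zpow n hn]
  · exact (norm_angularMode hx n).le

/-- Integrating first over circles, a test function of the form α(r) e^{-inθ} sees only the n-th
mode of `h`. The extra factor r on the right is the Jacobian. -/
theorem integral_mul_angularMode_of_integrable {h : Plane → ℂ} {α : ℝ → ℝ} {n : ℤ}
    (hint : Integrable (fun x => h x * ((α ‖x‖ : ℂ) * angularMode n x))) :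
    ∫ x, h x * ((α ‖x‖ : ℂ) * angularMode n x)
      = ∫ r in Set.Ioi (0 : ℝ), fourierMode n h r * ((r * α r : ℝ) : ℂ) := by
  have hcomp : Integrable (fun q => h (polarMap q) * ((α ‖polarMap q‖ : ℂ)
      * angularMode n (polarMap q))) (radialMeasure.prod angularMeasure) :=
    (measurePreserving_polarMap.integrable_comp hint.aestronglyMeasurable).2 hint
  rw [← measurePreserving_polarMap.map_eq, integral_map measurable_polarMap.aemeasurable
    (by rw [measurePreserving_polarMap.map_eq]; exact hint.aestronglyMeasurable),
    integral_prod _ hcomp, integral_radialMeasure]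
  apply setIntegral_congr_fun measurableSet_Ioi
  intro r hr
  simp only
  have : ∀ θ : ℝ, h (polarMap (r, θ)) * ((α ‖polarMap (r, θ)‖ : ℂ)
      * angularMode n (polarMap (r, θ)))
      = (h (polarMap (r, θ)) * Complex.exp (-(Complex.I * n * θ))) * (α r : ℂ) := by
    intro θ
    rw [angularMode_polarMap n hr, norm_polarMap]
    simp only [abs_of_pos (show (0 : ℝ) < r from hr)]
    ring
  simp only [this]
  rw [integral_mul_const, fourierMode]
  push_cast
  ring

theorem integral_mul_radial_mul_angularMode {h : Plane → ℂ} (hh : LocallyIntegrable h) (n : ℤ)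
    {α : ℝ → ℝ} (hα : Continuous α) (hc : HasCompactSupport α) (hs : tsupport α ⊆ Set.Ioi 0) :
    Integrable (fun x => h x * ((α ‖x‖ : ℂ) * angularMode n x)) ∧
    ∫ x, h x * ((α ‖x‖ : ℂ) * angularMode n x) = ∫ r, fourierMode n h r * ((r * α r : ℝ) : ℂ) := by
  obtain ⟨R, hR⟩ := hc.isBounded.subset_ball 0
  have hz : ∀ r : ℝ, 0 ≤ r → R ≤ r → α r = 0 := by
    intro r h0 hr
    apply image_eq_zero_of_notMem_tsupport
    intro hmem
    have := hR hmem
    rw [mem_ball_zero_iff, Real.norm_eq_abs, abs_of_nonneg h0] at this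
    linarith
  obtain ⟨C, hC⟩ := hα.bounded_above_of_compact_support hc
  have hint : Integrable (fun x => h x * ((α ‖x‖ : ℂ) * angularMode n x)) := by
    have h1 := (hh.integrable_indicator_ball R).mul_bdd (c := C)
      (g := fun x : Plane => (α ‖x‖ : ℂ) * angularMode n x) ?_ ?_
    · refine h1.congr (Eventually.of_forall fun x => ?_)
      simp only [Set.indicator]
      split_ifs with hx
      · rfl
      · rw [mem_ball_zero_iff, not_lt] at hx
        simp [hz _ (norm_nonneg x) hx]
    · exact ((Complex.continuous_ofReal.comp (hα.comp continuous_norm)).measurable.mul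
        (measurable_angularMode n)).aestronglyMeasurable
    · refine Eventually.of_forall fun x => ?_
      rw [norm_mul]
      calc _ ≤ C * 1 := by
            apply mul_le_mul _ (norm_angularMode_le n) (norm_nonneg _)
              ((norm_nonneg _).trans (hC 0))
            rw [Complex.norm_real]; exact hC _
        _ = C := mul_one C
  refine ⟨hint, ?_⟩
  rw [integral_mul_angularMode_of_integrable hint]
  apply setIntegral_eq_integral_of_forall_compl_eq_zero
  intro r hr
  rw [image_eq_zero_of_notMem_tsupport (f := α) (fun hm => hr (hs hm))]
  simp

/-! ### Separated test functions -/

theorem MeasureTheory.LocallyIntegrable.integrable_mul_of_hasCompactSupport {u ψ : Plane → ℂ}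
    (hu : LocallyIntegrable u) (hψ : Continuous ψ) (hc : HasCompactSupport ψ) :
    Integrable (fun x => u x * ψ x) := by
  have h2 : IntegrableOn (fun x => u x * ψ x) (tsupport ψ) :=
    (hu.integrableOn_isCompact hc).mul_continuousOn hψ.continuousOn hc
  rw [← integrableOn_iff_integrable_of_support_subset (s := tsupport ψ)]
  · exact h2
  · intro x hx
    apply subset_tsupport
    intro h0
    simp [h0] at hx

/-- The derivative of a complex function along the `j`-th coordinate. -/
noncomputable def coordDeriv (j : Fin 2) (Φ : Plane → ℂ) (x : Plane) : ℂ :=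
  fderiv ℝ Φ x (EuclideanSpace.single j 1)

theorem continuous_coordDeriv {Φ : Plane → ℂ} (hΦ : ContDiff ℝ ∞ Φ) (j : Fin 2) :
    Continuous (coordDeriv j Φ) :=
  (hΦ.continuous_fderiv (by simp)).clm_apply continuous_const

theorem hasCompactSupport_coordDeriv {Φ : Plane → ℂ} (hc : HasCompactSupport Φ) (j : Fin 2) :
    HasCompactSupport (coordDeriv j Φ) :=
  hc.fderiv_apply (𝕜 := ℝ) _

theorem partialDeriv_clm_comp {Φ : Plane → ℂ} (hΦ : ContDiff ℝ ∞ Φ) (l : ℂ →L[ℝ] ℝ) (j : Fin 2)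
    (x : Plane) : partialDeriv j (fun y => l (Φ y)) x = l (coordDeriv j Φ x) := by
  have h1 : HasFDerivAt Φ (fderiv ℝ Φ x) x := (hΦ.differentiable (by simp) x).hasFDerivAt
  have h2 := l.hasFDerivAt.comp x h1
  have h3 : fderiv ℝ (fun y => l (Φ y)) x = l.comp (fderiv ℝ Φ x) := h2.fderiv
  rw [partialDeriv, h3]
  rfl

theorem isTestFunction_clm_comp {Φ : Plane → ℂ} (hΦ : ContDiff ℝ ∞ Φ) (hc : HasCompactSupport Φ)
    (l : ℂ →L[ℝ] ℝ) : IsTestFunction (fun y => l (Φ y)) :=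
  ⟨l.contDiff.comp hΦ, hc.comp_left (map_zero l)⟩

/-- Weak gradients are defined by real test functions. The real and imaginary parts of a complex
test function are both admissible, and the identity is linear. -/
theorem HasWeakGradient.integral_mul_coordDeriv {u : Plane → ℂ} {Du : Fin 2 → Plane → ℂ}
    (H : HasWeakGradient u Du) (j : Fin 2) {Φ : Plane → ℂ} (hΦ : ContDiff ℝ ∞ Φ)
    (hc : HasCompactSupport Φ) : ∫ x, u x * coordDeriv j Φ x = - ∫ x, Du j x * Φ x := by
  have h1 := (H.2 j).2 _ (isTestFunction_clm_comp hΦ hc Complex.reCLM)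
  have h2 := (H.2 j).2 _ (isTestFunction_clm_comp hΦ hc Complex.imCLM)
  simp only [partialDeriv_clm_comp hΦ] at h1 h2
  have cd := continuous_coordDeriv hΦ j
  have sd := hasCompactSupport_coordDeriv hc j
  have split : ∀ {w ψ : Plane → ℂ}, LocallyIntegrable w → Continuous ψ → HasCompactSupport ψ →
      ∫ x, w x * ψ x = (∫ x, w x * ((Complex.reCLM (ψ x) : ℝ) : ℂ))
        + Complex.I * ∫ x, w x * ((Complex.imCLM (ψ x) : ℝ) : ℂ) := by
    intro w ψ hw hψ hψc
    rw [← integral_const_mul, ← integral_add]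
    · congr 1; ext x
      conv_lhs => rw [← Complex.re_add_im (ψ x)]
      simp only [Complex.reCLM_apply, Complex.imCLM_apply]
      ring
    · exact hw.integrable_mul_of_hasCompactSupport
        (Complex.continuous_ofReal.comp (Complex.reCLM.continuous.comp hψ))
        (hψc.comp_left (g := fun z => ((Complex.reCLM z : ℝ) : ℂ)) (by simp))
    · exact (hw.integrable_mul_of_hasCompactSupport
        (Complex.continuous_ofReal.comp (Complex.imCLM.continuous.comp hψ))
        (hψc.comp_left (g := fun z => ((Complex.imCLM z : ℝ) : ℂ)) (by simp))).const_mul _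
  rw [split H.1 cd sd, split (H.2 j).1 hΦ.continuous hc, h1, h2]
  ring

/-- The weak equation tested against complex test functions. -/
theorem IsDielectricSolution.integral_mul_coordDeriv {ri re δ : ℝ} {f V : Plane → ℂ}
    {DV : Fin 2 → Plane → ℂ} (H : IsDielectricSolution ri re δ f V DV)
    (hf : LocallyIntegrable f)
    (hε : ∀ j, LocallyIntegrable (fun x => permittivity ri re δ x * DV j x)) {Φ : Plane → ℂ}
    (hΦ : ContDiff ℝ ∞ Φ) (hc : HasCompactSupport Φ) :
    ∫ x, permittivity ri re δ x * ∑ j, DV j x * coordDeriv j Φ x = - ∫ x, f x * Φ x := by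
  have h1 := H.2.1 _ (isTestFunction_clm_comp hΦ hc Complex.reCLM)
  have h2 := H.2.1 _ (isTestFunction_clm_comp hΦ hc Complex.imCLM)
  simp only [partialDeriv_clm_comp hΦ] at h1 h2
  have int : ∀ l : ℂ →L[ℝ] ℝ, Integrable (fun x => permittivity ri re δ x *
      ∑ j, DV j x * ((l (coordDeriv j Φ x) : ℝ) : ℂ)) := by
    intro l
    simp only [Finset.mul_sum, ← mul_assoc]
    refine integrable_finsetSum _ fun j _ => ?_
    exact (hε j).integrable_mul_of_hasCompactSupport
      (Complex.continuous_ofReal.comp (l.continuous.comp (continuous_coordDeriv hΦ j)))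
      ((hasCompactSupport_coordDeriv hc j).comp_left (g := fun z => ((l z : ℝ) : ℂ)) (by simp))
  have intf : ∀ l : ℂ →L[ℝ] ℝ, Integrable (fun x => f x * ((l (Φ x) : ℝ) : ℂ)) := fun l =>
    hf.integrable_mul_of_hasCompactSupport
      (Complex.continuous_ofReal.comp (l.continuous.comp hΦ.continuous))
      (hc.comp_left (g := fun z => ((l z : ℝ) : ℂ)) (by simp))
  have dec : ∀ z : ℂ, z = ((Complex.reCLM z : ℝ) : ℂ) + Complex.I * ((Complex.imCLM z : ℝ) : ℂ) := by
    intro z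
    conv_lhs => rw [← Complex.re_add_im z]
    simp only [Complex.reCLM_apply, Complex.imCLM_apply]
    ring
  have e1 : ∫ x, permittivity ri re δ x * ∑ j, DV j x * coordDeriv j Φ x
      = (∫ x, permittivity ri re δ x *
          ∑ j, DV j x * ((Complex.reCLM (coordDeriv j Φ x) : ℝ) : ℂ))
        + Complex.I * ∫ x, permittivity ri re δ x *
          ∑ j, DV j x * ((Complex.imCLM (coordDeriv j Φ x) : ℝ) : ℂ) := by
    rw [← integral_const_mul, ← integral_add (int _) ((int _).const_mul _)]
    congr 1; ext x
    simp only [Fin.sum_univ_two]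
    conv_lhs => rw [dec (coordDeriv 0 Φ x), dec (coordDeriv 1 Φ x)]
    ring
  have e2 : ∫ x, f x * Φ x = (∫ x, f x * ((Complex.reCLM (Φ x) : ℝ) : ℂ))
      + Complex.I * ∫ x, f x * ((Complex.imCLM (Φ x) : ℝ) : ℂ) := by
    rw [← integral_const_mul, ← integral_add (intf _) ((intf _).const_mul _)]
    congr 1; ext x
    conv_lhs => rw [dec (Φ x)]
    ring
  rw [e1, e2, h1, h2]
  ring

/-- The separated test function `β(r) e^{-inθ}`. -/
noncomputable def separated (n : ℤ) (β : ℝ → ℝ) (x : Plane) : ℂ :=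
  (β ‖x‖ : ℂ) * angularMode n x

/-- Rotation by a right angle. -/
noncomputable def quarterTurn (x : Plane) : Plane := !₂[-x 1, x 0]

theorem toComplex_quarterTurn (x : Plane) : toComplex (quarterTurn x) = Complex.I * toComplex x := by
  apply Complex.ext
  · simp [toComplex_re, toComplex_im, quarterTurn]
  · simp [toComplex_re, toComplex_im, quarterTurn]

theorem eventually_eq_zero_of_tsupport {β : ℝ → ℝ} (hs : tsupport β ⊆ Set.Ioi 0) :
    ∀ᶠ r in 𝓝 (0 : ℝ), β r = 0 := by
  have : (0 : ℝ) ∉ tsupport β := fun h => lt_irrefl (0 : ℝ) (hs h)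
  filter_upwards [notMem_tsupport_iff_eventuallyEq.1 this] with r hr using hr

theorem separated_eventuallyEq_zero (n : ℤ) {β : ℝ → ℝ} (hs : tsupport β ⊆ Set.Ioi 0) :
    separated n β =ᶠ[𝓝 0] fun _ => 0 := by
  have h1 : Tendsto (fun x : Plane => ‖x‖) (𝓝 0) (𝓝 0) := by
    simpa using (continuous_norm (E := Plane)).tendsto 0
  filter_upwards [h1.eventually (eventually_eq_zero_of_tsupport hs)] with x hx
  simp [separated, hx]

theorem contDiffAt_angularMode (n : ℤ) {x : Plane} (hx : x ≠ 0) :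
    ContDiffAt ℝ ∞ (angularMode n) x := by
  have hn : ContDiffAt ℝ ∞ (fun y : Plane => ‖y‖) x := contDiffAt_norm ℝ hx
  have hz : ContDiffAt ℝ ∞ toComplex x :=
    (LinearIsometryEquiv.contDiff Complex.orthonormalBasisOneI.repr.symm).contDiffAt
  have hq : ContDiffAt ℝ ∞ (fun y => (starRingEnd ℂ) (toComplex y) / (‖y‖ : ℂ)) x := by
    have hconj : ContDiff ℝ ∞ (fun z : ℂ => (starRingEnd ℂ) z) := Complex.conjCLE.contDiff
    have ha : ContDiffAt ℝ ∞ (fun y => (starRingEnd ℂ) (toComplex y)) x :=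
      hconj.contDiffAt.comp x hz
    have hb : ContDiffAt ℝ ∞ (fun y : Plane => (‖y‖ : ℂ)) x :=
      Complex.ofRealCLM.contDiff.contDiffAt.comp x hn
    simp only [div_eq_mul_inv]
    exact ha.mul (hb.inv (by simpa using hx))
  have h0 : (starRingEnd ℂ) (toComplex x) / (‖x‖ : ℂ) ≠ 0 := by
    rw [← norm_ne_zero_iff, norm_div, RCLike.norm_conj, norm_toComplex, Complex.norm_real,
      norm_norm, div_self (norm_ne_zero_iff.2 hx)]
    exact one_ne_zero
  have hzp : ContDiffAt ℝ ∞ (fun z : ℂ => z ^ n) ((starRingEnd ℂ) (toComplex x) / (‖x‖ : ℂ)) := by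
    rcases n with m | m
    · simp only [Int.ofNat_eq_natCast, zpow_natCast]
      exact (contDiff_id.pow m).contDiffAt
    · simp only [zpow_negSucc]
      exact (contDiff_id.pow (m + 1)).contDiffAt.inv (pow_ne_zero _ h0)
  exact hzp.comp x hq

/-- Off the origin both factors are smooth. At the origin e^{-inθ} is not, but the support of `β`
avoids a neighbourhood of 0. -/
theorem contDiff_separated (n : ℤ) {β : ℝ → ℝ} (hβ : ContDiff ℝ ∞ β)
    (hs : tsupport β ⊆ Set.Ioi 0) : ContDiff ℝ ∞ (separated n β) := by
  rw [contDiff_iff_contDiffAt]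
  intro x
  by_cases hx : x = 0
  · subst hx
    exact contDiffAt_const.congr_of_eventuallyEq (separated_eventuallyEq_zero n hs)
  · refine ContDiffAt.mul ?_ (contDiffAt_angularMode n hx)
    exact Complex.ofRealCLM.contDiff.contDiffAt.comp x
      (hβ.contDiffAt.comp x (contDiffAt_norm ℝ hx))

theorem hasCompactSupport_separated (n : ℤ) {β : ℝ → ℝ} (hc : HasCompactSupport β) :
    HasCompactSupport (separated n β) := by
  obtain ⟨R, hR⟩ := hc.isBounded.subset_ball 0
  refine HasCompactSupport.intro (isCompact_closedBall (0 : Plane) R) fun x hx => ?_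
  have : β ‖x‖ = 0 := by
    apply image_eq_zero_of_notMem_tsupport
    intro hm
    apply hx
    have := hR hm
    rw [mem_ball_zero_iff, norm_norm] at this
    simpa using this.le
  simp [separated, this]

/-- The derivative in the direction `x` is r∂_r. It is computed along the ray s ↦ (1 + s)x, on which
e^{-inθ} is constant. -/
theorem fderiv_separated_self (n : ℤ) {β : ℝ → ℝ} (hβ : ContDiff ℝ ∞ β)
    (hs : tsupport β ⊆ Set.Ioi 0) (x : Plane) :
    fderiv ℝ (separated n β) x x = separated n (fun r => r * deriv β r) x := by
  by_cases hx : x = 0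
  · subst hx; simp [separated]
  have h1 : HasFDerivAt (separated n β) (fderiv ℝ (separated n β) x) ((1 + (0 : ℝ)) • x) := by
    rw [add_zero, one_smul]
    exact ((contDiff_separated n hβ hs).differentiable (by simp) x).hasFDerivAt
  have hc : HasDerivAt (fun s : ℝ => (1 + s) • x) x 0 := by
    simpa using ((hasDerivAt_id (0 : ℝ)).const_add 1).smul_const x
  have h2 := h1.comp_hasDerivAt (0 : ℝ) hc
  have h3 : HasDerivAt (fun s : ℝ => (β ((1 + s) * ‖x‖) : ℂ) * angularMode n x)
      (((deriv β ‖x‖ * ‖x‖ : ℝ) : ℂ) * angularMode n x) 0 := by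
    have hb : HasDerivAt β (deriv β ‖x‖) ((1 + (0 : ℝ)) * ‖x‖) := by
      rw [add_zero, one_mul]
      exact (hβ.differentiable (by simp) _).hasDerivAt
    have hl : HasDerivAt (fun s : ℝ => (1 + s) * ‖x‖) ‖x‖ 0 := by
      simpa using ((hasDerivAt_id (0 : ℝ)).const_add 1).mul_const ‖x‖
    exact ((hb.comp (0 : ℝ) hl).ofReal_comp).mul_const _
  have h4 : (separated n β ∘ fun s : ℝ => (1 + s) • x)
      =ᶠ[𝓝 0] fun s : ℝ => (β ((1 + s) * ‖x‖) : ℂ) * angularMode n x := by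
    filter_upwards [Ioi_mem_nhds (show (-1 : ℝ) < 0 by norm_num)] with s hs
    have hs' : (0 : ℝ) < 1 + s := by
      have : (-1 : ℝ) < s := hs
      linarith
    have hne : ((1 + s : ℝ) : ℂ) ≠ 0 := by exact_mod_cast hs'.ne'
    simp only [Function.comp_apply, separated, angularMode, norm_smul, Real.norm_eq_abs,
      abs_of_pos hs', toComplex, map_smul, Complex.real_smul, map_mul, Complex.conj_ofReal]
    rw [Complex.ofReal_mul, mul_div_mul_left _ _ hne]
  have h5 := (h3.congr_of_eventuallyEq h4).unique h2
  rw [← h5, separated]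
  push_cast
  ring

/-- The derivative in the direction of the rotated vector is ∂_θ. It is computed along the circle
cos s · x + sin s · x^⊥, on which the norm is constant and the mode picks up the factor e^{-ins}. -/
theorem fderiv_separated_quarterTurn (n : ℤ) {β : ℝ → ℝ} (hβ : ContDiff ℝ ∞ β)
    (hs : tsupport β ⊆ Set.Ioi 0) (x : Plane) :
    fderiv ℝ (separated n β) x (quarterTurn x) = -(Complex.I * n) * separated n β x := by
  by_cases hx : x = 0
  · subst hx
    have h0 : quarterTurn 0 = 0 := by ext i; fin_cases i <;> simp [quarterTurn]
    have : separated n β 0 = 0 := (separated_eventuallyEq_zero n hs).eq_of_nhds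
    simp [h0, this]
  have h1 : HasFDerivAt (separated n β) (fderiv ℝ (separated n β) x)
      (Real.cos 0 • x + Real.sin 0 • quarterTurn x) := by
    rw [Real.cos_zero, Real.sin_zero, zero_smul, add_zero, one_smul]
    exact ((contDiff_separated n hβ hs).differentiable (by simp) x).hasFDerivAt
  have hc : HasDerivAt (fun s : ℝ => Real.cos s • x + Real.sin s • quarterTurn x)
      (quarterTurn x) 0 := by
    simpa using ((Real.hasDerivAt_cos 0).smul_const x).fun_add
      ((Real.hasDerivAt_sin 0).smul_const (quarterTurn x))
  have h2 := h1.comp_hasDerivAt (0 : ℝ) hc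
  have hT : ∀ s : ℝ, toComplex (Real.cos s • x + Real.sin s • quarterTurn x)
      = Complex.exp (s * Complex.I) * toComplex x := by
    intro s
    have : toComplex (Real.cos s • x + Real.sin s • quarterTurn x)
        = Real.cos s • toComplex x + Real.sin s • toComplex (quarterTurn x) := by
      simp only [toComplex, map_add, map_smul]
    rw [this, toComplex_quarterTurn, Complex.real_smul, Complex.real_smul, Complex.exp_mul_I]
    push_cast
    ring
  have hN : ∀ s : ℝ, ‖Real.cos s • x + Real.sin s • quarterTurn x‖ = ‖x‖ := by
    intro s
    rw [← norm_toComplex, hT, norm_mul, Complex.norm_exp_ofReal_mul_I, one_mul, norm_toComplex]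
  have h3 : HasDerivAt (fun s : ℝ => Complex.exp (-(Complex.I * n) * s) * separated n β x)
      (-(Complex.I * n) * separated n β x) 0 := by
    have ha : HasDerivAt (fun s : ℝ => -(Complex.I * n) * (s : ℂ)) (-(Complex.I * n) * 1) 0 :=
      (Complex.ofRealCLM.hasDerivAt).const_mul _
    have hb := ha.cexp
    simpa using hb.mul_const (separated n β x)
  have h4 : (separated n β ∘ fun s : ℝ => Real.cos s • x + Real.sin s • quarterTurn x)
      = fun s : ℝ => Complex.exp (-(Complex.I * n) * s) * separated n β x := by
    ext s
    simp only [Function.comp_apply, separated, angularMode, hN, hT, map_mul]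
    have he : (starRingEnd ℂ) (Complex.exp (s * Complex.I)) ^ n
        = Complex.exp (-(Complex.I * n) * s) := by
      rw [← Complex.exp_conj, ← Complex.exp_int_mul]
      congr 1
      simp
      ring
    rw [mul_div_assoc, mul_zpow, he]
    ring
  rw [h4] at h2
  exact h2.unique h3

/-- The derivative of `V` along `x`, in terms of its gradient. -/
noncomputable def radialPart (DV : Fin 2 → Plane → ℂ) (x : Plane) : ℂ :=
  (x 0 : ℂ) * DV 0 x + (x 1 : ℂ) * DV 1 x

/-- The derivative of `V` with respect to the angle, in terms of its gradient. -/
noncomputable def angularPart (DV : Fin 2 → Plane → ℂ) (x : Plane) : ℂ :=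
  -(x 1 : ℂ) * DV 0 x + (x 0 : ℂ) * DV 1 x

theorem fderiv_apply_self_eq (Φ : Plane → ℂ) (x : Plane) :
    fderiv ℝ Φ x x = (x 0 : ℂ) * coordDeriv 0 Φ x + (x 1 : ℂ) * coordDeriv 1 Φ x := by
  have hx : x = x 0 • EuclideanSpace.single 0 (1 : ℝ) + x 1 • EuclideanSpace.single 1 (1 : ℝ) := by
    ext i; fin_cases i <;> simp
  have h := congrArg (fderiv ℝ Φ x) hx
  rw [map_add, map_smul, map_smul, Complex.real_smul, Complex.real_smul] at h
  exact h

theorem fderiv_apply_quarterTurn_eq (Φ : Plane → ℂ) (x : Plane) :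
    fderiv ℝ Φ x (quarterTurn x) = -(x 1 : ℂ) * coordDeriv 0 Φ x + (x 0 : ℂ) * coordDeriv 1 Φ x := by
  have hx : quarterTurn x
      = (-x 1) • EuclideanSpace.single 0 (1 : ℝ) + x 0 • EuclideanSpace.single 1 (1 : ℝ) := by
    ext i; fin_cases i <;> simp [quarterTurn]
  rw [hx, map_add, map_smul, map_smul, Complex.real_smul, Complex.real_smul]
  push_cast
  rfl

theorem norm_sq_eq_coords (x : Plane) : ((‖x‖ : ℂ)) ^ 2 = (x 0 : ℂ) ^ 2 + (x 1 : ℂ) ^ 2 := by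
  have : ‖x‖ ^ 2 = x 0 ^ 2 + x 1 ^ 2 := by
    rw [EuclideanSpace.norm_sq_eq]
    simp [Fin.sum_univ_two]
  exact_mod_cast this

/-- The vectors `x` and `quarterTurn x` are orthogonal and both have length |x|, so the product of
gradients splits into its r∂_r and ∂_θ parts. The product is bilinear, without conjugation. -/
theorem norm_sq_mul_sum (DV : Fin 2 → Plane → ℂ) (Φ : Plane → ℂ) (x : Plane) :
    (‖x‖ : ℂ) ^ 2 * ∑ j, DV j x * coordDeriv j Φ x
      = radialPart DV x * fderiv ℝ Φ x x + angularPart DV x * fderiv ℝ Φ x (quarterTurn x) := by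
  rw [norm_sq_eq_coords, fderiv_apply_self_eq, fderiv_apply_quarterTurn_eq, Fin.sum_univ_two,
    radialPart, angularPart]
  ring

theorem continuous_coord (i : Fin 2) : Continuous fun x : Plane => (x i : ℂ) := by fun_prop

theorem contDiff_coord (i : Fin 2) : ContDiff ℝ ∞ fun x : Plane => (x i : ℂ) := by
  have : ContDiff ℝ ∞ fun x : Plane => x i := by fun_prop
  exact Complex.ofRealCLM.contDiff.comp this

theorem MeasureTheory.LocallyIntegrable.continuous_fun_mul {g c : Plane → ℂ} (hg : LocallyIntegrable g)
    (hc : Continuous c) : LocallyIntegrable (fun x => c x * g x) := by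
  rw [locallyIntegrable_iff]
  intro K hK
  exact (hg.integrableOn_isCompact hK).continuousOn_mul hc.continuousOn hK

theorem locallyIntegrable_radialPart {DV : Fin 2 → Plane → ℂ}
    (h : ∀ j, LocallyIntegrable (DV j)) : LocallyIntegrable (radialPart DV) :=
  ((h 0).continuous_fun_mul (continuous_coord 0)).add ((h 1).continuous_fun_mul (continuous_coord 1))

theorem locallyIntegrable_angularPart {DV : Fin 2 → Plane → ℂ}
    (h : ∀ j, LocallyIntegrable (DV j)) : LocallyIntegrable (angularPart DV) :=
  ((h 0).continuous_fun_mul (continuous_coord 1).neg).add ((h 1).continuous_fun_mul (continuous_coord 0))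

theorem coordDeriv_coord_mul {Ψ : Plane → ℂ} (hΨ : ContDiff ℝ ∞ Ψ) (i j : Fin 2) (x : Plane) :
    coordDeriv j (fun y => (y i : ℂ) * Ψ y) x
      = (x i : ℂ) * coordDeriv j Ψ x + (if i = j then Ψ x else 0) := by
  have h1 : HasFDerivAt (fun y : Plane => (y i : ℂ))
      (Complex.ofRealCLM.comp (EuclideanSpace.proj (𝕜 := ℝ) i)) x :=
    (Complex.ofRealCLM.comp (EuclideanSpace.proj (𝕜 := ℝ) i)).hasFDerivAt
  have h2 : HasFDerivAt Ψ (fderiv ℝ Ψ x) x := (hΨ.differentiable (by simp) x).hasFDerivAt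
  rw [coordDeriv, (h1.fun_mul h2).fderiv]
  fin_cases i <;> fin_cases j <;> simp [coordDeriv]

/-- The divergence of the field xΨ is 2Ψ + x · ∇Ψ. Working with r∂_r in place of ∂_r keeps the
coefficients smooth at the origin. -/
theorem HasWeakGradient.integral_radialPart {u : Plane → ℂ} {Du : Fin 2 → Plane → ℂ}
    (H : HasWeakGradient u Du) {Ψ : Plane → ℂ} (hΨ : ContDiff ℝ ∞ Ψ) (hc : HasCompactSupport Ψ) :
    ∫ x, u x * (2 * Ψ x + fderiv ℝ Ψ x x) = - ∫ x, radialPart Du x * Ψ x := by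
  have sm : ∀ i : Fin 2, ContDiff ℝ ∞ (fun y : Plane => (y i : ℂ) * Ψ y) := fun i =>
    (contDiff_coord i).mul hΨ
  have sc : ∀ i : Fin 2, HasCompactSupport (fun y : Plane => (y i : ℂ) * Ψ y) := fun i =>
    hc.mul_left
  have h0 := H.integral_mul_coordDeriv 0 (sm 0) (sc 0)
  have h1 := H.integral_mul_coordDeriv 1 (sm 1) (sc 1)
  have i0 := H.1.integrable_mul_of_hasCompactSupport (continuous_coordDeriv (sm 0) 0)
    (hasCompactSupport_coordDeriv (sc 0) 0)
  have i1 := H.1.integrable_mul_of_hasCompactSupport (continuous_coordDeriv (sm 1) 1)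
    (hasCompactSupport_coordDeriv (sc 1) 1)
  have j0 := (H.2 0).1.integrable_mul_of_hasCompactSupport (sm 0).continuous (sc 0)
  have j1 := (H.2 1).1.integrable_mul_of_hasCompactSupport (sm 1).continuous (sc 1)
  calc ∫ x, u x * (2 * Ψ x + fderiv ℝ Ψ x x)
      = (∫ x, u x * coordDeriv 0 (fun y => (y 0 : ℂ) * Ψ y) x)
        + ∫ x, u x * coordDeriv 1 (fun y => (y 1 : ℂ) * Ψ y) x := by
        rw [← integral_add i0 i1]
        congr 1; ext x
        rw [coordDeriv_coord_mul hΨ, coordDeriv_coord_mul hΨ, fderiv_apply_self_eq]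
        simp
        ring
    _ = -((∫ x, Du 0 x * ((x 0 : ℂ) * Ψ x)) + ∫ x, Du 1 x * ((x 1 : ℂ) * Ψ x)) := by
        rw [h0, h1]; ring
    _ = _ := by
        rw [← integral_add j0 j1]
        congr 2; ext x
        rw [radialPart]; ring

/-- The rotation field is divergence-free, so no zeroth-order term appears. -/
theorem HasWeakGradient.integral_angularPart {u : Plane → ℂ} {Du : Fin 2 → Plane → ℂ}
    (H : HasWeakGradient u Du) {Ψ : Plane → ℂ} (hΨ : ContDiff ℝ ∞ Ψ) (hc : HasCompactSupport Ψ) :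
    ∫ x, u x * fderiv ℝ Ψ x (quarterTurn x) = - ∫ x, angularPart Du x * Ψ x := by
  have sm : ∀ i : Fin 2, ContDiff ℝ ∞ (fun y : Plane => (y i : ℂ) * Ψ y) := fun i =>
    (contDiff_coord i).mul hΨ
  have sc : ∀ i : Fin 2, HasCompactSupport (fun y : Plane => (y i : ℂ) * Ψ y) := fun i =>
    hc.mul_left
  have h0 := H.integral_mul_coordDeriv 0 (sm 1) (sc 1)
  have h1 := H.integral_mul_coordDeriv 1 (sm 0) (sc 0)
  have i0 := H.1.integrable_mul_of_hasCompactSupport (continuous_coordDeriv (sm 1) 0)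
    (hasCompactSupport_coordDeriv (sc 1) 0)
  have i1 := H.1.integrable_mul_of_hasCompactSupport (continuous_coordDeriv (sm 0) 1)
    (hasCompactSupport_coordDeriv (sc 0) 1)
  have j0 := (H.2 0).1.integrable_mul_of_hasCompactSupport (sm 1).continuous (sc 1)
  have j1 := (H.2 1).1.integrable_mul_of_hasCompactSupport (sm 0).continuous (sc 0)
  calc ∫ x, u x * fderiv ℝ Ψ x (quarterTurn x)
      = (∫ x, u x * coordDeriv 1 (fun y => (y 0 : ℂ) * Ψ y) x)
        - ∫ x, u x * coordDeriv 0 (fun y => (y 1 : ℂ) * Ψ y) x := by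
        rw [← integral_sub i1 i0]
        congr 1; ext x
        rw [coordDeriv_coord_mul hΨ, coordDeriv_coord_mul hΨ, fderiv_apply_quarterTurn_eq]
        simp
        ring
    _ = -((∫ x, Du 1 x * ((x 0 : ℂ) * Ψ x)) - ∫ x, Du 0 x * ((x 1 : ℂ) * Ψ x)) := by
        rw [h0, h1]; ring
    _ = _ := by
        rw [← integral_sub j1 j0]
        congr 2; ext x
        rw [angularPart]; ring

/-! ### The system of radial equations satisfied by the Fourier modes -/

open Classical in
/-- The permittivity as a function of the radius. -/
noncomputable def radialPermittivity (ri re δ r : ℝ) : ℂ :=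
  if ri < r ∧ r < re then -1 + Complex.I * (δ : ℂ) else 1

theorem permittivity_eq (ri re δ : ℝ) (x : Plane) :
    permittivity ri re δ x = radialPermittivity ri re δ ‖x‖ := by
  rw [permittivity, radialPermittivity]
  by_cases h : x ∈ shell ri re
  · have h' : ri < ‖x‖ ∧ ‖x‖ < re := h
    rw [if_pos h, if_pos h']
  · have h' : ¬ (ri < ‖x‖ ∧ ‖x‖ < re) := h
    rw [if_neg h, if_neg h']

theorem measurable_radialPermittivity (ri re δ : ℝ) : Measurable (radialPermittivity ri re δ) :=
  Measurable.ite measurableSet_Ioo measurable_const measurable_const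

theorem norm_radialPermittivity_le (ri re δ r : ℝ) :
    ‖radialPermittivity ri re δ r‖ ≤ 1 + |δ| := by
  rw [radialPermittivity]
  split_ifs
  · refine (norm_add_le _ _).trans ?_
    simp
  · simp

theorem locallyIntegrable_permittivity_mul (ri re δ : ℝ) {g : Plane → ℂ}
    (hg : LocallyIntegrable g) : LocallyIntegrable fun x => permittivity ri re δ x * g x := by
  rw [locallyIntegrable_iff]
  intro K hK
  refine Integrable.bdd_mul (c := 1 + |δ|) (hg.integrableOn_isCompact hK) ?_ ?_
  · have : permittivity ri re δ = fun x => radialPermittivity ri re δ ‖x‖ :=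
      funext (permittivity_eq ri re δ)
    rw [this]
    exact ((measurable_radialPermittivity ri re δ).comp measurable_norm).aestronglyMeasurable
  · exact Eventually.of_forall fun x => by
      rw [permittivity_eq]; exact norm_radialPermittivity_le ri re δ _

theorem fourierMode_permittivity_mul (ri re δ : ℝ) (n : ℤ) (g : Plane → ℂ) {r : ℝ} (hr : 0 < r) :
    fourierMode n (fun x => permittivity ri re δ x * g x) r
      = radialPermittivity ri re δ r * fourierMode n g r := by
  rw [fourierMode, fourierMode, ← integral_const_mul]
  congr 1; ext θ
  rw [permittivity_eq, norm_polarMap]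
  simp only [abs_of_pos hr]
  ring

theorem contDiffOn_inv_Ioi : ContDiffOn ℝ ∞ (fun r : ℝ => r⁻¹) (Set.Ioi 0) :=
  fun _ hx => (contDiffAt_inv ℝ (ne_of_gt hx)).contDiffWithinAt

theorem contDiffOn_inv_sq_Ioi : ContDiffOn ℝ ∞ (fun r : ℝ => (r ^ 2)⁻¹) (Set.Ioi 0) := by
  have := contDiffOn_inv_Ioi.pow 2
  simpa only [inv_pow] using this

theorem integral_mul_separated {h : Plane → ℂ} (hh : LocallyIntegrable h) (n : ℤ)
    {α : ℝ → ℝ} (hα : ContDiff ℝ ∞ α) (hc : HasCompactSupport α) (hs : tsupport α ⊆ Set.Ioi 0) :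
    ∫ x, h x * separated n α x = ∫ r, fourierMode n h r * ((r * α r : ℝ) : ℂ) :=
  (integral_mul_radial_mul_angularMode hh n hα.continuous hc hs).2

theorem test_zero {ξ : ℝ → ℝ} (hs : tsupport ξ ⊆ Set.Ioi 0) : ξ 0 = 0 :=
  image_eq_zero_of_notMem_tsupport fun h => lt_irrefl (0 : ℝ) (hs h)

/-- This is r v' = p for each mode. With ξ = r²β, the expression 2β + rβ' from the radial
integration by parts, multiplied by the Jacobian r, is exactly ξ'. -/
theorem HasWeakGradient.hasWeakDerivOn_fourierMode {u : Plane → ℂ} {Du : Fin 2 → Plane → ℂ}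
    (H : HasWeakGradient u Du) (n : ℤ) :
    HasWeakDerivOn (Set.Ioi 0) (fourierMode n u)
      (fun r => (r : ℂ)⁻¹ * fourierMode n (radialPart Du) r) := by
  intro ξ h1 h2 h3
  set β : ℝ → ℝ := fun r => (r ^ 2)⁻¹ * ξ r with hβdef
  have b1 : ContDiff ℝ ∞ β := contDiff_mul_of_tsupport_subset isOpen_Ioi h1 h3 contDiffOn_inv_sq_Ioi
  have bs : tsupport β ⊆ tsupport ξ := tsupport_mul_subset_right
  have b2 : HasCompactSupport β := h2.of_tsupport_subset bs
  have b3 : tsupport β ⊆ Set.Ioi 0 := bs.trans h3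
  have hξβ : ξ = fun r => r ^ 2 * β r := by
    ext r
    by_cases hr : r = 0
    · subst hr; simp [test_zero h3]
    · simp only [hβdef]; field_simp
  have hder : ∀ r, deriv ξ r = r * (2 * β r + r * deriv β r) := by
    intro r
    have hb : HasDerivAt β (deriv β r) r := (b1.differentiable (by simp) r).hasDerivAt
    have := ((hasDerivAt_pow 2 r).fun_mul hb).deriv
    rw [← hξβ] at this
    rw [this]
    push_cast
    ring
  have d1 : ContDiff ℝ ∞ (deriv β) := by
    have := (contDiff_infty_iff_deriv.1 b1).2
    exact this
  have a1 : ContDiff ℝ ∞ (fun r => 2 * β r + r * deriv β r) :=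
    (contDiff_const.mul b1).add (contDiff_id.mul d1)
  have as : tsupport (fun r => 2 * β r + r * deriv β r) ⊆ tsupport β := by
    refine (tsupport_add _ _).trans (Set.union_subset ?_ ?_)
    · exact tsupport_mul_subset_right
    · exact tsupport_mul_subset_right.trans tsupport_deriv_subset
  have key := H.integral_radialPart (contDiff_separated n b1 b3) (hasCompactSupport_separated n b2)
  have e1 : ∀ x, 2 * separated n β x + fderiv ℝ (separated n β) x x
      = separated n (fun r => 2 * β r + r * deriv β r) x := by
    intro x
    rw [fderiv_separated_self n b1 b3]
    simp only [separated]
    push_cast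
    ring
  simp only [e1] at key
  rw [integral_mul_separated H.1 n a1 (b2.of_tsupport_subset as) (as.trans b3),
    integral_mul_separated (locallyIntegrable_radialPart fun j => (H.2 j).1) n b1 b2 b3] at key
  simp only [hder]
  rw [key]
  congr 2
  ext r
  by_cases hr : r = 0
  · subst hr; simp
  · have : (r : ℂ) ≠ 0 := by exact_mod_cast hr
    simp only [hβdef]; push_cast; field_simp

/-- The angular derivative acts on the n-th mode as multiplication by in. Since both sides are only
locally integrable, the identity is obtained almost everywhere by testing on the half-line. -/
theorem HasWeakGradient.fourierMode_angularPart {u : Plane → ℂ} {Du : Fin 2 → Plane → ℂ}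
    (H : HasWeakGradient u Du) (n : ℤ) :
    ∀ᵐ r, r ∈ Set.Ioi (0 : ℝ) →
      fourierMode n (angularPart Du) r = Complex.I * n * fourierMode n u r := by
  have iQ := locallyIntegrable_angularPart fun j => (H.2 j).1
  have iq := locallyIntegrableOn_fourierMode iQ n
  have iv := locallyIntegrableOn_fourierMode H.1 n
  suffices ∀ᵐ r, r ∈ Set.Ioi (0 : ℝ) →
      fourierMode n (angularPart Du) r - (Complex.I * n) • fourierMode n u r = 0 by
    filter_upwards [this] with r hr hr0
    exact sub_eq_zero.1 (hr hr0)
  refine isOpen_Ioi.ae_eq_zero_of_integral_contDiff_smul_eq_zero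
    (iq.sub (iv.smul (Complex.I * n))) ?_
  intro ξ h1 h2 h3
  set β : ℝ → ℝ := fun r => r⁻¹ * ξ r with hβdef
  have b1 : ContDiff ℝ ∞ β := contDiff_mul_of_tsupport_subset isOpen_Ioi h1 h3 contDiffOn_inv_Ioi
  have bs : tsupport β ⊆ tsupport ξ := tsupport_mul_subset_right
  have b2 : HasCompactSupport β := h2.of_tsupport_subset bs
  have b3 : tsupport β ⊆ Set.Ioi 0 := bs.trans h3
  have hξβ : ∀ r, r * β r = ξ r := by
    intro r
    by_cases hr : r = 0
    · subst hr; simp [test_zero h3]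
    · simp only [hβdef]; field_simp
  have key := H.integral_angularPart (contDiff_separated n b1 b3) (hasCompactSupport_separated n b2)
  simp only [fderiv_separated_quarterTurn n b1 b3] at key
  have e1 : ∫ x, u x * (-(Complex.I * n) * separated n β x)
      = -(Complex.I * n) * ∫ x, u x * separated n β x := by
    rw [← integral_const_mul]; congr 1; ext x; ring
  rw [e1, integral_mul_separated H.1 n b1 b2 b3, integral_mul_separated iQ n b1 b2 b3] at key
  simp only [hξβ] at key
  have j1 := iq.integrable_mul_of_tsupport_subset h1.continuous h2 h3
  have j2 := iv.integrable_mul_of_tsupport_subset h1.continuous h2 h3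
  have e2 : ∫ r, (fourierMode n (angularPart Du) r * (ξ r : ℂ)
      - (Complex.I * n) * (fourierMode n u r * (ξ r : ℂ))) = 0 := by
    rw [integral_sub j1 (j2.const_mul _), integral_const_mul]
    linear_combination key
  rw [← e2]
  congr 1; ext r
  rw [Complex.real_smul, smul_eq_mul]
  ring

/-- Test the equation with ξ(r) e^{-inθ}: the factors in and -in of the two angular derivatives
multiply to n². It is the flux εp, not p, that acquires a weak derivative; its continuity is the
second transmission condition. -/
theorem IsDielectricSolution.hasWeakDerivOn_flux {ri re δ : ℝ} {f V : Plane → ℂ}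
    {DV : Fin 2 → Plane → ℂ} (H : IsDielectricSolution ri re δ f V DV)
    (hf : LocallyIntegrable f) (n : ℤ) :
    HasWeakDerivOn (Set.Ioi 0)
      (fun r => radialPermittivity ri re δ r * fourierMode n (radialPart DV) r)
      (fun r => (n : ℂ) ^ 2 * ((r : ℂ)⁻¹ * (radialPermittivity ri re δ r * fourierMode n V r))
        + r * fourierMode n f r) := by
  intro ξ h1 h2 h3
  have hDV : ∀ j, LocallyIntegrable (DV j) := fun j => (H.1.2 j).1
  have iP := locallyIntegrable_permittivity_mul ri re δ (locallyIntegrable_radialPart hDV)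
  have iQ := locallyIntegrable_permittivity_mul ri re δ (locallyIntegrable_angularPart hDV)
  have iV := locallyIntegrable_permittivity_mul ri re δ H.1.1
  have key := H.integral_mul_coordDeriv hf
    (fun j => locallyIntegrable_permittivity_mul ri re δ (hDV j))
    (contDiff_separated n h1 h3) (hasCompactSupport_separated n h2)
  have d1 : ContDiff ℝ ∞ (deriv ξ) := (contDiff_infty_iff_deriv.1 h1).2
  have d3 : tsupport (deriv ξ) ⊆ Set.Ioi 0 := tsupport_deriv_subset.trans h3
  -- Both weights come from dividing `norm_sq_mul_sum` by |x|²: α is r⁻² · rξ', and β is r⁻² · ξ.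
  set α : ℝ → ℝ := fun r => r⁻¹ * deriv ξ r with hα
  set β : ℝ → ℝ := fun r => (r ^ 2)⁻¹ * ξ r with hβ
  have a1 : ContDiff ℝ ∞ α := contDiff_mul_of_tsupport_subset isOpen_Ioi d1 d3 contDiffOn_inv_Ioi
  have as : tsupport α ⊆ tsupport (deriv ξ) := tsupport_mul_subset_right
  have a2 : HasCompactSupport α := h2.deriv.of_tsupport_subset as
  have a3 : tsupport α ⊆ Set.Ioi 0 := as.trans d3
  have b1 : ContDiff ℝ ∞ β := contDiff_mul_of_tsupport_subset isOpen_Ioi h1 h3 contDiffOn_inv_sq_Ioi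
  have bs : tsupport β ⊆ tsupport ξ := tsupport_mul_subset_right
  have b2 : HasCompactSupport β := h2.of_tsupport_subset bs
  have b3 : tsupport β ⊆ Set.Ioi 0 := bs.trans h3
  have e1 : ∀ x, permittivity ri re δ x * ∑ j, DV j x * coordDeriv j (separated n ξ) x
      = (permittivity ri re δ x * radialPart DV x) * separated n α x
        + -(Complex.I * n) * ((permittivity ri re δ x * angularPart DV x) * separated n β x) := by
    intro x
    by_cases hx : x = 0
    · subst hx
      have z1 : ∀ j, coordDeriv j (separated n ξ) 0 = 0 := by
        intro j
        rw [coordDeriv, (separated_eventuallyEq_zero n h3).fderiv_eq]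
        simp
      simp [z1, separated, hα, hβ]
    · have hne : (‖x‖ : ℂ) ≠ 0 := by simpa using hx
      have := norm_sq_mul_sum DV (separated n ξ) x
      rw [fderiv_separated_self n h1 h3, fderiv_separated_quarterTurn n h1 h3] at this
      have e2 : ∑ j, DV j x * coordDeriv j (separated n ξ) x
          = ((‖x‖ : ℂ) ^ 2)⁻¹ * (radialPart DV x * separated n (fun r => r * deriv ξ r) x
            + angularPart DV x * (-(Complex.I * n) * separated n ξ x)) := by
        rw [← this]; field_simp
      rw [e2]
      simp only [separated, hα, hβ]
      push_cast
      field_simp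
  have i1 : Integrable fun x => (permittivity ri re δ x * radialPart DV x) * separated n α x :=
    (integral_mul_radial_mul_angularMode iP n a1.continuous a2 a3).1
  have i2 : Integrable fun x => (permittivity ri re δ x * angularPart DV x) * separated n β x :=
    (integral_mul_radial_mul_angularMode iQ n b1.continuous b2 b3).1
  simp only [e1] at key
  rw [integral_add i1 (i2.const_mul _), integral_const_mul, integral_mul_separated iP n a1 a2 a3,
    integral_mul_separated iQ n b1 b2 b3, integral_mul_separated hf n h1 h2 h3] at key
  have ip := locallyIntegrableOn_fourierMode iP n
  have iv := (locallyIntegrableOn_fourierMode iV n)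
  have e3 : ∫ r, fourierMode n (fun x => permittivity ri re δ x * radialPart DV x) r
        * ((r * α r : ℝ) : ℂ)
      = ∫ r, radialPermittivity ri re δ r * fourierMode n (radialPart DV) r
        * ((deriv ξ r : ℝ) : ℂ) := by
    congr 1; ext r
    by_cases hr : 0 < r
    · rw [fourierMode_permittivity_mul _ _ _ _ _ hr]
      congr 2
      simp only [hα]; field_simp
    · have : deriv ξ r = 0 := image_eq_zero_of_notMem_tsupport fun h => hr (d3 h)
      simp [hα, this]
  have e4 : ∫ r, fourierMode n (fun x => permittivity ri re δ x * angularPart DV x) r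
        * ((r * β r : ℝ) : ℂ)
      = Complex.I * n * ∫ r : ℝ, (r : ℂ)⁻¹ * (radialPermittivity ri re δ r * fourierMode n V r)
        * (ξ r : ℂ) := by
    rw [← integral_const_mul]
    apply integral_congr_ae
    filter_upwards [H.1.fourierMode_angularPart n] with r hq
    by_cases hr : 0 < r
    · have hne : (r : ℂ) ≠ 0 := by exact_mod_cast hr.ne'
      rw [fourierMode_permittivity_mul _ _ _ _ _ hr, hq hr]
      simp only [hβ]; push_cast; field_simp
    · have : ξ r = 0 := image_eq_zero_of_notMem_tsupport fun h => hr (h3 h)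
      simp [hβ, this]
  have i3 : Integrable fun r : ℝ => (r : ℂ)⁻¹ * (radialPermittivity ri re δ r * fourierMode n V r)
      * (ξ r : ℂ) := by
    have ib1 : ContDiff ℝ ∞ (fun r => r⁻¹ * ξ r) :=
      contDiff_mul_of_tsupport_subset isOpen_Ioi h1 h3 contDiffOn_inv_Ioi
    have ibs : tsupport (fun r => r⁻¹ * ξ r) ⊆ tsupport ξ := tsupport_mul_subset_right
    refine (iv.integrable_mul_of_tsupport_subset ib1.continuous (h2.of_tsupport_subset ibs)
      (ibs.trans h3)).congr (Eventually.of_forall fun r => ?_)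
    by_cases hr : 0 < r
    · simp only
      rw [fourierMode_permittivity_mul _ _ _ _ _ hr]
      push_cast
      ring
    · have : ξ r = 0 := image_eq_zero_of_notMem_tsupport fun h => hr (h3 h)
      simp [this]
  have i4 : Integrable fun r : ℝ => fourierMode n f r * ((r * ξ r : ℝ) : ℂ) :=
    (locallyIntegrableOn_fourierMode hf n).integrable_mul_of_tsupport_subset
      (contDiff_id.mul h1).continuous
      (h2.of_tsupport_subset tsupport_mul_subset_right) (tsupport_mul_subset_right.trans h3)
  rw [e3, e4] at key
  have e5 : ∫ r : ℝ, ((n : ℂ) ^ 2 * ((r : ℂ)⁻¹ * (radialPermittivity ri re δ r * fourierMode n V r))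
        + r * fourierMode n f r) * (ξ r : ℂ)
      = (n : ℂ) ^ 2 * (∫ r : ℝ, (r : ℂ)⁻¹ * (radialPermittivity ri re δ r * fourierMode n V r)
        * (ξ r : ℂ)) + ∫ r : ℝ, fourierMode n f r * ((r * ξ r : ℝ) : ℂ) := by
    rw [← integral_const_mul, ← integral_add (i3.const_mul _) i4]
    congr 1; ext r
    push_cast; ring
  rw [e5]
  linear_combination key + (n : ℂ) ^ 2 * (∫ r : ℝ, (r : ℂ)⁻¹ * (radialPermittivity ri re δ r
    * fourierMode n V r) * (ξ r : ℂ)) * Complex.I_sq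

/-! ### Solution of the radial equations -/

theorem MeasureTheory.LocallyIntegrableOn.continuousOn_fun_mul {U : Set ℝ} (hU : IsOpen U)
    {w c : ℝ → ℂ} (hw : LocallyIntegrableOn w U) (hc : ContinuousOn c U) :
    LocallyIntegrableOn (fun r => c r * w r) U := by
  rw [locallyIntegrableOn_iff hU.isLocallyClosed]
  intro K hK hKc
  exact (hw.integrableOn_compact_subset hK hKc).continuousOn_mul (hc.mono hK) hKc

theorem continuousOn_inv_ofReal : ContinuousOn (fun r : ℝ => (r : ℂ)⁻¹) (Set.Ioi 0) :=
  Complex.continuous_ofReal.continuousOn.inv₀ fun x hx => by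
    have : (0 : ℝ) < x := hx
    exact_mod_cast this.ne'

theorem contDiffOn_zpow (s : ℤ) : ContDiffOn ℝ ∞ (fun r : ℝ => r ^ s) (Set.Ioi 0) := by
  intro x hx
  have hx0 : x ≠ 0 := ne_of_gt hx
  apply ContDiffAt.contDiffWithinAt
  rcases s with k | k
  · simp only [Int.ofNat_eq_natCast, zpow_natCast]
    exact (contDiff_id.pow k).contDiffAt
  · simp only [zpow_negSucc]
    exact (contDiff_id.pow (k + 1)).contDiffAt.inv (pow_ne_zero _ hx0)

theorem continuousOn_zpow_ofReal (s : ℤ) :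
    ContinuousOn (fun r : ℝ => ((r ^ s : ℝ) : ℂ)) (Set.Ioi 0) :=
  Complex.continuous_ofReal.comp_continuousOn (contDiffOn_zpow s).continuousOn

/-- The combinations `r^{-s} (p + s v)` of a solution of `r v' = p`, `p' = m² v / r + g` with
`s² = m²` are primitives of `r^{-s} g`. -/
theorem ae_eq_of_radial_system {U : Set ℝ} (hUo : IsOpen U) (hU : U.OrdConnected)
    (hpos : U ⊆ Set.Ioi 0) {m : ℕ} {s : ℤ} (hs : s ^ 2 = (m : ℤ) ^ 2) {v p g : ℝ → ℂ}
    (iv : LocallyIntegrableOn v U) (ip : LocallyIntegrableOn p U) (ig : LocallyIntegrableOn g U)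
    (hv : HasWeakDerivOn U v fun r => (r : ℂ)⁻¹ * p r)
    (hp : HasWeakDerivOn U p fun r => (m : ℂ) ^ 2 * ((r : ℂ)⁻¹ * v r) + g r)
    {c : ℝ} (hc : c ∈ U) :
    ∃ C : ℂ, ∀ᵐ r, r ∈ U → p r + s * v r
      = ((r ^ s : ℝ) : ℂ) * (C + ∫ x in c..r, ((x ^ (-s) : ℝ) : ℂ) * g x) := by
  have cinv := continuousOn_inv_ofReal.mono hpos
  have ipr := ip.continuousOn_fun_mul hUo cinv
  have ivr := iv.continuousOn_fun_mul hUo cinv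
  have ivs : LocallyIntegrableOn (fun r => (s : ℂ) * v r) U := iv.smul (s : ℂ)
  have iprs : LocallyIntegrableOn (fun r : ℝ => (s : ℂ) * ((r : ℂ)⁻¹ * p r)) U := ipr.smul (s : ℂ)
  have ivrs : LocallyIntegrableOn (fun r : ℝ => (m : ℂ) ^ 2 * ((r : ℂ)⁻¹ * v r)) U :=
    ivr.smul ((m : ℂ) ^ 2)
  have ih : LocallyIntegrableOn (fun r : ℝ => (m : ℂ) ^ 2 * ((r : ℂ)⁻¹ * v r) + g r) U :=
    ivrs.add ig
  have iu : LocallyIntegrableOn (fun r => p r + s * v r) U := ip.add ivs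
  have hcz := (contDiffOn_zpow (-s)).mono hpos
  -- From s² = m² one gets (p + s v)' = (s/r)(p + s v) + g, so r^{-s} is an integrating factor.
  have H := (hp.add (hv.const_mul (s : ℂ)) ip ih ivs iprs).smooth_mul hUo iu (ih.add iprs) hcz
  have ig' : LocallyIntegrableOn (fun r : ℝ => ((r ^ (-s) : ℝ) : ℂ) * g r) U :=
    ig.continuousOn_fun_mul hUo ((continuousOn_zpow_ofReal (-s)).mono hpos)
  have H' : HasWeakDerivOn U (fun r : ℝ => ((r ^ (-s) : ℝ) : ℂ) * (p r + s * v r))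
      (fun r : ℝ => ((r ^ (-s) : ℝ) : ℂ) * g r) := by
    refine H.congr (Eventually.of_forall fun r _ => rfl) (Eventually.of_forall fun r hr => ?_)
    have hr0 : (0 : ℝ) < r := hpos hr
    have hrc : (r : ℂ) ≠ 0 := by exact_mod_cast hr0.ne'
    have hs' : (s : ℂ) ^ 2 = (m : ℂ) ^ 2 := by exact_mod_cast congrArg (Int.cast (R := ℂ)) hs
    rw [deriv_zpow, zpow_sub_one₀ hr0.ne']
    push_cast
    rw [← hs']
    field_simp
    ring
  obtain ⟨C, hC⟩ := H'.ae_eq_primitive hUo hU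
    (iu.continuousOn_fun_mul hUo ((continuousOn_zpow_ofReal (-s)).mono hpos)) ig' hc
  refine ⟨C, ?_⟩
  filter_upwards [hC] with r hr hrU
  have hr0 : (0 : ℝ) < r := hpos hrU
  rw [← hr hrU, ← mul_assoc, ← Complex.ofReal_mul, ← zpow_add₀ hr0.ne', add_neg_cancel, zpow_zero,
    Complex.ofReal_one, one_mul]

/-- A pair of functions on the half-line that satisfies, for a permittivity `e` that equals `c` in
the shell and `1` elsewhere, the equations of a Fourier mode of order `m`, together with the local
regularity at the origin and the decay at infinity. -/
structure IsRadialSolution (m : ℕ) (ri re R R' : ℝ) (c : ℂ) (e v p g : ℝ → ℂ) : Prop where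
  ri_pos : 0 < ri
  ri_lt_re : ri < re
  re_lt : re < R
  e_core : ∀ r, 0 < r → r < ri → e r = 1
  e_shell : ∀ r, ri < r → r < re → e r = c
  e_ext : ∀ r, re < r → e r = 1
  e_loc : LocallyIntegrableOn (fun r => e r * p r) (Set.Ioi 0)
  e_loc' : LocallyIntegrableOn (fun r => e r * v r) (Set.Ioi 0)
  loc_v : LocallyIntegrableOn v (Set.Ioi 0)
  loc_p : LocallyIntegrableOn p (Set.Ioi 0)
  int_p : IntegrableOn p (Set.Ioo 0 ri)
  int_g : IntegrableOn g (Set.Ioi 0)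
  g_eq_zero : ∀ r, 0 < r → r < R → g r = 0
  g_eq_zero' : ∀ r, R' < r → g r = 0
  deriv_v : HasWeakDerivOn (Set.Ioi 0) v fun r => (r : ℂ)⁻¹ * p r
  deriv_flux : HasWeakDerivOn (Set.Ioi 0) (fun r => e r * p r)
    fun r => (m : ℂ) ^ 2 * ((r : ℂ)⁻¹ * (e r * v r)) + g r
  decay : ∀ η : ℝ, 0 < η → ∃ T : ℝ, ∀ᵐ r, T < r → ‖v r‖ ≤ η

namespace IsRadialSolution

variable {m : ℕ} {ri re R R' : ℝ} {c : ℂ} {e v p g : ℝ → ℂ}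

theorem loc_g (h : IsRadialSolution m ri re R R' c e v p g) : LocallyIntegrableOn g (Set.Ioi 0) :=
  h.int_g.locallyIntegrableOn

/-- The system in a region of constant permittivity. -/
theorem deriv_p_of_const (h : IsRadialSolution m ri re R R' c e v p g) {U : Set ℝ} {k : ℂ}
    (hU : U ⊆ Set.Ioi 0) (hk : k ≠ 0) (he : ∀ r ∈ U, e r = k) :
    HasWeakDerivOn U p fun r => (m : ℂ) ^ 2 * ((r : ℂ)⁻¹ * v r) + k⁻¹ * g r := by
  refine ((h.deriv_flux.mono hU).const_mul k⁻¹).congr (Eventually.of_forall fun r hr => ?_)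
    (Eventually.of_forall fun r hr => ?_)
  · rw [he r hr, ← mul_assoc, inv_mul_cancel₀ hk, one_mul]
  · simp only [he r hr]
    field_simp

/-- The source vanishes below `R`, so the integral in `ae_eq_of_radial_system` drops out. The
exponents s = m and s = -m together give the combinations of r^m and r^{-m} when m is nonzero. -/
theorem exists_const (h : IsRadialSolution m ri re R R' c e v p g) {a b : ℝ} {k : ℂ}
    (ha : 0 ≤ a) (hab : a < b) (hbR : b ≤ R) (hk : k ≠ 0) (he : ∀ r ∈ Set.Ioo a b, e r = k)
    {s : ℤ} (hs : s ^ 2 = (m : ℤ) ^ 2) :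
    ∃ C : ℂ, ∀ᵐ r, r ∈ Set.Ioo a b → p r + s * v r = ((r ^ s : ℝ) : ℂ) * C := by
  have hU : Set.Ioo a b ⊆ Set.Ioi 0 := fun r hr => lt_of_le_of_lt ha hr.1
  have hg : ∀ r ∈ Set.Ioo a b, g r = 0 := fun r hr =>
    h.g_eq_zero r (hU hr) (hr.2.trans_le hbR)
  have hp := h.deriv_p_of_const hU hk he
  have hp' : HasWeakDerivOn (Set.Ioo a b) p
      fun r => (m : ℂ) ^ 2 * ((r : ℂ)⁻¹ * v r) + (fun _ => (0 : ℂ)) r :=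
    hp.congr (Eventually.of_forall fun r _ => rfl)
      (Eventually.of_forall fun r hr => by simp [hg r hr])
  obtain ⟨C, hC⟩ := ae_eq_of_radial_system isOpen_Ioo Set.ordConnected_Ioo hU hs
    (h.loc_v.mono_set hU) (h.loc_p.mono_set hU) (locallyIntegrableOn_const 0)
    (h.deriv_v.mono hU) hp' (c := (a + b) / 2) ⟨by linarith, by linarith⟩
  refine ⟨C, ?_⟩
  filter_upwards [hC] with r hr hrU
  rw [hr hrU]
  simp

/-- `g` lives on the compact interval [R, R'] inside (0, ∞), so weights that blow up at 0 or grow at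
infinity do no harm. -/
theorem continuousOn_mul_int (h : IsRadialSolution m ri re R R' c e v p g) {φ : ℝ → ℂ}
    (hφ : ContinuousOn φ (Set.Ioi 0)) : IntegrableOn (fun x => φ x * g x) (Set.Ioi 0) := by
  have hR : 0 < R := h.ri_pos.trans (h.ri_lt_re.trans h.re_lt)
  have hsub : Set.Icc R R' ⊆ Set.Ioi 0 := fun x hx => hR.trans_le hx.1
  have h1 : IntegrableOn (fun x => φ x * g x) (Set.Icc R R') :=
    (h.int_g.mono_set hsub).continuousOn_mul (hφ.mono hsub) isCompact_Icc
  refine h1.of_forall_sdiff_eq_zero measurableSet_Ioi ?_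
  rintro x ⟨hx, hx'⟩
  have : g x = 0 := by
    rcases lt_or_ge x R with h2 | h2
    · exact h.g_eq_zero x hx h2
    · exact h.g_eq_zero' x (not_le.1 fun h3 => hx' ⟨h2, h3⟩)
  simp [this]

theorem integral_eq_of_lt (h : IsRadialSolution m ri re R R' c e v p g) {φ : ℝ → ℂ} {a b : ℝ}
    (ha : 0 < a) (hab : a ≤ b) (hφ : ContinuousOn φ (Set.Ioi 0)) :
    ∫ x in a..b, φ x * g x
      = (∫ x in Set.Ioi a, φ x * g x) - ∫ x in Set.Ioi b, φ x * g x := by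
  have hi := h.continuousOn_mul_int hφ
  rw [intervalIntegral.integral_of_le hab, eq_sub_iff_add_eq,
    ← setIntegral_union (Set.Ioc_disjoint_Ioi le_rfl) measurableSet_Ioi
      (hi.mono_set fun x hx => ha.trans hx.1) (hi.mono_set fun x hx => (ha.trans_le hab).trans hx),
    Set.Ioc_union_Ioi_eq_Ioi hab]

theorem integral_Ioi_eq_zero (h : IsRadialSolution m ri re R R' c e v p g) {φ : ℝ → ℂ} {b : ℝ}
    (hb : R' ≤ b) : ∫ x in Set.Ioi b, φ x * g x = 0 := by
  apply setIntegral_eq_zero_of_forall_eq_zero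
  intro x hx
  rw [h.g_eq_zero' x (hb.trans_lt hx), mul_zero]

theorem integral_eq_zero (h : IsRadialSolution m ri re R R' c e v p g) {φ : ℝ → ℂ} {a b : ℝ}
    (ha : 0 < a) (hab : a ≤ b) (hb : b < R) : ∫ x in a..b, φ x * g x = 0 := by
  rw [intervalIntegral.integral_of_le hab]
  apply setIntegral_eq_zero_of_forall_eq_zero
  intro x hx
  rw [h.g_eq_zero x (ha.trans hx.1) (hx.2.trans_lt hb), mul_zero]

theorem exists_ext (h : IsRadialSolution m ri re R R' c e v p g) {s : ℤ}
    (hs : s ^ 2 = (m : ℤ) ^ 2) :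
    ∃ C : ℂ, ∀ᵐ r, r ∈ Set.Ioi re → p r + s * v r
      = ((r ^ s : ℝ) : ℂ) * (C + ∫ x in re..r, ((x ^ (-s) : ℝ) : ℂ) * g x) := by
  have hre : 0 < re := h.ri_pos.trans h.ri_lt_re
  have hU : Set.Ioi re ⊆ Set.Ioi 0 := fun r hr => hre.trans hr
  have hp := h.deriv_p_of_const hU one_ne_zero (fun r hr => h.e_ext r hr)
  simp only [inv_one, one_mul] at hp
  -- The base point `re` is not in the open exterior interval. The primitive is therefore started at
  -- some `t` in (re, R) and moved to `re` afterwards, there being no source in between.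
  obtain ⟨t, ht⟩ := exists_between h.re_lt
  obtain ⟨C, hC⟩ := ae_eq_of_radial_system isOpen_Ioi Set.ordConnected_Ioi hU hs
    (h.loc_v.mono_set hU) (h.loc_p.mono_set hU) (h.loc_g.mono_set hU)
    (h.deriv_v.mono hU) hp (c := t) ht.1
  refine ⟨C, ?_⟩
  filter_upwards [hC] with r hr hrU
  rw [hr hrU]
  have hi := h.continuousOn_mul_int (continuousOn_zpow_ofReal (-s))
  have hII : ∀ a b : ℝ, 0 < a → 0 < b →
      IntervalIntegrable (fun x : ℝ => ((x ^ (-s) : ℝ) : ℂ) * g x) volume a b := fun a b ha hb =>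
    intervalIntegrable_of_locallyIntegrableOn Set.ordConnected_Ioi hi.locallyIntegrableOn ha hb
  rw [← intervalIntegral.integral_add_adjacent_intervals (hII re t hre (hre.trans ht.1))
    (hII t r (hre.trans ht.1) (hU hrU)), h.integral_eq_zero hre ht.1.le ht.2, zero_add]

/-- A half-line has positive measure, so all the properties that hold almost everywhere hold
together at some actual radius as large as desired. The decay of `v` is exploited at such radii. -/
theorem exists_large (h : IsRadialSolution m ri re R R' c e v p g) {q : ℝ → Prop}
    (hq : ∀ᵐ r, r ∈ Set.Ioi re → q r) {η : ℝ} (hη : 0 < η) (T : ℝ) :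
    ∃ r, T < r ∧ re < r ∧ R' < r ∧ 1 < r ∧ ‖v r‖ ≤ η ∧ q r := by
  obtain ⟨T', hT'⟩ := h.decay η hη
  set M := max (max T T') (max (max re R') 1)
  have hex : ∃ r ∈ Set.Ioi M, (r ∈ Set.Ioi re → q r) ∧ (T' < r → ‖v r‖ ≤ η) := by
    by_contra hcon
    push Not at hcon
    have hsub : Set.Ioi M ⊆ {r | ¬ ((r ∈ Set.Ioi re → q r) ∧ (T' < r → ‖v r‖ ≤ η))} := by
      rintro r hr ⟨h1, h2⟩
      obtain ⟨h3, h4⟩ := hcon r hr h1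
      exact absurd (h2 h3) (not_le.2 h4)
    have h0 := measure_mono_null hsub (ae_iff.1 (hq.and hT'))
    simp at h0
  obtain ⟨r, hr, h1, h2⟩ := hex
  have hr' : M < r := hr
  have l1 : T ≤ M := (le_max_left _ _).trans (le_max_left _ _)
  have l2 : T' ≤ M := (le_max_right _ _).trans (le_max_left _ _)
  have l3 : re ≤ M := (le_max_left _ _).trans ((le_max_left _ _).trans (le_max_right _ _))
  have l4 : R' ≤ M := (le_max_right _ _).trans ((le_max_left _ _).trans (le_max_right _ _))
  have l5 : (1 : ℝ) ≤ M := (le_max_right _ _).trans (le_max_right _ _)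
  exact ⟨r, l1.trans_lt hr', l3.trans_lt hr', l4.trans_lt hr', l5.trans_lt hr',
    h2 (l2.trans_lt hr'), h1 (l3.trans_lt hr')⟩

/-- Beyond the source, 2m v = r^m K - r^{-m} L' with constants K and L'. If K were nonzero, v would
grow at least like r; a bound on v at arbitrarily large radii already excludes this. -/
theorem const_ext_eq (h : IsRadialSolution m ri re R R' c e v p g) (hm : m ≠ 0) {C L : ℂ}
    (hC : ∀ᵐ r, r ∈ Set.Ioi re → p r + (m : ℂ) * v r
      = ((r ^ (m : ℤ) : ℝ) : ℂ) * (C + ∫ x in re..r, ((x ^ (-(m : ℤ)) : ℝ) : ℂ) * g x))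
    (hL : ∀ᵐ r, r ∈ Set.Ioi re → p r - (m : ℂ) * v r
      = ((r ^ (-(m : ℤ)) : ℝ) : ℂ) * (L + ∫ x in re..r, ((x ^ (m : ℤ) : ℝ) : ℂ) * g x)) :
    C = - ∫ x in Set.Ioi re, ((x ^ (-(m : ℤ)) : ℝ) : ℂ) * g x := by
  have hre : 0 < re := h.ri_pos.trans h.ri_lt_re
  set K := C + ∫ x in Set.Ioi re, ((x ^ (-(m : ℤ)) : ℝ) : ℂ) * g x with hK
  set L' := L + ∫ x in Set.Ioi re, ((x ^ (m : ℤ) : ℝ) : ℂ) * g x with hL'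
  suffices K = 0 from eq_neg_of_add_eq_zero_left this
  by_contra hne
  have hKpos : 0 < ‖K‖ := norm_pos_iff.2 hne
  obtain ⟨r, hT, hr1, hr2, hr3, hr4, hr5, hr6⟩ := h.exists_large
    (hC.and hL |>.mono fun r hr hrm => And.intro (hr.1 hrm) (hr.2 hrm)) one_pos
    ((2 * m + ‖L'‖) / ‖K‖)
  have hr0 : 0 < r := hre.trans hr1
  have hmZ := h.integral_eq_of_lt hre hr1.le (continuousOn_zpow_ofReal (-(m : ℤ)))
  have hmZ' := h.integral_eq_of_lt hre hr1.le (continuousOn_zpow_ofReal (m : ℤ))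
  rw [h.integral_Ioi_eq_zero hr2.le, sub_zero] at hmZ hmZ'
  rw [hmZ, ← hK] at hr5
  rw [hmZ', ← hL'] at hr6
  have e1 : ((r ^ (m : ℤ) : ℝ) : ℂ) * K = 2 * m * v r + ((r ^ (-(m : ℤ)) : ℝ) : ℂ) * L' := by
    rw [← hr5, ← hr6]; ring
  have e2 : r * ‖K‖ ≤ 2 * m + ‖L'‖ := by
    calc r * ‖K‖ ≤ r ^ m * ‖K‖ := by
          gcongr
          exact le_self_pow₀ hr3.le hm
      _ = ‖((r ^ (m : ℤ) : ℝ) : ℂ) * K‖ := by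
          rw [norm_mul, Complex.norm_real, zpow_natCast, Real.norm_eq_abs,
            abs_of_pos (pow_pos hr0 m)]
      _ ≤ ‖2 * (m : ℂ) * v r‖ + ‖((r ^ (-(m : ℤ)) : ℝ) : ℂ) * L'‖ := by
          rw [e1]; exact norm_add_le _ _
      _ ≤ 2 * m * 1 + 1 * ‖L'‖ := by
          have hle : (r ^ m)⁻¹ ≤ 1 := inv_le_one_of_one_le₀ (one_le_pow₀ hr3.le)
          rw [norm_mul, norm_mul, norm_mul, Complex.norm_real, zpow_neg, zpow_natCast,
            Real.norm_eq_abs, abs_of_pos (inv_pos.2 (pow_pos hr0 m)), Complex.norm_natCast,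
            Complex.norm_ofNat]
          gcongr
      _ = _ := by ring
  rw [div_lt_iff₀ hKpos] at hT
  linarith

/-- In the core only the regular solution `r ^ m` occurs. -/
theorem const_core_eq_zero (h : IsRadialSolution m ri re R R' c e v p g) (hm : m ≠ 0) {C L : ℂ}
    (hC : ∀ᵐ r, r ∈ Set.Ioo 0 ri → p r + (m : ℂ) * v r = ((r ^ (m : ℤ) : ℝ) : ℂ) * C)
    (hL : ∀ᵐ r, r ∈ Set.Ioo 0 ri → p r - (m : ℂ) * v r = ((r ^ (-(m : ℤ)) : ℝ) : ℂ) * L) :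
    L = 0 := by
  by_contra hne
  -- Adding the two relations gives 2p = r^m C + r^{-m} L. Here p is integrable down to 0, whereas
  -- r^{-m} with m ≥ 1 is not.
  have h1 : IntegrableOn (fun r : ℝ => 2 * p r - ((r ^ (m : ℤ) : ℝ) : ℂ) * C) (Set.Ioo 0 ri) := by
    refine (h.int_p.const_mul 2).sub ?_
    have : Continuous fun r : ℝ => ((r ^ (m : ℤ) : ℝ) : ℂ) * C := by
      simp only [zpow_natCast]; fun_prop
    exact (this.integrableOn_Icc (a := 0) (b := ri)).mono_set Set.Ioo_subset_Icc_self
  have h2 : IntegrableOn (fun r : ℝ => ((r ^ (-(m : ℤ)) : ℝ) : ℂ) * L) (Set.Ioo 0 ri) := by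
    refine h1.congr ?_
    rw [Filter.EventuallyEq, ae_restrict_iff' measurableSet_Ioo]
    filter_upwards [hC, hL] with r h3 h4 hr
    rw [← h4 hr, ← h3 hr]; ring
  have h3 : IntegrableOn (fun r : ℝ => ((r ^ (-(m : ℤ)) : ℝ) : ℂ)) (Set.Ioo 0 ri) := by
    refine (h2.mul_const L⁻¹).congr (Eventually.of_forall fun r => ?_)
    simp only
    rw [mul_assoc, mul_inv_cancel₀ hne, mul_one]
  have h4 : IntegrableOn (fun r : ℝ => r ^ (-(m : ℝ))) (Set.Ioo 0 ri) := by
    refine h3.norm.congr ?_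
    rw [Filter.EventuallyEq, ae_restrict_iff' measurableSet_Ioo]
    refine Eventually.of_forall fun r hr => ?_
    rw [Complex.norm_real, Real.norm_eq_abs, abs_of_pos (zpow_pos hr.1 _), ← Real.rpow_intCast]
    push_cast
    rfl
  have h5 := (intervalIntegral.integrableOn_Ioo_rpow_iff h.ri_pos).1 h4
  have : (1 : ℝ) ≤ m := by exact_mod_cast Nat.one_le_iff_ne_zero.2 hm
  linarith

end IsRadialSolution

/-! ### Matching the radial solutions across the two circles -/

/-- The transmission conditions at the two interfaces determine the coefficients of the radial
solution of order `m` (here `x = r_i ^ m` and `y = r_e ^ m`). -/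
theorem transmission_solution {x y A B C D a : ℂ} {δ : ℝ} (hx : x ≠ 0) (hy : y ≠ 0) (hδ : δ ≠ 0)
    (h1 : A * x = B * x + C / x)
    (h2 : A * x = (-1 + Complex.I * δ) * (B * x - C / x))
    (h3 : B * y + C / y = -a * y + D / y)
    (h4 : (-1 + Complex.I * δ) * (B * y - C / y) = -a * y - D / y) :
    B * (δ ^ 2 * (y ^ 2 - x ^ 2) + 4 * x ^ 2 - 4 * Complex.I * δ * x ^ 2)
        = 2 * a * Complex.I * δ * y ^ 2 ∧
      C * (δ ^ 2 * (y ^ 2 - x ^ 2) + 4 * x ^ 2 - 4 * Complex.I * δ * x ^ 2)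
        = 2 * a * x ^ 2 * (Complex.I * δ - 2) * y ^ 2 ∧
      D * (δ ^ 2 * (y ^ 2 - x ^ 2) + 4 * x ^ 2 - 4 * Complex.I * δ * x ^ 2)
        = a * (y ^ 2 - x ^ 2) * (2 * Complex.I * δ + δ ^ 2) * y ^ 2 := by
  have hδ' : (δ : ℂ) ≠ 0 := by exact_mod_cast hδ
  have hI := Complex.I_sq
  -- `E1` eliminates the core amplitude `A` and `E2` the exterior amplitude `D`. There remains a
  -- linear 2 × 2 system for `B` and `C`.
  have E1 : C * (Complex.I * δ) = B * x ^ 2 * (Complex.I * δ - 2) := by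
    have := h1.symm.trans h2
    field_simp at this
    linear_combination this
  have E2 : B * y ^ 2 * (Complex.I * δ) + C * (2 - Complex.I * δ) = -2 * a * y ^ 2 := by
    field_simp at h3 h4
    linear_combination h3 + h4
  have E3 : D = B * y ^ 2 + C + a * y ^ 2 := by
    field_simp at h3
    linear_combination -h3
  have hB : B * (δ ^ 2 * (y ^ 2 - x ^ 2) + 4 * x ^ 2 - 4 * Complex.I * δ * x ^ 2)
        = 2 * a * Complex.I * δ * y ^ 2 := by
    linear_combination (-Complex.I * δ) * E2 + (2 - Complex.I * δ) * E1
      + (B * y ^ 2 * δ ^ 2 - B * x ^ 2 * δ ^ 2) * hI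
  have hC : C * (δ ^ 2 * (y ^ 2 - x ^ 2) + 4 * x ^ 2 - 4 * Complex.I * δ * x ^ 2)
        = 2 * a * x ^ 2 * (Complex.I * δ - 2) * y ^ 2 := by
    -- `E1` determines `C` from `B` only after division by iδ, so a nonzero loss is essential here.
    have hne : Complex.I * δ ≠ 0 := mul_ne_zero Complex.I_ne_zero hδ'
    apply mul_left_cancel₀ hne
    linear_combination (δ ^ 2 * (y ^ 2 - x ^ 2) + 4 * x ^ 2 - 4 * Complex.I * δ * x ^ 2) * E1
      + x ^ 2 * (Complex.I * δ - 2) * hB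
  refine ⟨hB, hC, ?_⟩
  rw [E3]
  linear_combination y ^ 2 * hB + hC

namespace IsRadialSolution

variable {m : ℕ} {ri re R R' : ℝ} {c : ℂ} {e v p g : ℝ → ℂ}

theorem loc_deriv_v (h : IsRadialSolution m ri re R R' c e v p g) :
    LocallyIntegrableOn (fun r : ℝ => (r : ℂ)⁻¹ * p r) (Set.Ioi 0) :=
  h.loc_p.continuousOn_fun_mul isOpen_Ioi continuousOn_inv_ofReal

theorem loc_deriv_flux (h : IsRadialSolution m ri re R R' c e v p g) :
    LocallyIntegrableOn (fun r : ℝ => (m : ℂ) ^ 2 * ((r : ℂ)⁻¹ * (e r * v r)) + g r)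
      (Set.Ioi 0) :=
  ((h.e_loc'.continuousOn_fun_mul isOpen_Ioi continuousOn_inv_ofReal).smul ((m : ℂ) ^ 2)).add
    h.loc_g

/-- The transmission condition for a function with an integrable weak derivative. -/
theorem _root_.HasWeakDerivOn.eq_of_ae_eq_of_ae_eq {w w' : ℝ → ℂ}
    (H : HasWeakDerivOn (Set.Ioi 0) w w') (iw : LocallyIntegrableOn w (Set.Ioi 0))
    (iw' : LocallyIntegrableOn w' (Set.Ioi 0)) {a x b : ℝ} {f₁ f₂ : ℝ → ℂ} (hax : a < x)
    (hxb : x < b) (hx : 0 < x) (h₁ : ∀ᵐ r, r ∈ Set.Ioo a x → w r = f₁ r)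
    (h₂ : ∀ᵐ r, r ∈ Set.Ioo x b → w r = f₂ r) (c₁ : ContinuousAt f₁ x) (c₂ : ContinuousAt f₂ x) :
    f₁ x = f₂ x := by
  obtain ⟨φ, hφ, hw⟩ := H.exists_continuousOn isOpen_Ioi Set.ordConnected_Ioi iw iw' hx
  have hφx : ContinuousAt φ x := hφ.continuousAt (isOpen_Ioi.mem_nhds hx)
  have hm : max a 0 < x := max_lt hax hx
  rw [← eq_of_continuousAt_of_ae_eq_left hm hφx c₁, ← eq_of_continuousAt_of_ae_eq_right hxb hφx c₂]
  · filter_upwards [hw, h₂] with r h3 h4 hr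
    rw [← h3 (hx.trans hr.1), h4 hr]
  · filter_upwards [hw, h₁] with r h3 h4 hr
    rw [← h3 ((le_max_right a 0).trans_lt hr.1), h4 ⟨(le_max_left a 0).trans_lt hr.1, hr.2⟩]

/-- Each of the three regions has two constants. Regularity at the origin and decay at infinity
settle one in the core and one outside; continuity of v and of the flux at both circles gives four
equations for the remaining four. Outside, the integral terms turn out to be the mode of the
Newtonian potential, so only D r^{-m} is due to the structure. -/
theorem exists_shell_and_ext {δ : ℝ}
    (h : IsRadialSolution m ri re R R' (-1 + Complex.I * δ) e v p g) (hm : m ≠ 0) (hδ : δ ≠ 0)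
    {a : ℂ} (ha : a = (2 * m : ℂ)⁻¹ * ∫ x in Set.Ioi re, ((x : ℂ) ^ m)⁻¹ * g x) :
    ∃ B C D : ℂ,
      (∀ᵐ r, r ∈ Set.Ioo ri re → v r = B * (r : ℂ) ^ m + C * ((r : ℂ) ^ m)⁻¹ ∧
        p r = m * (B * (r : ℂ) ^ m - C * ((r : ℂ) ^ m)⁻¹)) ∧
      (∀ᵐ r, r ∈ Set.Ioi re → v r = D * ((r : ℂ) ^ m)⁻¹
        - (2 * m : ℂ)⁻¹ * ((r : ℂ) ^ m * (∫ x in Set.Ioi r, ((x : ℂ) ^ m)⁻¹ * g x)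
          + ((r : ℂ) ^ m)⁻¹ * ∫ x in re..r, (x : ℂ) ^ m * g x)) ∧
      B * (δ ^ 2 * (((re : ℂ) ^ m) ^ 2 - ((ri : ℂ) ^ m) ^ 2) + 4 * ((ri : ℂ) ^ m) ^ 2
          - 4 * Complex.I * δ * ((ri : ℂ) ^ m) ^ 2)
        = 2 * a * Complex.I * δ * ((re : ℂ) ^ m) ^ 2 ∧
      C * (δ ^ 2 * (((re : ℂ) ^ m) ^ 2 - ((ri : ℂ) ^ m) ^ 2) + 4 * ((ri : ℂ) ^ m) ^ 2
          - 4 * Complex.I * δ * ((ri : ℂ) ^ m) ^ 2)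
        = 2 * a * ((ri : ℂ) ^ m) ^ 2 * (Complex.I * δ - 2) * ((re : ℂ) ^ m) ^ 2 ∧
      D * (δ ^ 2 * (((re : ℂ) ^ m) ^ 2 - ((ri : ℂ) ^ m) ^ 2) + 4 * ((ri : ℂ) ^ m) ^ 2
          - 4 * Complex.I * δ * ((ri : ℂ) ^ m) ^ 2)
        = a * (((re : ℂ) ^ m) ^ 2 - ((ri : ℂ) ^ m) ^ 2) * (2 * Complex.I * δ + δ ^ 2)
          * ((re : ℂ) ^ m) ^ 2 := by
  have hri := h.ri_pos
  have hrire := h.ri_lt_re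
  have hre : 0 < re := hri.trans hrire
  have hmC : (m : ℂ) ≠ 0 := by exact_mod_cast hm
  have hε : (-1 + Complex.I * δ : ℂ) ≠ 0 := by
    intro h0
    have := congrArg Complex.re h0
    simp at this
  have sq1 : ((m : ℤ)) ^ 2 = (m : ℤ) ^ 2 := rfl
  have sq2 : (-(m : ℤ)) ^ 2 = (m : ℤ) ^ 2 := by ring
  have hz1 : ∀ r : ℝ, ((r ^ (m : ℤ) : ℝ) : ℂ) = (r : ℂ) ^ m := fun r => by simp
  have hz2 : ∀ r : ℝ, ((r ^ (-(m : ℤ)) : ℝ) : ℂ) = ((r : ℂ) ^ m)⁻¹ := fun r => by simp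
  have hpow : ∀ {r : ℝ}, 0 < r → (r : ℂ) ^ m ≠ 0 := fun {r} hr =>
    pow_ne_zero _ (by exact_mod_cast hr.ne')
  obtain ⟨A, hA⟩ := h.exists_const le_rfl hri ((hrire.trans h.re_lt).le) one_ne_zero
    (fun r hr => h.e_core r hr.1 hr.2) sq1
  obtain ⟨A', hA'⟩ := h.exists_const le_rfl hri ((hrire.trans h.re_lt).le) one_ne_zero
    (fun r hr => h.e_core r hr.1 hr.2) sq2
  obtain ⟨B, hB⟩ := h.exists_const hri.le hrire h.re_lt.le hε
    (fun r hr => h.e_shell r hr.1 hr.2) sq1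
  obtain ⟨B', hB'⟩ := h.exists_const hri.le hrire h.re_lt.le hε
    (fun r hr => h.e_shell r hr.1 hr.2) sq2
  obtain ⟨K, hK⟩ := h.exists_ext sq1
  obtain ⟨L, hL⟩ := h.exists_ext sq2
  push_cast at hA hA' hB hB' hK hL
  simp only [neg_neg, neg_mul, ← sub_eq_add_neg] at hA' hB' hL
  have hKL := h.const_ext_eq hm (by simpa using hK) (by simpa using hL)
  have hA0 : A' = 0 := h.const_core_eq_zero hm (by simpa using hA) (by simpa using hA')
  subst hA0
  simp only [hz2] at hKL
  simp only [zpow_natCast, zpow_neg] at hA hA' hB hB' hK hL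
  -- The coefficient of r^m just outside the shell is thus -a, the incident potential.
  have hKa : K = -(2 * m * a) := by
    rw [hKL, ha]; field_simp
  have core : ∀ᵐ r, r ∈ Set.Ioo 0 ri → v r = A / (2 * m) * (r : ℂ) ^ m ∧
      p r = m * (A / (2 * m) * (r : ℂ) ^ m) := by
    filter_upwards [hA, hA'] with r h1 h2 hr
    have e1 := h1 hr
    have e2 := h2 hr
    rw [mul_zero] at e2
    constructor
    · field_simp; linear_combination e1 - e2
    · field_simp; linear_combination e1 + e2
  have shl : ∀ᵐ r, r ∈ Set.Ioo ri re →
      v r = B / (2 * m) * (r : ℂ) ^ m + -B' / (2 * m) * ((r : ℂ) ^ m)⁻¹ ∧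
      p r = m * (B / (2 * m) * (r : ℂ) ^ m - -B' / (2 * m) * ((r : ℂ) ^ m)⁻¹) := by
    filter_upwards [hB, hB'] with r h1 h2 hr
    have e1 := h1 hr
    have e2 := h2 hr
    have hr0 := hpow (hri.trans hr.1)
    constructor
    · have : v r = (2 * m : ℂ)⁻¹ * ((p r + m * v r) - (p r - m * v r)) := by field_simp; ring
      rw [this, e1, e2]; field_simp; ring
    · have : p r = 2⁻¹ * ((p r + m * v r) + (p r - m * v r)) := by ring
      rw [this, e1, e2]; field_simp; ring
  -- Between `re` and `R` there is no source, so the exterior solution is a combination of two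
  -- powers and can be matched at `re`.
  have ext : ∀ᵐ r, r ∈ Set.Ioo re R →
      v r = -a * (r : ℂ) ^ m + -L / (2 * m) * ((r : ℂ) ^ m)⁻¹ ∧
      p r = m * (-a * (r : ℂ) ^ m - -L / (2 * m) * ((r : ℂ) ^ m)⁻¹) := by
    filter_upwards [hK, hL] with r h1 h2 hr
    have e1 := h1 hr.1
    have e2 := h2 hr.1
    have i1 := h.integral_eq_zero (φ := fun x : ℝ => ((x : ℂ) ^ m)⁻¹) hre hr.1.le hr.2
    have i2 := h.integral_eq_zero (φ := fun x : ℝ => (x : ℂ) ^ m) hre hr.1.le hr.2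
    rw [i1, add_zero, hKa] at e1
    rw [i2, add_zero] at e2
    have hr0 := hpow (hre.trans hr.1)
    constructor
    · have : v r = (2 * m : ℂ)⁻¹ * ((p r + m * v r) - (p r - m * v r)) := by field_simp; ring
      rw [this, e1, e2]; field_simp; ring
    · have : p r = 2⁻¹ * ((p r + m * v r) + (p r - m * v r)) := by ring
      rw [this, e1, e2]; field_simp; ring
  have ca : ∀ (k : ℂ) {x : ℝ}, 0 < x → ContinuousAt (fun r : ℝ => k * (r : ℂ) ^ m) x := by
    intro k x _
    fun_prop
  have ci : ∀ (k : ℂ) {x : ℝ}, 0 < x → ContinuousAt (fun r : ℝ => k * ((r : ℂ) ^ m)⁻¹) x := by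
    intro k x hx
    have h1 : ContinuousAt (fun r : ℝ => (r : ℂ) ^ m) x := by fun_prop
    exact continuousAt_const.mul (h1.inv₀ (hpow hx))
  -- `t1` and `t3` express continuity of v at the inner and outer circle, `t2` and `t4` continuity
  -- of the flux there.
  have t1 := h.deriv_v.eq_of_ae_eq_of_ae_eq h.loc_v h.loc_deriv_v hri hrire hri
    (core.mono fun r hr hrm => (hr hrm).1) (shl.mono fun r hr hrm => (hr hrm).1) (ca _ hri)
    ((ca _ hri).add (ci _ hri))
  have t2 := h.deriv_flux.eq_of_ae_eq_of_ae_eq (f₁ := fun r => m * (A / (2 * m) * (r : ℂ) ^ m))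
    (f₂ := fun r => (-1 + Complex.I * δ)
      * (m * (B / (2 * m) * (r : ℂ) ^ m - -B' / (2 * m) * ((r : ℂ) ^ m)⁻¹)))
    h.e_loc h.loc_deriv_flux hri hrire hri
    (core.mono fun r hr hrm => by rw [h.e_core r hrm.1 hrm.2, one_mul]; exact (hr hrm).2)
    (shl.mono fun r hr hrm => by rw [h.e_shell r hrm.1 hrm.2, (hr hrm).2])
    (continuousAt_const.mul (ca _ hri))
    (continuousAt_const.mul (continuousAt_const.mul ((ca _ hri).sub (ci _ hri))))
  have t3 := h.deriv_v.eq_of_ae_eq_of_ae_eq h.loc_v h.loc_deriv_v hrire h.re_lt hre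
    (shl.mono fun r hr hrm => (hr hrm).1) (ext.mono fun r hr hrm => (hr hrm).1)
    ((ca _ hre).add (ci _ hre)) ((ca _ hre).add (ci _ hre))
  have t4 := h.deriv_flux.eq_of_ae_eq_of_ae_eq
    (f₁ := fun r => (-1 + Complex.I * δ)
      * (m * (B / (2 * m) * (r : ℂ) ^ m - -B' / (2 * m) * ((r : ℂ) ^ m)⁻¹)))
    (f₂ := fun r => m * (-a * (r : ℂ) ^ m - -L / (2 * m) * ((r : ℂ) ^ m)⁻¹))
    h.e_loc h.loc_deriv_flux hrire h.re_lt hre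
    (shl.mono fun r hr hrm => by rw [h.e_shell r hrm.1 hrm.2, (hr hrm).2])
    (ext.mono fun r hr hrm => by rw [h.e_ext r hrm.1, one_mul]; exact (hr hrm).2)
    (continuousAt_const.mul (continuousAt_const.mul ((ca _ hre).sub (ci _ hre))))
    (continuousAt_const.mul ((ca _ hre).sub (ci _ hre)))
  have t2' := mul_left_cancel₀ hmC (t2.trans (mul_left_comm _ _ _))
  have t4' := mul_left_cancel₀ hmC ((mul_left_comm _ _ _).trans t4)
  simp only [← div_eq_mul_inv] at t1 t2' t3 t4'
  obtain ⟨s1, s2, s3⟩ := transmission_solution (hpow hri) (hpow hre) hδ t1 t2' t3 t4'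
  refine ⟨_, _, _, shl, ?_, s1, s2, s3⟩
  filter_upwards [hK, hL] with r h1 h2 hr
  have e1 := h1 hr
  have e2 := h2 hr
  have hr0 := hpow (hre.trans hr)
  have hi := h.integral_eq_of_lt hre (le_of_lt hr) (continuousOn_zpow_ofReal (-(m : ℤ)))
  simp only [hz2] at hi
  rw [hi, hKL, sub_eq_add_neg, neg_add_cancel_left] at e1
  have : v r = (2 * m : ℂ)⁻¹ * ((p r + m * v r) - (p r - m * v r)) := by field_simp; ring
  rw [this, e1, e2]
  field_simp
  ring

/-- For m = 0 the two exponents coincide and log r takes over as second solution. The flux is a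
primitive of `g`, hence a constant C below the source. As the total charge is zero, the flux is
again C beyond the source, where v equals C log r plus a constant; decay forces C = 0, so p vanishes
in the shell. -/
theorem shell_and_ext_zero (h : IsRadialSolution 0 ri re R R' c e v p g) (hc : c ≠ 0)
    (hg : ∫ x in Set.Ioi 0, g x = 0) :
    (∀ᵐ r, r ∈ Set.Ioo ri re → p r = 0) ∧
    (∀ᵐ r, r ∈ Set.Ioi re → v r = (∫ x in Set.Ioi r, (Real.log x : ℂ) * g x)
      + Real.log r * ∫ x in re..r, g x) := by
  have hri := h.ri_pos
  have hrire := h.ri_lt_re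
  have hre : 0 < re := hri.trans hrire
  obtain ⟨t, ht⟩ := exists_between h.re_lt
  have ht0 : 0 < t := hre.trans ht.1
  have one_int : ∀ a b : ℝ, ∫ x in a..b, g x = ∫ x in a..b, (fun _ => (1 : ℂ)) x * g x := by
    intro a b; simp
  have int_t : ∫ x in Set.Ioi t, g x = 0 := by
    have hi := h.int_g
    rw [← Set.Ioc_union_Ioi_eq_Ioi ht0.le, setIntegral_union (Set.Ioc_disjoint_Ioi le_rfl)
      measurableSet_Ioi (hi.mono_set Set.Ioc_subset_Ioi_self)
      (hi.mono_set fun x hx => ht0.trans hx)] at hg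
    rw [setIntegral_eq_zero_of_forall_eq_zero (t := Set.Ioc 0 t)
      (fun x hx => h.g_eq_zero x hx.1 (hx.2.trans_lt ht.2)), zero_add] at hg
    exact hg
  have hflux : HasWeakDerivOn (Set.Ioi 0) (fun r => e r * p r) g :=
    h.deriv_flux.congr (Eventually.of_forall fun r _ => rfl)
      (Eventually.of_forall fun r _ => by simp)
  obtain ⟨C, hC⟩ := hflux.ae_eq_primitive isOpen_Ioi Set.ordConnected_Ioi h.e_loc h.loc_g ht0
  have hp_ext : ∀ᵐ r, r ∈ Set.Ioi re → p r = C + ∫ x in t..r, g x := by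
    filter_upwards [hC] with r h1 hr
    rw [← h1 (hre.trans hr), h.e_ext r hr, one_mul]
  have hU : Set.Ioi re ⊆ Set.Ioi 0 := fun r hr => hre.trans hr
  have hp := h.deriv_p_of_const hU one_ne_zero (fun r hr => h.e_ext r hr)
  have hp' : HasWeakDerivOn (Set.Ioi re) p g :=
    hp.congr (Eventually.of_forall fun r _ => rfl) (Eventually.of_forall fun r _ => by simp)
  have hlog : ContDiffOn ℝ ∞ Real.log (Set.Ioi re) := fun x hx =>
    (Real.contDiffAt_log.2 (ne_of_gt (hU hx))).contDiffWithinAt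
  have hlogc : ContinuousOn (fun r : ℝ => (Real.log r : ℂ)) (Set.Ioi 0) :=
    Complex.continuous_ofReal.comp_continuousOn
      (Real.continuousOn_log.mono fun x hx => ne_of_gt hx)
  have ip := h.loc_p.mono_set hU
  have ig := h.loc_g.mono_set hU
  have ilp := ip.continuousOn_fun_mul isOpen_Ioi (hlogc.mono hU)
  have ilg := ig.continuousOn_fun_mul isOpen_Ioi (hlogc.mono hU)
  have ipr := h.loc_deriv_v.mono_set hU
  have hder : ∀ r ∈ Set.Ioi re, ((deriv Real.log r : ℝ) : ℂ) * p r = (r : ℂ)⁻¹ * p r := by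
    intro r _
    rw [Real.deriv_log]; push_cast; rfl
  have hlp : HasWeakDerivOn (Set.Ioi re) (fun r => (Real.log r : ℂ) * p r)
      (fun r => (Real.log r : ℂ) * g r + (r : ℂ)⁻¹ * p r) :=
    (hp'.smooth_mul isOpen_Ioi ip ig hlog).congr (Eventually.of_forall fun r _ => rfl)
      (Eventually.of_forall fun r hr => by rw [hder r hr])
  -- The combination v - p log r plays the role of p ± m v: its derivative is -g log r, free of v
  -- and p.
  have iu : LocallyIntegrableOn (fun r => v r + (-1) * ((Real.log r : ℂ) * p r)) (Set.Ioi re) :=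
    (h.loc_v.mono_set hU).add (ilp.smul (-1 : ℂ))
  have hu : HasWeakDerivOn (Set.Ioi re) (fun r => v r + (-1) * ((Real.log r : ℂ) * p r))
      (fun r => (-1) * ((Real.log r : ℂ) * g r)) :=
    ((h.deriv_v.mono hU).add (hlp.const_mul (-1)) (h.loc_v.mono_set hU) ipr (ilp.smul (-1 : ℂ))
      ((ilg.add ipr).smul (-1 : ℂ))).congr (Eventually.of_forall fun r _ => rfl)
      (Eventually.of_forall fun r _ => by ring)
  obtain ⟨E, hE⟩ := hu.ae_eq_primitive isOpen_Ioi Set.ordConnected_Ioi iu (ilg.smul (-1 : ℂ)) ht.1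
  have hv_ext : ∀ᵐ r, r ∈ Set.Ioi re → v r = Real.log r * (C + ∫ x in t..r, g x)
      + (E - ∫ x in t..r, (Real.log x : ℂ) * g x) := by
    filter_upwards [hE, hp_ext] with r h1 h2 hr
    have : v r + (-1) * ((Real.log r : ℂ) * p r)
        = E + ∫ x in t..r, (-1) * ((Real.log x : ℂ) * g x) := h1 hr
    rw [intervalIntegral.integral_const_mul] at this
    rw [← h2 hr]
    linear_combination this
  set E' := E - ∫ x in Set.Ioi t, (Real.log x : ℂ) * g x with hE'
  have large : ∀ r, t < r → R' < r → v r = Real.log r * (C + ∫ x in t..r, g x)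
      + (E - ∫ x in t..r, (Real.log x : ℂ) * g x) → v r = Real.log r * C + E' := by
    intro r h1 h2 h3
    rw [one_int, h.integral_eq_of_lt ht0 h1.le continuousOn_const,
      h.integral_eq_of_lt ht0 h1.le hlogc, h.integral_Ioi_eq_zero h2.le,
      h.integral_Ioi_eq_zero h2.le] at h3
    simp only [one_mul, int_t, sub_zero, add_zero] at h3
    exact h3
  have hC0 : C = 0 := by
    by_contra hne
    have hpos : 0 < ‖C‖ := norm_pos_iff.2 hne
    obtain ⟨r, k1, k2, k3, k4, k5, k6⟩ := h.exists_large hv_ext one_pos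
      (max t (Real.exp ((1 + ‖E'‖) / ‖C‖)))
    have l := large r ((le_max_left _ _).trans_lt k1) k3 k6
    have k7 := (le_max_right _ _).trans_lt k1
    have k8 : (1 + ‖E'‖) / ‖C‖ < Real.log r := (Real.lt_log_iff_exp_lt (by linarith)).2 k7
    have k9 : Real.log r * ‖C‖ ≤ 1 + ‖E'‖ := by
      have k10 : 0 ≤ Real.log r := Real.log_nonneg k4.le
      calc Real.log r * ‖C‖ = ‖v r - E'‖ := by
            rw [l, add_sub_cancel_right, norm_mul, Complex.norm_real, Real.norm_eq_abs,
              abs_of_nonneg k10]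
        _ ≤ ‖v r‖ + ‖E'‖ := norm_sub_le _ _
        _ ≤ 1 + ‖E'‖ := by gcongr
    rw [div_lt_iff₀ hpos] at k8
    linarith
  subst hC0
  -- Boundedness would leave a constant at infinity; here the limit zero of v is needed.
  have hE0 : E' = 0 := by
    by_contra hne
    have hpos : 0 < ‖E'‖ := norm_pos_iff.2 hne
    obtain ⟨r, k1, k2, k3, k4, k5, k6⟩ := h.exists_large hv_ext (half_pos hpos) t
    have l := large r k1 k3 k6
    rw [mul_zero, zero_add] at l
    rw [l] at k5
    linarith
  constructor
  · filter_upwards [hC] with r h1 hr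
    have := h1 (hri.trans hr.1)
    rw [h.e_shell r hr.1 hr.2, intervalIntegral.integral_symm, one_int,
      h.integral_eq_zero (hri.trans hr.1) (hr.2.trans ht.1).le ht.2] at this
    simpa [hc] using this
  · have hII : ∀ {φ : ℝ → ℂ}, ContinuousOn φ (Set.Ioi 0) → ∀ a b : ℝ, 0 < a → 0 < b →
        IntervalIntegrable (fun x => φ x * g x) volume a b := fun hφ a b ha hb =>
      intervalIntegrable_of_locallyIntegrableOn Set.ordConnected_Ioi
        (h.continuousOn_mul_int hφ).locallyIntegrableOn ha hb
    have base : ∀ r, 0 < r → ∀ {φ : ℝ → ℂ}, ContinuousOn φ (Set.Ioi 0) →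
        ∫ x in re..r, φ x * g x = ∫ x in t..r, φ x * g x := by
      intro r hr φ hφ
      rw [← intervalIntegral.integral_add_adjacent_intervals (hII hφ re t hre ht0)
        (hII hφ t r ht0 hr), h.integral_eq_zero hre ht.1.le ht.2, zero_add]
    have tail : ∀ r, re < r → (∫ x in Set.Ioi r, (Real.log x : ℂ) * g x)
        = (∫ x in Set.Ioi t, (Real.log x : ℂ) * g x) - ∫ x in t..r, (Real.log x : ℂ) * g x := by
      intro r hr
      have e1 := h.integral_eq_of_lt hre hr.le hlogc
      have e2 := h.integral_eq_of_lt hre ht.1.le hlogc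
      rw [h.integral_eq_zero hre ht.1.le ht.2] at e2
      rw [base r (hre.trans hr) hlogc] at e1
      linear_combination e1 - e2
    filter_upwards [hv_ext] with r h1 hr
    have hr0 : 0 < r := hre.trans hr
    rw [h1 hr, tail r hr, one_int re r, base r hr0 continuousOn_const]
    have hEE : E = ∫ x in Set.Ioi t, (Real.log x : ℂ) * g x := sub_eq_zero.1 hE0
    rw [← hEE]
    simp only [one_mul]
    ring

end IsRadialSolution

/-! ### Fourier integrals of power series and of the logarithmic kernel -/

theorem integral_angularMeasure_eq {E : Type*} [NormedAddCommGroup E] [NormedSpace ℝ E] (u : ℝ → E) :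
    ∫ θ, u θ ∂angularMeasure = ∫ θ in (-Real.pi)..Real.pi, u θ := by
  rw [angularMeasure, intervalIntegral.integral_of_le (by linarith [Real.pi_pos]),
    integral_Ioc_eq_integral_Ioo]

theorem integral_angularMeasure_eq_of_periodic {E : Type*} [NormedAddCommGroup E]
    [NormedSpace ℝ E] {u : ℝ → E} (hu : u.Periodic (2 * Real.pi)) :
    ∫ θ, u θ ∂angularMeasure = ∫ θ in (0 : ℝ)..(2 * Real.pi), u θ := by
  rw [integral_angularMeasure_eq]
  have := hu.intervalIntegral_add_eq (-Real.pi) 0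
  rw [zero_add] at this
  rw [← this]
  congr 1
  ring

theorem measureReal_angularMeasure : angularMeasure.real Set.univ = 2 * Real.pi := by
  rw [angularMeasure, Measure.real, Measure.restrict_apply_univ, Real.volume_Ioo,
    ENNReal.toReal_ofReal (by linarith [Real.pi_pos])]
  ring

theorem integral_exp_mul_exp_neg (k n : ℤ) :
    ∫ θ, Complex.exp (Complex.I * k * (θ : ℝ)) * Complex.exp (-(Complex.I * n * θ)) ∂angularMeasure
      = if k = n then 2 * (Real.pi : ℂ) else 0 := by
  have h1 : ∀ θ : ℝ, Complex.exp (Complex.I * k * θ) * Complex.exp (-(Complex.I * n * θ))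
      = Complex.exp ((Complex.I * (k - n : ℤ)) * θ) := by
    intro θ; rw [← Complex.exp_add]; congr 1; push_cast; ring
  simp only [h1]
  split_ifs with h
  · subst h
    simp only [sub_self, Int.cast_zero, mul_zero, zero_mul, Complex.exp_zero]
    rw [integral_const, measureReal_angularMeasure]
    simp
  · have hne : Complex.I * ((k - n : ℤ) : ℂ) ≠ 0 := by
      refine mul_ne_zero Complex.I_ne_zero ?_
      exact_mod_cast sub_ne_zero.2 h
    rw [integral_angularMeasure_eq, integral_exp_mul_complex hne]
    have e : Complex.exp (Complex.I * ((k - n : ℤ) : ℂ) * (Real.pi : ℝ))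
        = Complex.exp (Complex.I * ((k - n : ℤ) : ℂ) * ((-Real.pi : ℝ) : ℂ)) := by
      rw [Complex.exp_eq_exp_iff_exists_int]
      exact ⟨k - n, by push_cast; ring⟩
    rw [e, sub_self, zero_div]

theorem norm_exp_I_mul (n : ℤ) (θ : ℝ) : ‖Complex.exp (Complex.I * n * θ)‖ = 1 := by
  rw [Complex.norm_exp]; simp

/-- The Fourier integrals of an absolutely convergent trigonometric series. -/
theorem integral_mul_exp_of_hasSum {ι : Type*} [Countable ι] {b : ι → ℂ}
    (hs : Summable fun k => ‖b k‖) {j : ι → ℤ} (hj : Function.Injective j) {u : ℝ → ℂ}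
    (hu : ∀ θ : ℝ, HasSum (fun k => b k * Complex.exp (Complex.I * j k * θ)) (u θ)) :
    (∀ k, ∫ θ, u θ * Complex.exp (-(Complex.I * j k * θ)) ∂angularMeasure = 2 * Real.pi * b k) ∧
      ∀ n, n ∉ Set.range j →
        ∫ θ, u θ * Complex.exp (-(Complex.I * n * θ)) ∂angularMeasure = 0 := by
  have key : ∀ n : ℤ, HasSum (fun k => b k * if j k = n then 2 * (Real.pi : ℂ) else 0)
      (∫ θ, u θ * Complex.exp (-(Complex.I * n * θ)) ∂angularMeasure) := by
    intro n
    have h1 := hasSum_integral_of_summable_integral_norm (μ := angularMeasure)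
      (F := fun k (θ : ℝ) => b k * Complex.exp (Complex.I * j k * θ)
        * Complex.exp (-(Complex.I * n * θ))) ?_ ?_
    · have e1 : ∀ k, ∫ θ : ℝ, b k * Complex.exp (Complex.I * j k * θ)
          * Complex.exp (-(Complex.I * n * θ)) ∂angularMeasure
          = b k * if j k = n then 2 * (Real.pi : ℂ) else 0 := by
        intro k
        rw [← integral_exp_mul_exp_neg, ← integral_const_mul]
        congr 1; ext θ; ring
      have e2 : ∀ θ : ℝ, ∑' k, b k * Complex.exp (Complex.I * j k * θ)
          * Complex.exp (-(Complex.I * n * θ)) = u θ * Complex.exp (-(Complex.I * n * θ)) :=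
        fun θ => ((hu θ).mul_right _).tsum_eq
      simp only [e1, e2] at h1
      exact h1
    · intro k
      refine Integrable.of_bound (C := ‖b k‖) ?_ (Eventually.of_forall fun θ => ?_)
      · exact Continuous.aestronglyMeasurable (by fun_prop)
      · rw [norm_mul, norm_mul, norm_exp_I_mul, norm_exp_neg_I_mul, mul_one, mul_one]
    · simp only [norm_mul, norm_exp_I_mul, norm_exp_neg_I_mul, mul_one, integral_const,
        smul_eq_mul]
      exact hs.mul_left _
  constructor
  · intro k
    have h1 := key (j k)
    have h2 : HasSum (fun k' => b k' * if j k' = j k then 2 * (Real.pi : ℂ) else 0)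
        (b k * if j k = j k then 2 * (Real.pi : ℂ) else 0) := by
      apply hasSum_single
      intro k' hk'
      rw [if_neg (fun h => hk' (hj h)), mul_zero]
    rw [h1.unique h2, if_pos rfl]; ring
  · intro n hn
    refine (key n).unique ?_
    have : ∀ k, (b k * if j k = n then 2 * (Real.pi : ℂ) else 0) = 0 := by
      intro k
      rw [if_neg (fun h => hn ⟨k, h⟩), mul_zero]
    simp only [this]
    exact hasSum_zero

/-- The Fourier integrals of the real part of a power series. -/
theorem integral_re_mul_exp_of_hasSum {b : ℕ → ℂ} (hs : Summable fun k => ‖b k‖) {u : ℝ → ℂ}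
    (hu : ∀ θ : ℝ, HasSum (fun k : ℕ => b k * Complex.exp (Complex.I * (k : ℤ) * θ)) (u θ))
    (huc : Continuous u) {n : ℤ} (hn : n ≠ 0) :
    ∫ θ, ((u θ).re : ℂ) * Complex.exp (-(Complex.I * n * θ)) ∂angularMeasure
      = Real.pi * if 0 < n then b n.natAbs else (starRingEnd ℂ) (b n.natAbs) := by
  have hu' : ∀ θ : ℝ, HasSum (fun k : ℕ => (starRingEnd ℂ) (b k)
      * Complex.exp (Complex.I * ((-(k : ℤ) : ℤ) : ℂ) * θ)) ((starRingEnd ℂ) (u θ)) := by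
    intro θ
    have := (hu θ).mapL (Complex.conjCLE : ℂ →L[ℝ] ℂ)
    simp only [ContinuousLinearEquiv.coe_coe, Complex.conjCLE_apply, map_mul] at this
    convert! this using 2 with k
    rw [← Complex.exp_conj]
    congr 2
    simp
  have h1 := integral_mul_exp_of_hasSum hs (j := fun k : ℕ => (k : ℤ)) Nat.cast_injective hu
  have h2 := integral_mul_exp_of_hasSum (b := fun k => (starRingEnd ℂ) (b k)) (by simpa using hs)
    (j := fun k : ℕ => -(k : ℤ)) (fun a b h => by simpa using h) hu'
  have i1 : Integrable (fun θ : ℝ => u θ * Complex.exp (-(Complex.I * n * θ))) angularMeasure := by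
    have : Continuous fun θ : ℝ => u θ * Complex.exp (-(Complex.I * n * θ)) := by fun_prop
    exact (this.integrableOn_Icc (a := -Real.pi) (b := Real.pi)).mono_set Set.Ioo_subset_Icc_self
  have i2 : Integrable (fun θ : ℝ => (starRingEnd ℂ) (u θ) * Complex.exp (-(Complex.I * n * θ)))
      angularMeasure := by
    have : Continuous fun θ : ℝ => (starRingEnd ℂ) (u θ) * Complex.exp (-(Complex.I * n * θ)) :=
      (Complex.continuous_conj.comp huc).mul (by fun_prop)
    exact (this.integrableOn_Icc (a := -Real.pi) (b := Real.pi)).mono_set Set.Ioo_subset_Icc_self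
  -- The real part is half the sum of u, which has frequencies k ≥ 0, and its conjugate, which has
  -- frequencies k ≤ 0. For n ≠ 0 exactly one of them contributes.
  have e : ∫ θ, ((u θ).re : ℂ) * Complex.exp (-(Complex.I * n * θ)) ∂angularMeasure
      = 2⁻¹ * ((∫ θ, u θ * Complex.exp (-(Complex.I * n * θ)) ∂angularMeasure)
        + ∫ θ, (starRingEnd ℂ) (u θ) * Complex.exp (-(Complex.I * n * θ)) ∂angularMeasure) := by
    rw [← integral_add i1 i2, ← integral_const_mul]
    congr 1; ext θ
    rw [← add_mul, Complex.add_conj]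
    push_cast; ring
  rw [e]
  rcases lt_trichotomy n 0 with h | h | h
  · have h3 := h2.1 n.natAbs
    have hn' : -((n.natAbs : ℕ) : ℤ) = n := by omega
    simp only [hn'] at h3
    rw [h3, h1.2 n (by rintro ⟨k, hk⟩; simp only at hk; omega), if_neg (by omega)]
    ring
  · exact absurd h hn
  · have h3 := h1.1 n.natAbs
    have hn' : ((n.natAbs : ℕ) : ℤ) = n := by omega
    simp only [hn'] at h3
    rw [h3, h2.2 n (by rintro ⟨k, hk⟩; simp only at hk; omega), if_pos h]
    ring

theorem exp_I_mul_natCast (k : ℕ) (θ : ℝ) :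
    Complex.exp (Complex.I * ((k : ℤ) : ℂ) * θ) = Complex.exp (θ * Complex.I) ^ k := by
  rw [← Complex.exp_nat_mul]; congr 1; push_cast; ring

theorem angularMode_eq_ite {y : Plane} (hy : y ≠ 0) (n : ℤ) :
    angularMode n y = if 0 < n then ((starRingEnd ℂ) (toComplex y) / (‖y‖ : ℂ)) ^ n.natAbs
      else (starRingEnd ℂ) (((starRingEnd ℂ) (toComplex y) / (‖y‖ : ℂ)) ^ n.natAbs) := by
  rw [angularMode]
  set σ := (starRingEnd ℂ) (toComplex y) / (‖y‖ : ℂ) with hσ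
  have h1 : ‖σ‖ = 1 := by
    rw [hσ, norm_div, RCLike.norm_conj, norm_toComplex, Complex.norm_real, norm_norm,
      div_self (norm_ne_zero_iff.2 hy)]
  split_ifs with h
  · conv_lhs => rw [show n = ((n.natAbs : ℕ) : ℤ) by omega]
    exact zpow_natCast _ _
  · conv_lhs => rw [show n = -((n.natAbs : ℕ) : ℤ) by omega]
    rw [zpow_neg, zpow_natCast, Complex.inv_def, Complex.normSq_eq_norm_sq, norm_pow, h1]
    simp

/-- The Fourier integrals of `log |1 - q e^{iθ}|`, `|q| < 1`. -/
theorem integral_log_norm_one_sub_mul_exp {t : ℝ} (ht0 : 0 ≤ t) (ht1 : t < 1) {y : Plane}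
    (hy : y ≠ 0) {n : ℤ} (hn : n ≠ 0) :
    ∫ θ : ℝ, (Real.log ‖1 - t * ((starRingEnd ℂ) (toComplex y) / (‖y‖ : ℂ))
        * Complex.exp (θ * Complex.I)‖ : ℂ) * Complex.exp (-(Complex.I * n * θ)) ∂angularMeasure
      = -((Real.pi / n.natAbs * t ^ n.natAbs : ℝ) : ℂ) * angularMode n y := by
  set σ := (starRingEnd ℂ) (toComplex y) / (‖y‖ : ℂ) with hσ
  have h1 : ‖σ‖ = 1 := by
    rw [hσ, norm_div, RCLike.norm_conj, norm_toComplex, Complex.norm_real, norm_norm,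
      div_self (norm_ne_zero_iff.2 hy)]
  have hq : ∀ θ : ℝ, ‖t * σ * Complex.exp (θ * Complex.I)‖ = t := by
    intro θ
    rw [norm_mul, norm_mul, h1, Complex.norm_exp_ofReal_mul_I, Complex.norm_real,
      Real.norm_eq_abs, abs_of_nonneg ht0, mul_one, mul_one]
  have hne : ∀ θ : ℝ, 1 - t * σ * Complex.exp (θ * Complex.I) ∈ Complex.slitPlane := by
    intro θ
    left
    have := (Complex.abs_re_le_norm (t * σ * Complex.exp (θ * Complex.I))).trans_eq (hq θ)
    rw [Complex.sub_re, Complex.one_re]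
    linarith [(abs_le.1 this).2]
  -- These are the Taylor coefficients of log(1 - z). At k = 0 the division by zero yields 0, which
  -- is the correct value.
  set b : ℕ → ℂ := fun k => -(((t : ℂ) * σ) ^ k / k) with hb
  have hs : Summable fun k => ‖b k‖ := by
    refine Summable.of_nonneg_of_le (fun _ => norm_nonneg _) (fun k => ?_)
      (summable_geometric_of_lt_one ht0 ht1)
    rw [hb]
    simp only [norm_neg, norm_div, norm_pow, norm_mul, h1, Complex.norm_real, Real.norm_eq_abs,
      abs_of_nonneg ht0, mul_one, Complex.norm_natCast]
    rcases Nat.eq_zero_or_pos k with rfl | hk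
    · simp
    · exact div_le_self (pow_nonneg ht0 k) (by exact_mod_cast hk)
  have hu : ∀ θ : ℝ, HasSum (fun k : ℕ => b k * Complex.exp (Complex.I * (k : ℤ) * θ))
      (Complex.log (1 - t * σ * Complex.exp (θ * Complex.I))) := by
    intro θ
    have h2 := (Complex.hasSum_taylorSeries_neg_log (z := t * σ * Complex.exp (θ * Complex.I))
      (by rw [hq]; exact ht1)).neg
    rw [neg_neg] at h2
    convert! h2 using 2 with k
    rw [exp_I_mul_natCast, hb]
    simp only
    rw [mul_pow _ (Complex.exp _)]
    ring
  have huc : Continuous fun θ : ℝ => Complex.log (1 - t * σ * Complex.exp (θ * Complex.I)) := by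
    refine Continuous.clog (by fun_prop) hne
  have h3 := integral_re_mul_exp_of_hasSum hs hu huc hn
  simp only [Complex.log_re] at h3
  rw [h3, angularMode_eq_ite hy n, ← hσ]
  split_ifs
  · simp only [hb]; push_cast; rw [mul_pow]; ring
  · simp only [hb, map_neg, map_div₀, map_pow, map_mul, Complex.conj_ofReal, map_natCast]
    push_cast; rw [mul_pow]; ring

theorem norm_polarMap_sub (r θ : ℝ) (y : Plane) :
    ‖polarMap (r, θ) - y‖ = ‖r * Complex.exp (θ * Complex.I) - toComplex y‖ := by
  rw [← norm_toComplex, ← toComplex_polarMap]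
  congr 1
  simp only [toComplex, map_sub]

/-- This is Jensen's formula for a linear factor: the mean of log |z - w| over the circle of radius
r is log max(r, |w|). It also covers points w on the circle itself, where the integrand is
unbounded. -/
theorem integrable_log_norm_polarMap_sub (r : ℝ) (y : Plane) :
    Integrable (fun θ => Real.log ‖polarMap (r, θ) - y‖) angularMeasure ∧
    (0 < r → ∫ θ, Real.log ‖polarMap (r, θ) - y‖ ∂angularMeasure
      = 2 * Real.pi * Real.log (max r ‖y‖)) := by
  have hper : Function.Periodic (fun θ : ℝ => Real.log ‖polarMap (r, θ) - y‖) (2 * Real.pi) := by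
    intro θ
    simp only [norm_polarMap_sub]
    congr 3
    push_cast
    rw [add_mul, Complex.exp_add, show (2 * (Real.pi : ℂ)) * Complex.I = 2 * Real.pi * Complex.I by
      ring, Complex.exp_two_pi_mul_I, mul_one]
  have he : (fun θ : ℝ => Real.log ‖polarMap (r, θ) - y‖)
      = fun θ => Real.log ‖circleMap 0 r θ - toComplex y‖ := by
    funext θ
    rw [norm_polarMap_sub, circleMap, zero_add]
  have h1 : CircleIntegrable (fun z => Real.log ‖z - toComplex y‖) 0 r :=
    circleIntegrable_log_norm_sub_const r
  have h2 : IntervalIntegrable (fun θ => Real.log ‖polarMap (r, θ) - y‖) volume 0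
      (2 * Real.pi) := by
    rw [he]; exact h1
  refine ⟨?_, fun hr => ?_⟩
  · have h3 := hper.intervalIntegrable₀ (by positivity) h2 (-Real.pi) Real.pi
    rw [intervalIntegrable_iff_integrableOn_Ioo_of_le (by linarith [Real.pi_pos])] at h3
    exact h3
  · rw [integral_angularMeasure_eq_of_periodic hper]
    have h3 := circleAverage_log_norm_sub_const_eq_log_radius_add_posLog (a := toComplex y)
      (c := 0) hr.ne'
    rw [Real.circleAverage_def, smul_eq_mul, inv_mul_eq_iff_eq_mul₀ (by positivity)] at h3
    rw [he, h3, zero_sub, norm_neg, norm_toComplex]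
    congr 1
    change Real.log r + max 0 (Real.log (r⁻¹ * ‖y‖)) = _
    rcases (norm_nonneg y).eq_or_lt with h0 | h0
    · rw [← h0]; simp [hr.le]
    · rw [Real.log_mul (by positivity) h0.ne', Real.log_inv]
      rcases le_total r ‖y‖ with h | h
      · have := Real.log_le_log hr h
        rw [max_eq_right h, max_eq_right (by linarith)]; ring
      · have := Real.log_le_log h0 h
        rw [max_eq_left h, max_eq_left (by linarith)]; ring

/-- Factor out the larger of the two moduli. If it is r, the remaining factor is conjugated, which
leaves its modulus unchanged and brings both cases to one form. -/
theorem log_norm_polarMap_sub {r : ℝ} (hr : 0 < r) {y : Plane} (hy : y ≠ 0) (hry : r ≠ ‖y‖)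
    (θ : ℝ) :
    Real.log ‖polarMap (r, θ) - y‖ = Real.log (max r ‖y‖)
      + Real.log ‖1 - ((min r ‖y‖ / max r ‖y‖ : ℝ) : ℂ)
        * ((starRingEnd ℂ) (toComplex y) / (‖y‖ : ℂ)) * Complex.exp (θ * Complex.I)‖ := by
  have hs : 0 < ‖y‖ := norm_pos_iff.2 hy
  have hw : toComplex y ≠ 0 := by rw [← norm_pos_iff, norm_toComplex]; exact hs
  have hsq : toComplex y * (starRingEnd ℂ) (toComplex y) = (‖y‖ : ℂ) ^ 2 := by
    rw [Complex.mul_conj, Complex.normSq_eq_norm_sq, norm_toComplex]; push_cast; rfl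
  have hs' : (‖y‖ : ℂ) ≠ 0 := by exact_mod_cast hs.ne'
  have hr' : (r : ℂ) ≠ 0 := by exact_mod_cast hr.ne'
  have hE : ‖Complex.exp (θ * Complex.I)‖ = 1 := Complex.norm_exp_ofReal_mul_I θ
  rw [norm_polarMap_sub]
  have hpos : (0 : ℝ) < ‖(r : ℂ) * Complex.exp (θ * Complex.I) - toComplex y‖ := by
    rw [norm_pos_iff, sub_ne_zero]
    intro h
    have := congrArg norm h
    rw [norm_mul, hE, mul_one, Complex.norm_real, norm_toComplex, Real.norm_eq_abs,
      abs_of_pos hr] at this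
    exact hry this
  have key : ‖(r : ℂ) * Complex.exp (θ * Complex.I) - toComplex y‖ = max r ‖y‖ *
      ‖1 - ((min r ‖y‖ / max r ‖y‖ : ℝ) : ℂ)
        * ((starRingEnd ℂ) (toComplex y) / (‖y‖ : ℂ)) * Complex.exp (θ * Complex.I)‖ := by
    rcases hry.lt_or_gt with h | h
    · rw [max_eq_right h.le, min_eq_left h.le]
      rw [← norm_neg]
      have e : -((r : ℂ) * Complex.exp (θ * Complex.I) - toComplex y) = toComplex y *
          (1 - ((r / ‖y‖ : ℝ) : ℂ) * ((starRingEnd ℂ) (toComplex y) / (‖y‖ : ℂ))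
            * Complex.exp (θ * Complex.I)) := by
        push_cast
        field_simp
        linear_combination (-(r : ℂ) * Complex.exp (θ * Complex.I)) * -hsq
      rw [e, norm_mul, norm_toComplex]
    · rw [max_eq_left h.le, min_eq_right h.le]
      have e : (r : ℂ) * Complex.exp (θ * Complex.I) - toComplex y = Complex.exp (θ * Complex.I) *
          (starRingEnd ℂ) (r * (1 - ((‖y‖ / r : ℝ) : ℂ)
            * ((starRingEnd ℂ) (toComplex y) / (‖y‖ : ℂ)) * Complex.exp (θ * Complex.I))) := by
        have hEE : Complex.exp (θ * Complex.I) * (starRingEnd ℂ) (Complex.exp (θ * Complex.I))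
            = 1 := by
          rw [Complex.mul_conj, Complex.normSq_eq_norm_sq, hE]; simp
        simp only [map_mul, map_sub, map_one, map_div₀, Complex.conj_ofReal, Complex.conj_conj]
        push_cast
        field_simp
        linear_combination toComplex y * hEE
      rw [e, norm_mul, hE, one_mul, RCLike.norm_conj, norm_mul, Complex.norm_real,
        Real.norm_eq_abs, abs_of_pos hr]
  have hmax : 0 < max r ‖y‖ := lt_max_of_lt_left hr
  rw [key, Real.log_mul hmax.ne']
  intro h0
  rw [key, h0, mul_zero] at hpos
  exact hpos.false

/-- The Fourier integrals of `log |x - y|` over a circle. -/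
theorem integral_log_norm_polarMap_sub_mul_exp {r : ℝ} (hr : 0 < r) {y : Plane} (hy : y ≠ 0)
    (hry : r ≠ ‖y‖) {n : ℤ} (hn : n ≠ 0) :
    ∫ θ : ℝ, (Real.log ‖polarMap (r, θ) - y‖ : ℂ) * Complex.exp (-(Complex.I * n * θ))
        ∂angularMeasure
      = -((Real.pi / n.natAbs * (min r ‖y‖ / max r ‖y‖) ^ n.natAbs : ℝ) : ℂ)
        * angularMode n y := by
  have hs : 0 < ‖y‖ := norm_pos_iff.2 hy
  have hmax : 0 < max r ‖y‖ := lt_max_of_lt_left hr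
  have hlt : min r ‖y‖ / max r ‖y‖ < 1 := by
    rw [div_lt_one hmax, min_lt_max]; exact hry
  rw [← integral_log_norm_one_sub_mul_exp (by positivity) hlt hy hn]
  have hi := (integrable_log_norm_polarMap_sub r y).1
  have e : ∀ θ : ℝ, (Real.log ‖1 - ((min r ‖y‖ / max r ‖y‖ : ℝ) : ℂ)
        * ((starRingEnd ℂ) (toComplex y) / (‖y‖ : ℂ)) * Complex.exp (θ * Complex.I)‖ : ℂ)
      * Complex.exp (-(Complex.I * n * θ))
      = (Real.log ‖polarMap (r, θ) - y‖ : ℂ) * Complex.exp (-(Complex.I * n * θ))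
        - (Real.log (max r ‖y‖) : ℂ) * (Complex.exp (Complex.I * (0 : ℤ) * θ)
          * Complex.exp (-(Complex.I * n * θ))) := by
    intro θ
    rw [log_norm_polarMap_sub hr hy hry θ]
    push_cast
    rw [mul_zero, zero_mul, Complex.exp_zero]; ring
  simp only [e]
  rw [integral_sub, integral_const_mul, integral_exp_mul_exp_neg, if_neg (Ne.symm hn), mul_zero,
    sub_zero]
  · exact hi.ofReal.mul_bdd (c := 1) (continuous_exp_neg_I_mul n).aestronglyMeasurable
      (ae_of_all _ fun θ => (norm_exp_neg_I_mul n θ).le)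
  · refine Integrable.const_mul ?_ _
    refine (integrable_const (1 : ℝ)).mono' (Continuous.aestronglyMeasurable (by fun_prop))
      (ae_of_all _ fun θ => ?_)
    rw [norm_mul, norm_exp_I_mul, norm_exp_neg_I_mul, one_mul]

/-- The Fourier multipliers of `log |x - y|` between the circles of radii `r` and `s`. -/
noncomputable def logKernelMode (n : ℤ) (r s : ℝ) : ℝ :=
  if n = 0 then Real.log (max r s)
  else -((2 * (n.natAbs : ℝ))⁻¹ * (min r s / max r s) ^ n.natAbs)

theorem measurable_logKernelMode (n : ℤ) (r : ℝ) : Measurable (logKernelMode n r) := by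
  unfold logKernelMode
  split_ifs
  · fun_prop
  · fun_prop

theorem abs_logKernelMode_le (n : ℤ) {r s S : ℝ} (hr : 0 < r) (hs : 0 ≤ s) (hsS : s ≤ S) :
    |logKernelMode n r s| ≤ |Real.log r| + |Real.log (max r S)| + 1 := by
  unfold logKernelMode
  have hm : 0 < max r s := lt_max_of_lt_left hr
  split_ifs with h
  · have h1 : Real.log r ≤ Real.log (max r s) := Real.log_le_log hr (le_max_left _ _)
    have h2 : Real.log (max r s) ≤ Real.log (max r S) :=
      Real.log_le_log hm (max_le_max le_rfl hsS)
    rw [abs_le]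
    constructor
    · linarith [neg_abs_le (Real.log r), abs_nonneg (Real.log (max r S))]
    · linarith [le_abs_self (Real.log (max r S)), abs_nonneg (Real.log r)]
  · have h0 : 0 ≤ min r s / max r s := by positivity
    have h1 : (min r s / max r s) ^ n.natAbs ≤ 1 :=
      pow_le_one₀ h0 (div_le_one_of_le₀ min_le_max hm.le)
    have h2 : (1 : ℝ) ≤ n.natAbs := by exact_mod_cast Int.natAbs_pos.2 h
    have h3 : (2 * (n.natAbs : ℝ))⁻¹ ≤ 1 := inv_le_one_of_one_le₀ (by linarith)
    rw [abs_neg, abs_of_nonneg (by positivity)]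
    have : (2 * (n.natAbs : ℝ))⁻¹ * (min r s / max r s) ^ n.natAbs ≤ 1 * 1 :=
      mul_le_mul h3 h1 (pow_nonneg h0 _) zero_le_one
    linarith [abs_nonneg (Real.log r), abs_nonneg (Real.log (max r S))]

/-- Since |log t| = 2 log⁺ t - log t, an upper bound for log⁺ on the circle and Jensen's formula
suffice. The bound is uniform for ‖y‖ ≤ S. -/
theorem integral_abs_log_norm_polarMap_sub_le {r : ℝ} (hr : 0 < r) {y : Plane} {S : ℝ}
    (hy : ‖y‖ ≤ S) :
    ∫ θ, |Real.log ‖polarMap (r, θ) - y‖| ∂angularMeasure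
      ≤ 2 * Real.pi * (2 * Real.posLog (r + S) - Real.log r) := by
  obtain ⟨h1, h2⟩ := integrable_log_norm_polarMap_sub r y
  have h3 : Real.log r ≤ Real.log (max r ‖y‖) := Real.log_le_log hr (le_max_left _ _)
  calc _ ≤ ∫ θ, (2 * Real.posLog (r + S) - Real.log ‖polarMap (r, θ) - y‖) ∂angularMeasure := by
        refine integral_mono h1.abs ((integrable_const _).sub h1) fun θ => ?_
        have h4 : Real.posLog ‖polarMap (r, θ) - y‖ ≤ Real.posLog (r + S) := by
          refine Real.posLog_le_posLog (norm_nonneg _) ((norm_sub_le _ _).trans ?_)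
          rw [norm_polarMap, abs_of_pos hr]; linarith
        change max 0 (Real.log _) ≤ _ at h4
        rw [max_le_iff] at h4
        show |_| ≤ _
        rw [abs_le]
        constructor
        · linarith
        · linarith
    _ = 2 * Real.pi * (2 * Real.posLog (r + S) - Real.log (max r ‖y‖)) := by
        rw [integral_sub (integrable_const _) h1, h2 hr, integral_const, measureReal_angularMeasure,
          smul_eq_mul]
        ring
    _ ≤ _ := by
        refine mul_le_mul_of_nonneg_left ?_ (by positivity)
        linarith

/-- This licenses the exchange of integrations over the circle and the plane, including circles that
meet the support of `f`, where the kernel is singular. -/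
theorem integrable_fundamentalSolution_mul {f : Plane → ℂ} (hf : Integrable f) {S : ℝ}
    (hS : ∀ y, S < ‖y‖ → f y = 0) {r : ℝ} (hr : 0 < r) :
    Integrable (fun q : ℝ × Plane => (fundamentalSolution (polarMap (r, q.1) - q.2) : ℂ) * f q.2)
      (angularMeasure.prod volume) := by
  have hm : AEStronglyMeasurable
      (fun q : ℝ × Plane => (fundamentalSolution (polarMap (r, q.1) - q.2) : ℂ) * f q.2)
      (angularMeasure.prod volume) := by
    refine AEStronglyMeasurable.mul (Measurable.aestronglyMeasurable ?_) hf.1.comp_snd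
    unfold fundamentalSolution
    have : Measurable fun q : ℝ × Plane => polarMap (r, q.1) - q.2 :=
      (measurable_polarMap.comp (measurable_const.prodMk measurable_fst)).sub measurable_snd
    fun_prop
  rw [integrable_prod_iff' hm]
  have hn : ∀ θ y, ‖(fundamentalSolution (polarMap (r, θ) - y) : ℂ) * f y‖
      = |Real.log ‖polarMap (r, θ) - y‖| * (1 / (2 * Real.pi) * ‖f y‖) := by
    intro θ y
    rw [norm_mul, Complex.norm_real, fundamentalSolution, Real.norm_eq_abs, abs_mul,
      abs_of_pos (by positivity : 0 < 1 / (2 * Real.pi))]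
    ring
  refine ⟨ae_of_all _ fun y => ?_, ?_⟩
  · simp only [fundamentalSolution]
    exact (((integrable_log_norm_polarMap_sub r y).1.const_mul _).ofReal).mul_const _
  · refine (hf.norm.const_mul (2 * Real.posLog (r + S) - Real.log r)).mono'
      hm.norm.prod_swap.integral_prod_right' (ae_of_all _ fun y => ?_)
    simp only [hn]
    rw [integral_mul_const, Real.norm_eq_abs, abs_mul, abs_of_nonneg (integral_nonneg fun θ =>
      abs_nonneg _), abs_of_nonneg (by positivity)]
    rcases le_or_gt ‖y‖ S with h | h
    · calc _ ≤ 2 * Real.pi * (2 * Real.posLog (r + S) - Real.log r)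
            * (1 / (2 * Real.pi) * ‖f y‖) := by
            refine mul_le_mul_of_nonneg_right (integral_abs_log_norm_polarMap_sub_le hr h)
              (by positivity)
        _ = _ := by field_simp
    · rw [hS y h]; simp

theorem integrable_newtonianPotential_polarMap {f : Plane → ℂ} (hf : Integrable f) {S : ℝ}
    (hS : ∀ y, S < ‖y‖ → f y = 0) {r : ℝ} (hr : 0 < r) :
    Integrable (fun θ => newtonianPotential f (polarMap (r, θ))) angularMeasure :=
  (integrable_fundamentalSolution_mul hf hS hr).integral_prod_left

theorem integral_fundamentalSolution_mul_exp {r : ℝ} (hr : 0 < r) {y : Plane} (hy : y ≠ 0)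
    (hry : r ≠ ‖y‖) (n : ℤ) :
    ∫ θ : ℝ, (fundamentalSolution (polarMap (r, θ) - y) : ℂ) * Complex.exp (-(Complex.I * n * θ))
      ∂angularMeasure = (logKernelMode n r ‖y‖ : ℂ) * angularMode n y := by
  have e : ∀ θ : ℝ, (fundamentalSolution (polarMap (r, θ) - y) : ℂ)
      * Complex.exp (-(Complex.I * n * θ)) = ((1 / (2 * Real.pi) : ℝ) : ℂ)
        * ((Real.log ‖polarMap (r, θ) - y‖ : ℂ) * Complex.exp (-(Complex.I * n * θ))) := by
    intro θ; rw [fundamentalSolution]; push_cast; ring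
  simp only [e]
  rw [integral_const_mul, logKernelMode]
  have hpi : (Real.pi : ℂ) ≠ 0 := by exact_mod_cast Real.pi_ne_zero
  split_ifs with h
  · subst h
    have : ∀ θ : ℝ, (Real.log ‖polarMap (r, θ) - y‖ : ℂ)
        * Complex.exp (-(Complex.I * (0 : ℤ) * θ))
        = ((Real.log ‖polarMap (r, θ) - y‖ : ℝ) : ℂ) := by
      intro θ; simp
    simp only [this]
    rw [integral_complex_ofReal, (integrable_log_norm_polarMap_sub r y).2 hr, angularMode, zpow_zero]
    push_cast; field_simp
  · rw [integral_log_norm_polarMap_sub_mul_exp hr hy hry h]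
    have : ((n.natAbs : ℕ) : ℂ) ≠ 0 := by exact_mod_cast Int.natAbs_ne_zero.2 h
    push_cast; field_simp

theorem ae_ne_zero_and_norm_ne (r : ℝ) : ∀ᵐ y : Plane, y ≠ 0 ∧ r ≠ ‖y‖ := by
  have h1 : ∀ᵐ y : Plane, y ≠ 0 := by
    simpa using (measure_eq_zero_iff_ae_notMem.1 (measure_singleton (μ := (volume : Measure Plane)) 0))
  have h2 := measure_eq_zero_iff_ae_notMem.1 (Measure.addHaar_sphere (volume : Measure Plane) 0 r)
  filter_upwards [h1, h2] with y h3 h4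
  refine ⟨h3, fun h => h4 ?_⟩
  simp [h]

/-- The Fourier coefficients of a Newtonian potential on a circle. -/
theorem fourierMode_newtonianPotential {f : Plane → ℂ} (hf : Integrable f) {S : ℝ}
    (hS : ∀ y, S < ‖y‖ → f y = 0) {r : ℝ} (hr : 0 < r) (n : ℤ) :
    fourierMode n (newtonianPotential f) r
      = ∫ y, f y * ((logKernelMode n r ‖y‖ : ℂ) * angularMode n y) := by
  have hi := integrable_fundamentalSolution_mul hf hS hr
  have hi' : Integrable (fun q : ℝ × Plane =>
      (fundamentalSolution (polarMap (r, q.1) - q.2) : ℂ) * f q.2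
        * Complex.exp (-(Complex.I * n * (q.1 : ℝ)))) (angularMeasure.prod volume) := by
    refine hi.mul_bdd (c := 1) ?_ (ae_of_all _ fun q => (norm_exp_neg_I_mul n q.1).le)
    exact ((continuous_exp_neg_I_mul n).comp continuous_fst).aestronglyMeasurable
  rw [fourierMode]
  simp only [newtonianPotential]
  calc _ = ∫ θ : ℝ, (∫ y : Plane, (fundamentalSolution (polarMap (r, θ) - y) : ℂ) * f y
        * Complex.exp (-(Complex.I * n * (θ : ℝ)))) ∂angularMeasure := by
        congr 1; ext θ; rw [integral_mul_const]
    _ = ∫ y : Plane, (∫ θ : ℝ, (fundamentalSolution (polarMap (r, θ) - y) : ℂ) * f y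
        * Complex.exp (-(Complex.I * n * (θ : ℝ))) ∂angularMeasure) := integral_integral_swap hi'
    _ = _ := by
        refine integral_congr_ae ?_
        filter_upwards [ae_ne_zero_and_norm_ne r] with y hy
        rw [← integral_fundamentalSolution_mul_exp hr hy.1 hy.2 n, ← integral_const_mul]
        congr 1; ext θ; ring

theorem integrable_mul_logKernelMode {f : Plane → ℂ} (hf : Integrable f) {S : ℝ}
    (hS : ∀ y, S < ‖y‖ → f y = 0) {r : ℝ} (hr : 0 < r) (n : ℤ) :
    Integrable fun y => f y * ((logKernelMode n r ‖y‖ : ℂ) * angularMode n y) := by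
  refine (hf.norm.const_mul (|Real.log r| + |Real.log (max r S)| + 1)).mono' ?_
    (ae_of_all _ fun y => ?_)
  · refine hf.1.mul (Measurable.aestronglyMeasurable (Measurable.mul ?_ (measurable_angularMode n)))
    exact Complex.measurable_ofReal.comp ((measurable_logKernelMode n r).comp measurable_norm)
  · rcases le_or_gt ‖y‖ S with h | h
    · rw [norm_mul, norm_mul, Complex.norm_real, Real.norm_eq_abs, mul_comm ‖f y‖]
      refine mul_le_mul_of_nonneg_right ?_ (norm_nonneg _)
      refine (mul_le_of_le_one_right (abs_nonneg _) (norm_angularMode_le n)).trans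
        (abs_logKernelMode_le n hr (norm_nonneg y) h)
    · rw [hS y h]; simp

theorem fourierMode_newtonianPotential_eq_integral_Ioi {f : Plane → ℂ} (hf : Integrable f) {S : ℝ}
    (hS : ∀ y, S < ‖y‖ → f y = 0) {r : ℝ} (hr : 0 < r) (n : ℤ) :
    fourierMode n (newtonianPotential f) r
      = ∫ s in Set.Ioi (0 : ℝ), fourierMode n f s * ((s * logKernelMode n r s : ℝ) : ℂ) := by
  rw [fourierMode_newtonianPotential hf hS hr,
    integral_mul_angularMode_of_integrable (integrable_mul_logKernelMode hf hS hr n)]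

/-! ### The source and the expansion of its potential -/

/-- A charge density of total charge zero, supported in the annulus `R ≤ |x| ≤ S`, outside the
closed disk of radius `re`. -/
structure IsSource (re R S : ℝ) (f : Plane → ℂ) : Prop where
  re_pos : 0 < re
  re_lt : re < R
  outer_nonneg : 0 ≤ S
  integrable : Integrable f
  zero_inside : ∀ y, ‖y‖ < R → f y = 0
  zero_outside : ∀ y, S < ‖y‖ → f y = 0
  integral_eq_zero : ∫ x, f x = 0

/-- The Fourier coefficients of `f` against `|x|⁻ⁿ`, which are, up to a factor, those of its
Newtonian potential. -/
noncomputable def sourceCoeff (re : ℝ) (f : Plane → ℂ) (n : ℤ) : ℂ :=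
  (2 * (n.natAbs : ℂ))⁻¹ * ∫ x in Set.Ioi re, ((x : ℂ) ^ n.natAbs)⁻¹ * (x * fourierMode n f x)

namespace IsSource

variable {re R S : ℝ} {f : Plane → ℂ}

theorem mode_eq_zero (h : IsSource re R S f) (n : ℤ) {r : ℝ} (hr : 0 < r) (hrR : r < R) :
    (r : ℂ) * fourierMode n f r = 0 := by
  rw [fourierMode]
  have : ∀ θ, f (polarMap (r, θ)) = 0 := fun θ => h.zero_inside _ (by
    rw [norm_polarMap, abs_of_pos hr]; exact hrR)
  simp [this]

theorem mode_eq_zero' (h : IsSource re R S f) (n : ℤ) {r : ℝ} (hr : 0 < r) (hrS : S < r) :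
    (r : ℂ) * fourierMode n f r = 0 := by
  rw [fourierMode]
  have : ∀ θ, f (polarMap (r, θ)) = 0 := fun θ => h.zero_outside _ (by
    rw [norm_polarMap, abs_of_pos hr]; exact hrS)
  simp [this]

theorem integrableOn_mul (h : IsSource re R S f) (n : ℤ) {φ : ℝ → ℂ}
    (hφ : ContinuousOn φ (Set.Ioi 0)) :
    IntegrableOn (fun x : ℝ => φ x * (x * fourierMode n f x)) (Set.Ioi 0) := by
  have hR : 0 < R := h.re_pos.trans h.re_lt
  have hsub : Set.Icc R S ⊆ Set.Ioi 0 := fun x hx => hR.trans_le hx.1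
  have h1 : IntegrableOn (fun x : ℝ => φ x * (x * fourierMode n f x)) (Set.Icc R S) :=
    ((integrableOn_mul_fourierMode h.integrable n).mono_set hsub).continuousOn_mul (hφ.mono hsub)
      isCompact_Icc
  refine h1.of_forall_sdiff_eq_zero measurableSet_Ioi ?_
  rintro x ⟨hx, hx'⟩
  have : (x : ℂ) * fourierMode n f x = 0 := by
    rcases lt_or_ge x R with h2 | h2
    · exact h.mode_eq_zero n hx h2
    · exact h.mode_eq_zero' n hx (not_le.1 fun h3 => hx' ⟨h2, h3⟩)
  simp [this]

theorem mode_potential_eq (h : IsSource re R S f) (n : ℤ) {r : ℝ} (hr : 0 < r) :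
    fourierMode n (newtonianPotential f) r
      = ∫ s in Set.Ioi re, (logKernelMode n r s : ℂ) * (s * fourierMode n f s) := by
  rw [fourierMode_newtonianPotential_eq_integral_Ioi h.integrable h.zero_outside hr]
  have e : ∀ s : ℝ, fourierMode n f s * ((s * logKernelMode n r s : ℝ) : ℂ)
      = (logKernelMode n r s : ℂ) * (s * fourierMode n f s) := by
    intro s; push_cast; ring
  simp only [e]
  refine setIntegral_eq_of_subset_of_forall_sdiff_eq_zero measurableSet_Ioi
    (Set.Ioi_subset_Ioi h.re_pos.le) ?_
  rintro s ⟨hs, hs'⟩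
  rw [h.mode_eq_zero n hs ((not_lt.1 hs').trans_lt h.re_lt), mul_zero]

theorem continuousOn_inv_pow (m : ℕ) :
    ContinuousOn (fun x : ℝ => ((x : ℂ) ^ m)⁻¹) (Set.Ioi 0) := by
  refine ContinuousOn.inv₀ (by fun_prop) fun x hx => ?_
  exact pow_ne_zero _ (by exact_mod_cast (ne_of_gt hx))

theorem continuousOn_log : ContinuousOn (fun x : ℝ => (Real.log x : ℂ)) (Set.Ioi 0) :=
  Complex.continuous_ofReal.comp_continuousOn
    (Real.continuousOn_log.mono fun _ hx => ne_of_gt hx)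

/-- The modes of the potential inside the disk. -/
theorem mode_potential_inside (h : IsSource re R S f) {n : ℤ} (hn : n ≠ 0) {r : ℝ} (hr : 0 < r)
    (hre : r ≤ re) :
    fourierMode n (newtonianPotential f) r = -sourceCoeff re f n * (r : ℂ) ^ n.natAbs := by
  rw [h.mode_potential_eq n hr, sourceCoeff, neg_mul, mul_right_comm, ← neg_mul,
    ← integral_const_mul]
  refine setIntegral_congr_fun measurableSet_Ioi fun s hs => ?_
  have hrs : r ≤ s := hre.trans (le_of_lt hs)
  have hs0 : (s : ℂ) ≠ 0 := by exact_mod_cast (hr.trans_le hrs).ne'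
  have hm : ((n.natAbs : ℕ) : ℂ) ≠ 0 := by exact_mod_cast Int.natAbs_ne_zero.2 hn
  simp only [logKernelMode, if_neg hn, min_eq_left hrs, max_eq_right hrs]
  push_cast
  rw [div_pow]
  field_simp

theorem split_integral (h : IsSource re R S f) {r : ℝ} (hr : re < r) {ψ φ₁ φ₂ : ℝ → ℂ} (n : ℤ)
    (h1 : ContinuousOn φ₁ (Set.Ioi 0)) (h2 : ContinuousOn φ₂ (Set.Ioi 0))
    (e1 : ∀ s, re < s → s ≤ r → ψ s = φ₁ s) (e2 : ∀ s, r < s → ψ s = φ₂ s) :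
    ∫ s in Set.Ioi re, ψ s * (s * fourierMode n f s)
      = (∫ s in re..r, φ₁ s * (s * fourierMode n f s))
        + ∫ s in Set.Ioi r, φ₂ s * (s * fourierMode n f s) := by
  have hre := h.re_pos
  have i1 : IntegrableOn (fun s : ℝ => ψ s * (s * fourierMode n f s)) (Set.Ioc re r) :=
    ((h.integrableOn_mul n h1).mono_set fun x hx => hre.trans hx.1).congr_fun
      (fun s hs => by simp only [e1 s hs.1 hs.2]) measurableSet_Ioc
  have i2 : IntegrableOn (fun s : ℝ => ψ s * (s * fourierMode n f s)) (Set.Ioi r) :=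
    ((h.integrableOn_mul n h2).mono_set fun x hx => (hre.trans hr).trans hx).congr_fun
      (fun s hs => by simp only [e2 s hs]) measurableSet_Ioi
  rw [← Set.Ioc_union_Ioi_eq_Ioi hr.le, setIntegral_union (Set.Ioc_disjoint_Ioi le_rfl)
    measurableSet_Ioi i1 i2, intervalIntegral.integral_of_le hr.le]
  congr 1
  · exact setIntegral_congr_fun measurableSet_Ioc fun s hs => by simp only [e1 s hs.1 hs.2]
  · exact setIntegral_congr_fun measurableSet_Ioi fun s hs => by simp only [e2 s hs]

/-- The modes of the potential outside the disk. -/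
theorem mode_potential_outside (h : IsSource re R S f) {n : ℤ} (hn : n ≠ 0) {r : ℝ}
    (hr : re < r) :
    fourierMode n (newtonianPotential f) r = -((2 * (n.natAbs : ℂ))⁻¹ *
      ((r : ℂ) ^ n.natAbs * (∫ x in Set.Ioi r, ((x : ℂ) ^ n.natAbs)⁻¹ * (x * fourierMode n f x))
        + ((r : ℂ) ^ n.natAbs)⁻¹ * ∫ x in re..r, (x : ℂ) ^ n.natAbs * (x * fourierMode n f x))) := by
  have hr0 : 0 < r := h.re_pos.trans hr
  have hrC : (r : ℂ) ≠ 0 := by exact_mod_cast hr0.ne'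
  have hm : ((n.natAbs : ℕ) : ℂ) ≠ 0 := by exact_mod_cast Int.natAbs_ne_zero.2 hn
  rw [h.mode_potential_eq n hr0, h.split_integral hr (ψ := fun s => (logKernelMode n r s : ℂ))
    (φ₁ := fun s => -((2 * (n.natAbs : ℂ))⁻¹ * ((r : ℂ) ^ n.natAbs)⁻¹) * (s : ℂ) ^ n.natAbs)
    (φ₂ := fun s => -((2 * (n.natAbs : ℂ))⁻¹ * (r : ℂ) ^ n.natAbs) * ((s : ℂ) ^ n.natAbs)⁻¹) n
    (by fun_prop) (continuousOn_const.mul (continuousOn_inv_pow _))]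
  · simp only [mul_assoc, neg_mul]
    rw [intervalIntegral.integral_neg, integral_neg]
    simp only [intervalIntegral.integral_const_mul, integral_const_mul]
    ring
  · intro s hs hsr
    simp only [logKernelMode, if_neg hn, min_eq_right hsr, max_eq_left hsr]
    push_cast
    rw [div_pow]
    field_simp
  · intro s hs
    have hs0 : (s : ℂ) ≠ 0 := by exact_mod_cast (hr0.trans hs).ne'
    simp only [logKernelMode, if_neg hn, min_eq_left hs.le, max_eq_right hs.le]
    push_cast
    rw [div_pow]
    field_simp

/-- The right-hand side is the expression found for the zeroth exterior mode of a solution, so the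
two modes agree there. -/
theorem mode_zero_potential_outside (h : IsSource re R S f) {r : ℝ} (hr : re < r) :
    fourierMode 0 (newtonianPotential f) r
      = (∫ x in Set.Ioi r, (Real.log x : ℂ) * (x * fourierMode 0 f x))
        + Real.log r * ∫ x in re..r, (x : ℂ) * fourierMode 0 f x := by
  have hr0 : 0 < r := h.re_pos.trans hr
  rw [h.mode_potential_eq 0 hr0, h.split_integral hr (ψ := fun s => (logKernelMode 0 r s : ℂ))
    (φ₁ := fun s => (Real.log r : ℂ)) (φ₂ := fun s => (Real.log s : ℂ)) 0 continuousOn_const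
    continuousOn_log, intervalIntegral.integral_const_mul, add_comm]
  · intro s hs hsr
    simp only [logKernelMode, if_pos, max_eq_left hsr]
  · intro s hs
    simp only [logKernelMode, if_pos, max_eq_right hs.le]

theorem integral_mode_zero (h : IsSource re R S f) :
    ∫ x in Set.Ioi (0 : ℝ), (x : ℂ) * fourierMode 0 f x = 0 := by
  have h1 := integral_mul_angularMode_of_integrable (h := f) (α := fun _ => 1) (n := 0)
    (by simpa [angularMode] using h.integrable)
  simp only [angularMode, zpow_zero, Complex.ofReal_one, mul_one, h.integral_eq_zero] at h1
  rw [h1]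
  congr 1; ext x; ring

/-- `harmonicCoeff` carries the factor 1/(2π) of a Fourier coefficient and integrates over (0, 2π);
`fourierMode` has no such factor and integrates over (-π, π). Periodicity reconciles the intervals.
-/
theorem harmonicCoeff_eq (h : IsSource re R S f) {n : ℤ} (hn : n ≠ 0) :
    harmonicCoeff re (newtonianPotential f) n = (2 * Real.pi : ℂ)⁻¹ * sourceCoeff re f n := by
  have h1 := h.mode_potential_inside hn h.re_pos le_rfl
  rw [fourierMode, integral_angularMeasure_eq_of_periodic] at h1
  · have : ∀ θ, polarMap (re, θ) = !₂[re * Real.cos θ, re * Real.sin θ] := fun θ => rfl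
    simp only [this] at h1
    rw [harmonicCoeff, h1]
    have : (re : ℂ) ≠ 0 := by exact_mod_cast h.re_pos.ne'
    push_cast
    field_simp
  · intro θ
    have e1 : polarMap (re, θ + 2 * Real.pi) = polarMap (re, θ) := by
      simp [polarMap]
    have e2 : Complex.exp (-(Complex.I * n * ((θ + 2 * Real.pi : ℝ) : ℂ)))
        = Complex.exp (-(Complex.I * n * θ)) := by
      rw [Complex.exp_eq_exp_iff_exists_int]
      exact ⟨-n, by push_cast; ring⟩
    simp only [e1, e2]

/-- On the support of `f` the kernel between the circles of radii `re` and ‖y‖ is at most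
(re/R)^|n|. The gap between `re` and `R` is what later makes the sums over all modes converge
geometrically. -/
theorem norm_sourceCoeff_le (h : IsSource re R S f) {n : ℤ} (hn : n ≠ 0) :
    ‖sourceCoeff re f n‖ * R ^ n.natAbs ≤ ∫ y, ‖f y‖ := by
  have hre := h.re_pos
  have hR : 0 < R := hre.trans h.re_lt
  have h1 := h.mode_potential_inside hn h.re_pos le_rfl
  rw [fourierMode_newtonianPotential h.integrable h.zero_outside hre] at h1
  have h2 := congrArg norm h1
  rw [norm_mul, norm_neg, norm_pow, Complex.norm_real, Real.norm_eq_abs, abs_of_pos hre] at h2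
  have h3 : ‖sourceCoeff re f n‖ * re ^ n.natAbs ≤ ∫ y, (re / R) ^ n.natAbs * ‖f y‖ := by
    rw [← h2]
    refine norm_integral_le_of_norm_le (h.integrable.norm.const_mul _) (ae_of_all _ fun y => ?_)
    rcases lt_or_ge ‖y‖ R with hy | hy
    · rw [h.zero_inside y hy]; simp
    · have hrey : re ≤ ‖y‖ := (h.re_lt.trans_le hy).le
      have h4 : (1 : ℝ) ≤ n.natAbs := by exact_mod_cast Int.natAbs_pos.2 hn
      rw [norm_mul, norm_mul, Complex.norm_real, Real.norm_eq_abs, logKernelMode, if_neg hn,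
        abs_neg, abs_of_nonneg (by positivity), min_eq_left hrey, max_eq_right hrey, mul_comm]
      refine mul_le_mul_of_nonneg_right ?_ (norm_nonneg _)
      refine (mul_le_of_le_one_right (by positivity) (norm_angularMode_le n)).trans ?_
      refine (mul_le_of_le_one_left (by positivity)
        (inv_le_one_of_one_le₀ (by linarith))).trans ?_
      gcongr
  rw [integral_const_mul, div_pow, div_mul_eq_mul_div, le_div_iff₀ (by positivity)] at h3
  have : 0 < re ^ n.natAbs := by positivity
  nlinarith
end IsSource

namespace IsSource

variable {re R S : ℝ} {f : Plane → ℂ}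

/-- With w the complex coordinate of y, |w|² = w · conj w turns |y|^{-k} e^{-ikθ} into w^{-k}, and
its conjugate into (conj w)^{-k}. The coefficients thereby become holomorphic and antiholomorphic
moments of the charge. -/
theorem logKernelMode_mul_angularMode {r : ℝ} (hr : 0 < r) {y : Plane} (hy : r < ‖y‖) {k : ℕ}
    (hk : k ≠ 0) :
    (logKernelMode k r ‖y‖ : ℂ) * angularMode k y
        = -((2 * (k : ℂ))⁻¹ * (r : ℂ) ^ k * (toComplex y)⁻¹ ^ k) ∧
      (logKernelMode (-k) r ‖y‖ : ℂ) * angularMode (-k) y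
        = -((2 * (k : ℂ))⁻¹ * (r : ℂ) ^ k * ((starRingEnd ℂ) (toComplex y))⁻¹ ^ k) := by
  have hs : (‖y‖ : ℂ) ≠ 0 := by exact_mod_cast (hr.trans hy).ne'
  have hw : toComplex y ≠ 0 := by
    rw [← norm_pos_iff, norm_toComplex]; exact hr.trans hy
  have hw' : (starRingEnd ℂ) (toComplex y) ≠ 0 := by rwa [Ne, map_eq_zero]
  have hsq : toComplex y * (starRingEnd ℂ) (toComplex y) = (‖y‖ : ℂ) ^ 2 := by
    rw [Complex.mul_conj, Complex.normSq_eq_norm_sq, norm_toComplex]; push_cast; rfl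
  have hkC : (k : ℂ) ≠ 0 := by exact_mod_cast hk
  have e1 : (k : ℤ) ≠ 0 := by exact_mod_cast hk
  have e2 : -(k : ℤ) ≠ 0 := by omega
  simp only [logKernelMode, if_neg e1, if_neg e2, Int.natAbs_neg, Int.natAbs_natCast, angularMode,
    min_eq_left hy.le, max_eq_right hy.le, zpow_neg, zpow_natCast]
  push_cast
  constructor
  · rw [neg_mul, mul_assoc, ← mul_pow, mul_assoc, ← mul_pow]
    congr 3
    field_simp
    linear_combination (r : ℂ) * hsq
  · rw [neg_mul, mul_assoc, ← inv_pow, ← mul_pow, mul_assoc, ← mul_pow]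
    congr 3
    field_simp

/-- For k ≠ 0 two evaluations of the mode on the circle of radius `re` are compared. For k = 0 both
sides are zero, since the inverse of 0 is 0, so the series below may start at 0. -/
theorem sourceCoeff_eq (h : IsSource re R S f) (k : ℕ) :
    sourceCoeff re f k = (2 * (k : ℂ))⁻¹ * ∫ y, f y * (toComplex y)⁻¹ ^ k ∧
      sourceCoeff re f (-k)
        = (2 * (k : ℂ))⁻¹ * ∫ y, f y * ((starRingEnd ℂ) (toComplex y))⁻¹ ^ k := by
  rcases eq_or_ne k 0 with rfl | hk
  · simp [sourceCoeff]
  have e1 : (k : ℤ) ≠ 0 := by exact_mod_cast hk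
  have e2 : -(k : ℤ) ≠ 0 := by omega
  have hre : (re : ℂ) ^ k ≠ 0 := pow_ne_zero _ (by exact_mod_cast h.re_pos.ne')
  have h1 := h.mode_potential_inside e1 h.re_pos le_rfl
  have h2 := h.mode_potential_inside e2 h.re_pos le_rfl
  rw [fourierMode_newtonianPotential h.integrable h.zero_outside h.re_pos] at h1 h2
  have h3 : ∀ y, f y ≠ 0 → re < ‖y‖ := fun y hy =>
    h.re_lt.trans_le (not_lt.1 fun h4 => hy (h.zero_inside y h4))
  have e3 : ∀ y, f y * ((logKernelMode k re ‖y‖ : ℂ) * angularMode k y)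
      = -((2 * (k : ℂ))⁻¹ * (re : ℂ) ^ k) * (f y * (toComplex y)⁻¹ ^ k) := by
    intro y
    by_cases hy : f y = 0
    · simp [hy]
    · rw [(logKernelMode_mul_angularMode h.re_pos (h3 y hy) hk).1]; ring
  have e4 : ∀ y, f y * ((logKernelMode (-k) re ‖y‖ : ℂ) * angularMode (-k) y)
      = -((2 * (k : ℂ))⁻¹ * (re : ℂ) ^ k) * (f y * ((starRingEnd ℂ) (toComplex y))⁻¹ ^ k) := by
    intro y
    by_cases hy : f y = 0
    · simp [hy]
    · rw [(logKernelMode_mul_angularMode h.re_pos (h3 y hy) hk).2]; ring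
  simp only [e3] at h1
  simp only [e4] at h2
  rw [integral_const_mul, Int.natAbs_natCast] at h1
  rw [integral_const_mul, Int.natAbs_neg, Int.natAbs_natCast] at h2
  exact ⟨mul_right_cancel₀ hre (by linear_combination h1),
    mul_right_cancel₀ hre (by linear_combination h2)⟩

theorem integrable_fundamentalSolution_mul_inside (h : IsSource re R S f) {x : Plane}
    (hx : ‖x‖ < R) : Integrable fun y => (fundamentalSolution (x - y) : ℂ) * f y := by
  have hm : Measurable fun y : Plane => (fundamentalSolution (x - y) : ℂ) := by
    unfold fundamentalSolution
    have : Measurable fun y : Plane => x - y := measurable_const.sub measurable_id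
    fun_prop
  refine (h.integrable.norm.const_mul (1 / (2 * Real.pi)
    * (|Real.log (R - ‖x‖)| + |Real.log (‖x‖ + S)|))).mono' (hm.aestronglyMeasurable.mul
      h.integrable.1) (ae_of_all _ fun y => ?_)
  by_cases hy : f y = 0
  · simp [hy]
  have h1 : R ≤ ‖y‖ := not_lt.1 fun h4 => hy (h.zero_inside y h4)
  have h2 : ‖y‖ ≤ S := not_lt.1 fun h4 => hy (h.zero_outside y h4)
  rw [norm_mul, Complex.norm_real, fundamentalSolution, Real.norm_eq_abs, abs_mul,
    abs_of_pos (by positivity : 0 < 1 / (2 * Real.pi))]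
  have h3 : R - ‖x‖ ≤ ‖x - y‖ := by
    have := norm_sub_norm_le y x
    rw [norm_sub_rev] at this; linarith
  have h4 : ‖x - y‖ ≤ ‖x‖ + S := (norm_sub_le _ _).trans (by linarith)
  have h5 := Real.log_le_log (by linarith) h3
  have h6 := Real.log_le_log (by linarith) h4
  gcongr
  rw [abs_le]
  constructor
  · linarith [neg_abs_le (Real.log (R - ‖x‖)), abs_nonneg (Real.log (‖x‖ + S))]
  · linarith [le_abs_self (Real.log (‖x‖ + S)), abs_nonneg (Real.log (R - ‖x‖))]

/-- With z, w the complex coordinates of x, y, the value is -Re log(1 - z/w). The Taylor series is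
averaged with its conjugate. -/
theorem log_norm_sub_hasSum {x y : Plane} (hxy : ‖x‖ < ‖y‖) :
    HasSum (fun k : ℕ => (2 * (k : ℂ))⁻¹ * ((toComplex x) ^ k * (toComplex y)⁻¹ ^ k
        + (starRingEnd ℂ) (toComplex x) ^ k * ((starRingEnd ℂ) (toComplex y))⁻¹ ^ k))
      ((Real.log ‖y‖ - Real.log ‖x - y‖ : ℝ) : ℂ) := by
  set z := toComplex x with hz
  set w := toComplex y with hw
  have hy0 : 0 < ‖w‖ := by rw [hw, norm_toComplex]; exact (norm_nonneg x).trans_lt hxy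
  have hw0 : w ≠ 0 := norm_pos_iff.1 hy0
  have h1 : ‖z * w⁻¹‖ < 1 := by
    rw [norm_mul, norm_inv, ← div_eq_mul_inv, div_lt_one hy0, hz, hw, norm_toComplex,
      norm_toComplex]
    exact hxy
  have h2 := Complex.hasSum_taylorSeries_neg_log h1
  have h3 := h2.add (Complex.hasSum_conj'.2 h2)
  rw [Complex.add_conj, Complex.neg_re, Complex.log_re] at h3
  have h4 := h3.mul_left (2⁻¹ : ℂ)
  have e : Real.log ‖x - y‖ = Real.log ‖y‖ + Real.log ‖1 - z * w⁻¹‖ := by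
    have e1 : ‖x - y‖ = ‖y‖ * ‖1 - z * w⁻¹‖ := by
      rw [← norm_toComplex y, ← hw, ← norm_mul, mul_sub, mul_one, mul_left_comm,
        mul_inv_cancel₀ hw0, mul_one, ← norm_toComplex, norm_sub_rev]
      congr 1
      rw [hz, hw]
      simp only [toComplex, map_sub]
    rw [e1, Real.log_mul (by rw [← norm_toComplex]; exact hy0.ne')]
    rw [norm_ne_zero_iff, sub_ne_zero]
    intro h5
    rw [← h5, norm_one] at h1
    exact h1.false
  convert! h4 using 1
  · funext k
    simp only [map_div₀, map_pow, map_mul, map_inv₀, Complex.conj_natCast]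
    rw [mul_pow, mul_pow, mul_inv]
    ring
  · rw [e]; push_cast; ring

theorem norm_logExpansion_term_le {x y : Plane} (hR : 0 < R) (hy : R ≤ ‖y‖) (k : ℕ) :
    ‖(2 * (k : ℂ))⁻¹ * ((toComplex x) ^ k * (toComplex y)⁻¹ ^ k
        + (starRingEnd ℂ) (toComplex x) ^ k * ((starRingEnd ℂ) (toComplex y))⁻¹ ^ k)‖
      ≤ (‖x‖ / R) ^ k := by
  have h1 : ‖(toComplex x) ^ k * (toComplex y)⁻¹ ^ k
        + (starRingEnd ℂ) (toComplex x) ^ k * ((starRingEnd ℂ) (toComplex y))⁻¹ ^ k‖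
      ≤ 2 * (‖x‖ / R) ^ k := by
    refine (norm_add_le _ _).trans ?_
    simp only [norm_mul, norm_pow, norm_inv, RCLike.norm_conj, norm_toComplex]
    rw [← mul_pow, ← div_eq_mul_inv, two_mul]
    gcongr
  rcases eq_or_ne k 0 with rfl | hk
  · simp
  rw [norm_mul, norm_inv, norm_mul, Complex.norm_natCast, Complex.norm_ofNat]
  have h2 : (1 : ℝ) ≤ k := by exact_mod_cast Nat.one_le_iff_ne_zero.2 hk
  calc _ ≤ (2 * (k : ℝ))⁻¹ * (2 * (‖x‖ / R) ^ k) := by gcongr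
    _ = (k : ℝ)⁻¹ * (‖x‖ / R) ^ k := by field_simp
    _ ≤ 1 * (‖x‖ / R) ^ k := by gcongr; exact inv_le_one_of_one_le₀ h2
    _ = _ := one_mul _

/-- The power series expansion of the potential near the origin. -/
theorem hasSum_potential (h : IsSource re R S f) {x : Plane} (hx : ‖x‖ < R) :
    HasSum (fun k : ℕ => -((2 * Real.pi : ℂ)⁻¹ * (sourceCoeff re f k * toComplex x ^ k
        + sourceCoeff re f (-k) * (starRingEnd ℂ) (toComplex x) ^ k)))
      (newtonianPotential f x - newtonianPotential f 0) := by
  have hR : 0 < R := h.re_pos.trans h.re_lt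
  have hw : Measurable fun y : Plane => (toComplex y)⁻¹ := measurable_toComplex.inv
  have hw' : Measurable fun y : Plane => ((starRingEnd ℂ) (toComplex y))⁻¹ :=
    (Complex.continuous_conj.measurable.comp measurable_toComplex).inv
  have hsupp : ∀ y, f y ≠ 0 → R ≤ ‖y‖ := fun y hy => not_lt.1 fun h4 => hy (h.zero_inside y h4)
  have hint : ∀ (q : Plane → ℂ), Measurable q → (∀ y, ‖q y‖ ≤ ‖y‖⁻¹) → ∀ k : ℕ,
      Integrable fun y => f y * q y ^ k := by
    intro q hq hq1 k
    refine (h.integrable.norm.const_mul (R⁻¹ ^ k)).mono'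
      (h.integrable.1.mul (hq.pow_const k).aestronglyMeasurable) (ae_of_all _ fun y => ?_)
    by_cases hy : f y = 0
    · simp [hy]
    · rw [norm_mul, norm_pow, mul_comm]
      have := hsupp y hy
      gcongr
      exact (hq1 y).trans (inv_anti₀ hR this)
  have i1 := hint _ hw (fun y => by rw [norm_inv, norm_toComplex])
  have i2 := hint _ hw' (fun y => by rw [norm_inv, RCLike.norm_conj, norm_toComplex])
  set F : ℕ → Plane → ℂ := fun k y => (2 * (k : ℂ))⁻¹ * ((toComplex x) ^ k * (toComplex y)⁻¹ ^ k
        + (starRingEnd ℂ) (toComplex x) ^ k * ((starRingEnd ℂ) (toComplex y))⁻¹ ^ k) * f y with hF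
  have eF : ∀ k, F k = fun y => (2 * (k : ℂ))⁻¹ * ((toComplex x) ^ k * (f y * (toComplex y)⁻¹ ^ k)
        + (starRingEnd ℂ) (toComplex x) ^ k * (f y * ((starRingEnd ℂ) (toComplex y))⁻¹ ^ k)) := by
    intro k; funext y; simp only [hF]; ring
  have iF : ∀ k, Integrable (F k) := by
    intro k
    rw [eF]
    exact (((i1 k).const_mul _).add ((i2 k).const_mul _)).const_mul _
  have bF : ∀ k y, ‖F k y‖ ≤ (‖x‖ / R) ^ k * ‖f y‖ := by
    intro k y
    by_cases hy : f y = 0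
    · simp [hF, hy]
    · rw [hF, norm_mul]
      exact mul_le_mul_of_nonneg_right (norm_logExpansion_term_le hR (hsupp y hy) k) (norm_nonneg _)
  -- The support lies at distance at least `R` from the origin, so the geometric series in ‖x‖/R
  -- permits termwise integration.
  have sF : Summable fun k => ∫ y, ‖F k y‖ := by
    refine Summable.of_nonneg_of_le (fun k => integral_nonneg fun y => norm_nonneg _)
      (fun k => integral_mono (iF k).norm (h.integrable.norm.const_mul _) (bF k)) ?_
    simp only [integral_const_mul]
    exact (summable_geometric_of_lt_one (by positivity) ((div_lt_one hR).2 hx)).mul_right _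
  have h1 := hasSum_integral_of_summable_integral_norm iF sF
  have h2 : ∀ y, ∑' k, F k y = ((Real.log ‖y‖ - Real.log ‖x - y‖ : ℝ) : ℂ) * f y := by
    intro y
    by_cases hy : f y = 0
    · simp [hF, hy]
    · exact ((log_norm_sub_hasSum (hx.trans_le (hsupp y hy))).mul_right (f y)).tsum_eq
  simp only [h2] at h1
  have h3 := h1.mul_left (-((2 * Real.pi : ℂ)⁻¹))
  convert! h3 using 1
  · funext k
    rw [eF, integral_const_mul, integral_add ((i1 k).const_mul _) ((i2 k).const_mul _),
      integral_const_mul, integral_const_mul, (h.sourceCoeff_eq k).1, (h.sourceCoeff_eq k).2]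
    ring
  -- The potential at the origin supplies the term log ‖y‖ of the expanded difference.
  · rw [newtonianPotential, newtonianPotential, ← integral_const_mul,
      ← integral_sub (h.integrable_fundamentalSolution_mul_inside hx)
        (h.integrable_fundamentalSolution_mul_inside (by simpa using hR))]
    congr 1; ext y
    simp only [fundamentalSolution, zero_sub, norm_neg]
    push_cast; ring

end IsSource

/-! ### The modes of a weak solution form a radial solution -/

theorem locallyIntegrable_coord_div_norm_mul {g : Plane → ℂ} (hg : LocallyIntegrable g)
    (j : Fin 2) : LocallyIntegrable fun x => ((x j / ‖x‖ : ℝ) : ℂ) * g x := by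
  rw [locallyIntegrable_iff]
  intro K hK
  refine Integrable.bdd_mul (c := 1) (hg.integrableOn_isCompact hK) ?_ ?_
  · have h1 : Measurable fun x : Plane => x j := Complex.continuous_re.measurable.comp (continuous_coord j).measurable
    exact (Complex.measurable_ofReal.comp (h1.div measurable_norm)).aestronglyMeasurable
  · refine ae_of_all _ fun x => ?_
    rw [Complex.norm_real, norm_div, norm_norm]
    exact div_le_one_of_le₀ (PiLp.norm_apply_le x j) (norm_nonneg _)

theorem locallyIntegrable_radialPart_div_norm {DV : Fin 2 → Plane → ℂ}
    (h : ∀ j, LocallyIntegrable (DV j)) :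
    LocallyIntegrable fun x => (‖x‖ : ℂ)⁻¹ * radialPart DV x := by
  have := (locallyIntegrable_coord_div_norm_mul (h 0) 0).add
    (locallyIntegrable_coord_div_norm_mul (h 1) 1)
  refine this.congr (ae_of_all _ fun x => ?_)
  simp only [Pi.add_apply, radialPart]
  push_cast
  ring

/-- The modes of ∂_r V are integrable against r dr, so those of r∂_r V are integrable against dr all
the way to 0. This is the regularity that rules out r^{-m} in the core. -/
theorem integrableOn_fourierMode_radialPart {DV : Fin 2 → Plane → ℂ}
    (h : ∀ j, LocallyIntegrable (DV j)) (n : ℤ) (R : ℝ) :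
    IntegrableOn (fourierMode n (radialPart DV)) (Set.Ioo 0 R) := by
  have h1 := integrableOn_Ioo_mul_fourierMode (locallyIntegrable_radialPart_div_norm h) n R
  refine h1.congr_fun (fun r hr => ?_) measurableSet_Ioo
  have hr0 : (r : ℂ) ≠ 0 := by exact_mod_cast (ne_of_gt hr.1)
  simp only [fourierMode]
  rw [← integral_const_mul]
  congr 1; ext θ
  rw [norm_polarMap, abs_of_pos hr.1]
  field_simp

theorem norm_fourierMode_le {u : Plane → ℂ} {r M : ℝ} (n : ℤ)
    (h : ∀ᵐ θ ∂angularMeasure, ‖u (polarMap (r, θ))‖ ≤ M) :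
    ‖fourierMode n u r‖ ≤ 2 * Real.pi * M := by
  have h1 := norm_integral_le_of_norm_le_const (μ := angularMeasure)
    (f := fun θ : ℝ => u (polarMap (r, θ)) * Complex.exp (-(Complex.I * n * θ))) (C := M) (by
      filter_upwards [h] with θ hθ
      rwa [norm_mul, norm_exp_neg_I_mul, mul_one])
  rw [measureReal_angularMeasure] at h1
  rw [fourierMode]
  linarith

theorem exists_norm_fourierMode_le {u : Plane → ℂ}
    (hu : Tendsto u (cocompact Plane ⊓ ae volume) (𝓝 0)) (n : ℤ) {η : ℝ} (hη : 0 < η) :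
    ∃ T : ℝ, ∀ᵐ r : ℝ, T < r → ‖fourierMode n u r‖ ≤ η := by
  have h1 : ∀ᶠ x in cocompact Plane ⊓ ae volume, ‖u x‖ ≤ η / (2 * Real.pi) := by
    have := hu.norm
    rw [norm_zero] at this
    exact this.eventually (Iic_mem_nhds (by positivity))
  obtain ⟨s, hs, t, ht, hst⟩ := Filter.eventually_inf.1 h1
  rw [mem_cocompact] at hs
  obtain ⟨K, hK, hKs⟩ := hs
  obtain ⟨T, hT⟩ := hK.isBounded.subset_closedBall (0 : Plane)
  have h2 : ∀ᵐ x : Plane, T < ‖x‖ → ‖u x‖ ≤ η / (2 * Real.pi) := by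
    filter_upwards [ht] with x hx hTx
    refine hst x ⟨hKs fun hxK => ?_, hx⟩
    have := hT hxK
    rw [mem_closedBall_zero_iff] at this
    exact absurd this (not_le.2 hTx)
  refine ⟨max T 0, ?_⟩
  have h3 := ae_ae_polarMap h2
  filter_upwards [h3] with r hr hTr
  have hr0 : 0 < r := (le_max_right T 0).trans_lt hTr
  refine (norm_fourierMode_le n (M := η / (2 * Real.pi)) ?_).trans (by
    rw [mul_div_cancel₀]; positivity)
  filter_upwards [hr hr0] with θ hθ
  refine hθ ?_
  rw [norm_polarMap, abs_of_pos hr0]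
  exact (le_max_left T 0).trans_lt hTr

theorem IsDielectricSolution.isRadialSolution {ri re R S δ : ℝ} {f V : Plane → ℂ}
    {DV : Fin 2 → Plane → ℂ} (H : IsDielectricSolution ri re δ f V DV) (hf : IsSource re R S f)
    (hri : 0 < ri) (hre : ri < re) (n : ℤ) :
    IsRadialSolution n.natAbs ri re R S (-1 + Complex.I * δ) (radialPermittivity ri re δ)
      (fourierMode n V) (fourierMode n (radialPart DV)) fun r => r * fourierMode n f r := by
  have hDV : ∀ j, LocallyIntegrable (DV j) := fun j => (H.1.2 j).1
  have loc : ∀ {u : Plane → ℂ}, LocallyIntegrable u →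
      LocallyIntegrableOn (fun r => radialPermittivity ri re δ r * fourierMode n u r)
        (Set.Ioi 0) := by
    intro u hu
    have := locallyIntegrableOn_fourierMode (locallyIntegrable_permittivity_mul ri re δ hu) n
    rw [locallyIntegrableOn_iff isOpen_Ioi.isLocallyClosed] at this ⊢
    intro K hK hKc
    refine (this K hK hKc).congr_fun (fun r hr => ?_) hKc.measurableSet
    exact fourierMode_permittivity_mul ri re δ n u (hK hr)
  refine ⟨hri, hre, hf.re_lt, ?_, ?_, ?_, loc (locallyIntegrable_radialPart hDV), loc H.1.1,
    locallyIntegrableOn_fourierMode H.1.1 n,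
    locallyIntegrableOn_fourierMode (locallyIntegrable_radialPart hDV) n,
    integrableOn_fourierMode_radialPart hDV n ri, integrableOn_mul_fourierMode hf.integrable n,
    fun r h1 h2 => hf.mode_eq_zero n h1 h2, ?_, H.1.hasWeakDerivOn_fourierMode n, ?_,
    fun η hη => exists_norm_fourierMode_le H.2.2 n hη⟩
  · intro r h1 h2
    rw [radialPermittivity, if_neg (fun h => absurd h.1 (not_lt.2 h2.le))]
  · intro r h1 h2
    rw [radialPermittivity, if_pos ⟨h1, h2⟩]
  · intro r h1
    rw [radialPermittivity, if_neg (fun h => absurd h.2 (not_lt.2 h1.le))]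
  · intro r h1
    exact hf.mode_eq_zero' n (hf.outer_nonneg.trans_lt h1) h1
  · have := H.hasWeakDerivOn_flux hf.integrable.locallyIntegrable n
    have e : ((n.natAbs : ℕ) : ℂ) ^ 2 = (n : ℂ) ^ 2 := by
      have : ((n.natAbs : ℕ) : ℤ) ^ 2 = n ^ 2 := Int.natAbs_sq n
      have h2 := congrArg (fun k : ℤ => (k : ℂ)) this
      push_cast at h2
      simpa using h2
    rw [e]
    exact this

/-! ### Recovering a function on the circle from its Fourier coefficients -/

theorem integrable_angularMeasure_iff {u : ℝ → ℂ} :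
    Integrable u angularMeasure ↔ IntegrableOn u (Set.Ioo (-Real.pi) Real.pi) := Iff.rfl

/-- Pairing with `u` is a continuous functional on the continuous functions of the circle. It
vanishes on the exponentials, whose span is dense. -/
theorem integral_continuousMap_mul_eq_zero {u : ℝ → ℂ} (hu : Integrable u angularMeasure)
    (h0 : ∀ n : ℤ, ∫ θ, u θ * Complex.exp (-(Complex.I * n * θ)) ∂angularMeasure = 0)
    (G : C(AddCircle (2 * Real.pi), ℂ)) : ∫ θ : ℝ, G θ * u θ ∂angularMeasure = 0 := by
  have : Fact (0 < 2 * Real.pi) := ⟨by positivity⟩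
  have hint : ∀ G : C(AddCircle (2 * Real.pi), ℂ),
      Integrable (fun θ : ℝ => G θ * u θ) angularMeasure := by
    intro G
    refine Integrable.bdd_mul (c := ‖G‖) hu ?_ (ae_of_all _ fun θ => G.norm_coe_le_norm θ)
    exact (G.continuous.comp (AddCircle.continuous_mk' _)).aestronglyMeasurable
  let L : C(AddCircle (2 * Real.pi), ℂ) →ₗ[ℂ] ℂ :=
    { toFun := fun G => ∫ θ : ℝ, G θ * u θ ∂angularMeasure
      map_add' := fun G H => by
        rw [← integral_add (hint G) (hint H)]
        congr 1; ext θ; simp [add_mul]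
      map_smul' := fun c G => by
        simp only [ContinuousMap.coe_smul, Pi.smul_apply, smul_eq_mul, RingHom.id_apply]
        rw [← integral_const_mul]
        congr 1; ext θ; ring }
  let L' : C(AddCircle (2 * Real.pi), ℂ) →L[ℂ] ℂ :=
    L.mkContinuous (∫ θ, ‖u θ‖ ∂angularMeasure) fun G => by
      refine (norm_integral_le_of_norm_le (hu.norm.mul_const ‖G‖) (ae_of_all _ fun θ => ?_)).trans
        (integral_mul_const _ _).le
      rw [norm_mul, mul_comm]
      exact mul_le_mul_of_nonneg_left (G.norm_coe_le_norm θ) (norm_nonneg _)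
  have hker : Submodule.span ℂ (Set.range (@fourier (2 * Real.pi))) ≤ L'.ker := by
    rw [Submodule.span_le]
    rintro _ ⟨n, rfl⟩
    show L' (fourier n) = 0
    show ∫ θ : ℝ, fourier n (θ : AddCircle (2 * Real.pi)) * u θ ∂angularMeasure = 0
    rw [← h0 (-n)]
    congr 1; ext θ
    rw [fourier_coe_apply, mul_comm]
    congr 2
    have : (Real.pi : ℂ) ≠ 0 := by exact_mod_cast Real.pi_ne_zero
    push_cast
    field_simp
  have h1 : (Submodule.span ℂ (Set.range (@fourier (2 * Real.pi)))).topologicalClosure ≤ L'.ker :=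
    Submodule.topologicalClosure_minimal _ hker (L'.isClosed_ker)
  rw [span_fourier_closure_eq_top] at h1
  exact h1 (Submodule.mem_top (x := G))

/-- An integrable function with vanishing Fourier coefficients vanishes. -/
theorem ae_eq_zero_of_fourier_eq_zero {u : ℝ → ℂ} (hu : Integrable u angularMeasure)
    (h0 : ∀ n : ℤ, ∫ θ, u θ * Complex.exp (-(Complex.I * n * θ)) ∂angularMeasure = 0) :
    ∀ᵐ θ ∂angularMeasure, u θ = 0 := by
  have : Fact (0 < 2 * Real.pi) := ⟨by positivity⟩
  rw [angularMeasure, ae_restrict_iff' measurableSet_Ioo]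
  refine isOpen_Ioo.ae_eq_zero_of_integral_contDiff_smul_eq_zero
    (integrable_angularMeasure_iff.1 hu).locallyIntegrableOn ?_
  intro g hg hgc hgs
  have hz : ∀ x, x ∉ Set.Ioo (-Real.pi) Real.pi → g x = 0 := fun x hx => by
    by_contra h
    exact hx (hgs (subset_tsupport _ h))
  -- A test function supported in (-π, π) vanishes at both ends and therefore descends to a
  -- continuous function on the circle.
  have hcont : Continuous (AddCircle.liftIco (2 * Real.pi) (-Real.pi) fun x => (g x : ℂ)) := by
    refine AddCircle.liftIco_continuous ?_ (by have := hg.continuous; fun_prop)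
    rw [hz (-Real.pi) (by simp), hz (-Real.pi + 2 * Real.pi) (by
      rintro ⟨_, h⟩; linarith)]
  have h1 := integral_continuousMap_mul_eq_zero hu h0 ⟨_, hcont⟩
  rw [← setIntegral_eq_integral_of_forall_compl_eq_zero (s := Set.Ioo (-Real.pi) Real.pi)
    (fun x hx => by rw [hz x hx, zero_smul]), ← h1, angularMeasure]
  refine setIntegral_congr_fun measurableSet_Ioo fun θ hθ => ?_
  simp only [ContinuousMap.coe_mk]
  rw [AddCircle.liftIco_coe_apply ⟨hθ.1.le, by linarith [hθ.2]⟩]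
  rfl

/-- An integrable function is bounded by the sum of the moduli of its Fourier coefficients. -/
theorem ae_norm_le_tsum_fourier {u : ℝ → ℂ} (hu : Integrable u angularMeasure)
    (hs : Summable fun n : ℤ =>
      ‖∫ θ, u θ * Complex.exp (-(Complex.I * n * θ)) ∂angularMeasure‖) :
    ∀ᵐ θ ∂angularMeasure, ‖u θ‖ ≤ (2 * Real.pi)⁻¹ *
      ∑' n : ℤ, ‖∫ θ, u θ * Complex.exp (-(Complex.I * n * θ)) ∂angularMeasure‖ := by
  set c : ℤ → ℂ := fun n => ∫ θ, u θ * Complex.exp (-(Complex.I * n * θ)) ∂angularMeasure with hc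
  set b : ℤ → ℂ := fun n => ((2 * Real.pi)⁻¹ : ℝ) * c n with hb
  have hnb : ∀ n, ‖b n‖ = (2 * Real.pi)⁻¹ * ‖c n‖ := by
    intro n
    rw [hb, norm_mul, Complex.norm_real, Real.norm_eq_abs, abs_of_pos (by positivity)]
  have hsb : Summable fun n => ‖b n‖ := by
    simp only [hnb]; exact hs.mul_left _
  have hbe : ∀ (n : ℤ) (θ : ℝ), ‖b n * Complex.exp (Complex.I * n * θ)‖ = ‖b n‖ := by
    intro n θ; rw [norm_mul, norm_exp_I_mul, mul_one]
  have hsum : ∀ θ : ℝ, HasSum (fun n : ℤ => b n * Complex.exp (Complex.I * n * θ))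
      (∑' n : ℤ, b n * Complex.exp (Complex.I * n * θ)) := fun θ =>
    (Summable.of_norm (by simp only [hbe]; exact hsb)).hasSum
  -- `w` is the absolutely convergent Fourier series of `u`. It has the same coefficients, so it
  -- equals `u` almost everywhere and inherits the bound of its sum.
  set w : ℝ → ℂ := fun θ => ∑' n : ℤ, b n * Complex.exp (Complex.I * n * θ) with hw
  have hwc : Continuous w :=
    continuous_tsum (fun n => by fun_prop) hsb fun n θ => (hbe n θ).le
  have hwb : ∀ θ, ‖w θ‖ ≤ (2 * Real.pi)⁻¹ * ∑' n : ℤ, ‖c n‖ := by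
    intro θ
    rw [← tsum_mul_left]
    simp only [← hnb]
    have := norm_tsum_le_tsum_norm (f := fun n : ℤ => b n * Complex.exp (Complex.I * n * θ))
      (by simp only [hbe]; exact hsb)
    simpa only [hbe] using this
  have hwi : Integrable w angularMeasure :=
    (hwc.integrableOn_Icc (a := -Real.pi) (b := Real.pi)).mono_set Set.Ioo_subset_Icc_self
  have h1 := (integral_mul_exp_of_hasSum hsb (j := fun n => n) (fun _ _ h => h) hsum).1
  have h2 := ae_eq_zero_of_fourier_eq_zero (hu.sub hwi) (fun n => by
    have ie : ∀ {v : ℝ → ℂ}, Integrable v angularMeasure → Integrable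
        (fun θ : ℝ => v θ * Complex.exp (-(Complex.I * n * θ))) angularMeasure := fun hv =>
      hv.mul_bdd (c := 1) (continuous_exp_neg_I_mul n).aestronglyMeasurable
        (ae_of_all _ fun θ => (norm_exp_neg_I_mul n θ).le)
    simp only [Pi.sub_apply, sub_mul]
    rw [integral_sub (ie hu) (ie hwi), h1 n]
    simp only [hb, hc]
    have : (Real.pi : ℂ) ≠ 0 := by exact_mod_cast Real.pi_ne_zero
    push_cast
    field_simp
    ring)
  filter_upwards [h2] with θ hθ
  have : u θ = w θ := sub_eq_zero.1 hθ
  rw [this]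
  exact hwb θ

/-! ### Harmonic extensions and the size of the coefficients -/

/-- Harmonicity is invariant under linear isometries of the domain. -/
theorem InnerProductSpace.HarmonicAt.comp_linearIsometryEquiv {E E' F : Type*}
    [NormedAddCommGroup E] [InnerProductSpace ℝ E] [FiniteDimensional ℝ E]
    [NormedAddCommGroup E'] [InnerProductSpace ℝ E'] [FiniteDimensional ℝ E']
    [NormedAddCommGroup F] [NormedSpace ℝ F] {f : E' → F} (e : E ≃ₗᵢ[ℝ] E') {x : E}
    (h : InnerProductSpace.HarmonicAt f (e x)) : InnerProductSpace.HarmonicAt (f ∘ e) x := by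
  refine ⟨h.1.comp x e.contDiff.contDiffAt, ?_⟩
  have hL : ∀ z, Laplacian.laplacian (f ∘ e) z = Laplacian.laplacian f (e z) := by
    intro z
    -- The Laplacian may be computed in any orthonormal basis; one basis and its image under `e` are
    -- used on the two sides.
    rw [InnerProductSpace.laplacian_eq_iteratedFDeriv_orthonormalBasis (f ∘ e)
        (stdOrthonormalBasis ℝ E),
      InnerProductSpace.laplacian_eq_iteratedFDeriv_orthonormalBasis f
        ((stdOrthonormalBasis ℝ E).map e)]
    refine Finset.sum_congr rfl fun i _ => ?_
    have h1 : iteratedFDeriv ℝ 2 (f ∘ e) z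
        = (iteratedFDeriv ℝ 2 f (e z)).compContinuousLinearMap
          fun _ => (e.toContinuousLinearEquiv : E →L[ℝ] E') := by
      simp only [← iteratedFDerivWithin_univ]
      exact e.toContinuousLinearEquiv.iteratedFDerivWithin_comp_right f uniqueDiffOn_univ
        (Set.mem_univ _) 2
    rw [h1, ContinuousMultilinearMap.compContinuousLinearMap_apply]
    congr 1
    ext j
    fin_cases j <;> simp
  have h2 := (e.continuous.tendsto x).eventually h.2
  filter_upwards [h2] with z hz
  rw [hL z, hz]
  rfl

/-- The Fourier integrals of a real harmonic function decay geometrically. -/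
theorem exists_norm_integral_mul_exp_le {g : ℂ → ℝ} {R₀ s t : ℝ}
    (hg : InnerProductSpace.HarmonicOnNhd g (ball 0 R₀)) (hs : 0 < s) (hst : s < t)
    (htR : t < R₀) :
    ∃ K : ℝ, ∀ n : ℤ, n ≠ 0 →
      ‖∫ θ : ℝ, (g (s * Complex.exp (θ * Complex.I)) : ℂ) * Complex.exp (-(Complex.I * n * θ))
        ∂angularMeasure‖ * t ^ n.natAbs ≤ K * s ^ n.natAbs := by
  -- On a disk `g` is the real part of a holomorphic `G`. Its Taylor coefficients satisfy |b_k| t^k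
  -- ≤ K since t < R₀, and the modes of `g` on the circle of radius s are π b_k s^k or conjugates of
  -- these.
  obtain ⟨G, hG, hGg⟩ := hg.exists_analyticOnNhd_ball_re_eq
  have ht : 0 < t := hs.trans hst
  have hGd : DifferentiableOn ℂ G (ball 0 R₀) := hG.differentiableOn
  set b : ℕ → ℂ := fun k => (k.factorial : ℂ)⁻¹ * iteratedDeriv k G 0 with hb
  have hser : ∀ z ∈ ball (0 : ℂ) R₀, HasSum (fun k => b k * z ^ k) (G z) := by
    intro z hz
    convert! Complex.hasSum_taylorSeries_on_ball hGd hz using 2 with k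
    simp only [hb, sub_zero, smul_eq_mul]
    ring
  have hmem : ∀ (q : ℝ), 0 ≤ q → q < R₀ → ∀ θ : ℝ,
      (q : ℂ) * Complex.exp (θ * Complex.I) ∈ ball (0 : ℂ) R₀ := by
    intro q hq hqR θ
    rw [mem_ball_zero_iff, norm_mul, Complex.norm_exp_ofReal_mul_I, mul_one, Complex.norm_real,
      Real.norm_eq_abs, abs_of_nonneg hq]
    exact hqR
  have hsumt : Summable fun k => b k * (t : ℂ) ^ k :=
    (hser t (by simpa using hmem t ht.le htR 0)).summable
  obtain ⟨K, hK⟩ : ∃ K, ∀ k, ‖b k‖ * t ^ k ≤ K := by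
    obtain ⟨K, hK⟩ := (hsumt.tendsto_atTop_zero.norm).bddAbove_range
    refine ⟨K, fun k => ?_⟩
    have := hK ⟨k, rfl⟩
    simpa [abs_of_pos ht] using this
  have hsum_s : Summable fun k => ‖b k * (s : ℂ) ^ k‖ := by
    refine Summable.of_nonneg_of_le (fun _ => norm_nonneg _) (fun k => ?_)
      ((summable_geometric_of_lt_one (by positivity) ((div_lt_one ht).2 hst)).mul_left K)
    rw [norm_mul, norm_pow, Complex.norm_real, Real.norm_eq_abs, abs_of_pos hs, div_pow,
      mul_div_assoc', le_div_iff₀ (by positivity), mul_right_comm]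
    exact mul_le_mul_of_nonneg_right (hK k) (by positivity)
  have hu : ∀ θ : ℝ, HasSum (fun k : ℕ => b k * (s : ℂ) ^ k * Complex.exp (Complex.I * (k : ℤ) * θ))
      (G (s * Complex.exp (θ * Complex.I))) := by
    intro θ
    convert! hser _ (hmem s hs.le (hst.trans htR) θ) using 2 with k
    rw [exp_I_mul_natCast, mul_pow, mul_assoc]
  have huc : Continuous fun θ : ℝ => G (s * Complex.exp (θ * Complex.I)) :=
    hGd.continuousOn.comp_continuous (by fun_prop) (hmem s hs.le (hst.trans htR))
  refine ⟨Real.pi * K, fun n hn => ?_⟩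
  have h1 := integral_re_mul_exp_of_hasSum hsum_s hu huc hn
  have h2 : ∀ θ : ℝ, (G (s * Complex.exp (θ * Complex.I))).re = g (s * Complex.exp (θ * Complex.I)) :=
    fun θ => hGg (hmem s hs.le (hst.trans htR) θ)
  simp only [h2] at h1
  rw [h1]
  have h3 : ‖(Real.pi : ℂ) * if 0 < n then b n.natAbs * (s : ℂ) ^ n.natAbs
      else (starRingEnd ℂ) (b n.natAbs * (s : ℂ) ^ n.natAbs)‖
      = Real.pi * (‖b n.natAbs‖ * s ^ n.natAbs) := by
    rw [norm_mul, Complex.norm_real, Real.norm_eq_abs, abs_of_pos Real.pi_pos]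
    split_ifs
    · rw [norm_mul, norm_pow, Complex.norm_real, Real.norm_eq_abs, abs_of_pos hs]
    · rw [RCLike.norm_conj, norm_mul, norm_pow, Complex.norm_real, Real.norm_eq_abs, abs_of_pos hs]
  rw [h3]
  have h4 := hK n.natAbs
  calc _ = Real.pi * (‖b n.natAbs‖ * t ^ n.natAbs) * s ^ n.natAbs := by ring
    _ ≤ Real.pi * K * s ^ n.natAbs := by gcongr

/-- The plane as a copy of `ℂ`. -/
noncomputable def planeEquiv : Plane ≃ₗᵢ[ℝ] ℂ := Complex.orthonormalBasisOneI.repr.symm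

theorem planeEquiv_apply (x : Plane) : planeEquiv x = toComplex x := rfl

theorem planeEquiv_symm_polar (r θ : ℝ) :
    planeEquiv.symm (r * Complex.exp (θ * Complex.I)) = polarMap (r, θ) := by
  rw [← toComplex_polarMap, ← planeEquiv_apply, LinearIsometryEquiv.symm_apply_apply]

/-- If the potential extends harmonically to a disk, its coefficients decay accordingly. -/
theorem IsSource.exists_norm_sourceCoeff_le {re R S : ℝ} {f : Plane → ℂ} (h : IsSource re R S f)
    {R₀ t : ℝ} (hext : ExtendsHarmonically re (newtonianPotential f) (ball 0 R₀)) (hre : re ≤ t)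
    (htR : t < R₀) :
    ∃ K : ℝ, ∀ n : ℤ, n ≠ 0 → ‖sourceCoeff re f n‖ * t ^ n.natAbs ≤ K := by
  obtain ⟨H, hH, hHF⟩ := hext
  have hre0 := h.re_pos
  have hh : InnerProductSpace.HarmonicOnNhd (H ∘ planeEquiv.symm) (ball 0 R₀) := by
    intro z hz
    refine InnerProductSpace.HarmonicAt.comp_linearIsometryEquiv _ (hH _ ?_)
    rw [mem_ball_zero_iff] at hz ⊢
    rwa [LinearIsometryEquiv.norm_map]
  -- The extension agrees with the potential only on the open disk of radius `re`, so the modes are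
  -- compared on a smaller circle. On it they are -a_n s^|n|, up to normalisation.
  set s := re / 2 with hs
  have hs0 : 0 < s := by positivity
  have hst : s < t := by linarith
  -- The extension is complex-valued; its real and imaginary parts are harmonic and are treated
  -- separately.
  obtain ⟨K₁, hK₁⟩ := exists_norm_integral_mul_exp_le (hh.comp_CLM Complex.reCLM) hs0 hst htR
  obtain ⟨K₂, hK₂⟩ := exists_norm_integral_mul_exp_le (hh.comp_CLM Complex.imCLM) hs0 hst htR
  refine ⟨K₁ + K₂, fun n hn => ?_⟩
  have hF : ∀ θ : ℝ, (H ∘ planeEquiv.symm) (s * Complex.exp (θ * Complex.I))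
      = newtonianPotential f (polarMap (s, θ)) := by
    intro θ
    rw [Function.comp_apply, planeEquiv_symm_polar]
    refine hHF ?_
    rw [mem_ball_zero_iff, norm_polarMap, abs_of_pos hs0, hs]
    linarith
  have hcont : Continuous fun θ : ℝ => (H ∘ planeEquiv.symm) (s * Complex.exp (θ * Complex.I)) := by
    refine hh.continuousOn.comp_continuous (by fun_prop) fun θ => ?_
    rw [mem_ball_zero_iff, norm_mul, Complex.norm_exp_ofReal_mul_I, mul_one, Complex.norm_real,
      Real.norm_eq_abs, abs_of_pos hs0]
    exact hst.trans htR
  have hint : ∀ l : ℂ →L[ℝ] ℝ, Integrable (fun θ : ℝ =>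
      ((l ∘ (H ∘ planeEquiv.symm)) (s * Complex.exp (θ * Complex.I)) : ℂ)
        * Complex.exp (-(Complex.I * n * θ))) angularMeasure := by
    intro l
    have : Continuous fun θ : ℝ =>
        ((l ∘ (H ∘ planeEquiv.symm)) (s * Complex.exp (θ * Complex.I)) : ℂ)
          * Complex.exp (-(Complex.I * n * θ)) :=
      (Complex.continuous_ofReal.comp (l.continuous.comp hcont)).mul (continuous_exp_neg_I_mul n)
    exact (this.integrableOn_Icc (a := -Real.pi) (b := Real.pi)).mono_set Set.Ioo_subset_Icc_self
  have h1 := h.mode_potential_inside hn hs0 (by rw [hs]; linarith)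
  have h2 : fourierMode n (newtonianPotential f) s
      = (∫ θ : ℝ, ((Complex.reCLM ∘ (H ∘ planeEquiv.symm)) (s * Complex.exp (θ * Complex.I)) : ℂ)
          * Complex.exp (-(Complex.I * n * θ)) ∂angularMeasure)
        + (∫ θ : ℝ, ((Complex.imCLM ∘ (H ∘ planeEquiv.symm)) (s * Complex.exp (θ * Complex.I)) : ℂ)
          * Complex.exp (-(Complex.I * n * θ)) ∂angularMeasure) * Complex.I := by
    rw [← integral_mul_const, ← integral_add (hint _) ((hint _).mul_const _), fourierMode]
    congr 1; ext θ
    rw [← hF θ]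
    simp only [Function.comp_apply, Complex.reCLM_apply, Complex.imCLM_apply]
    conv_lhs => rw [← Complex.re_add_im (H (planeEquiv.symm (s * Complex.exp (θ * Complex.I))))]
    ring
  have h3 : ‖sourceCoeff re f n‖ * s ^ n.natAbs
      = ‖fourierMode n (newtonianPotential f) s‖ := by
    rw [h1, norm_mul, norm_neg, norm_pow, Complex.norm_real, Real.norm_eq_abs, abs_of_pos hs0]
  have h4 : ‖fourierMode n (newtonianPotential f) s‖ * t ^ n.natAbs
      ≤ (K₁ + K₂) * s ^ n.natAbs := by
    rw [h2]
    have ht : 0 < t := hs0.trans hst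
    refine (mul_le_mul_of_nonneg_right (norm_add_le _ _) (by positivity)).trans ?_
    rw [norm_mul, Complex.norm_I, mul_one, add_mul, add_mul]
    exact add_le_add (hK₁ n hn) (hK₂ n hn)
  rw [← h3] at h4
  have : 0 < s ^ n.natAbs := by positivity
  nlinarith

theorem differentiableOn_powerSeries {b : ℕ → ℂ} {t K : ℝ} (hb : ∀ k, ‖b k‖ * t ^ k ≤ K) :
    DifferentiableOn ℂ (fun z => ∑' k, b k * z ^ k) (ball 0 t) := by
  intro z hz
  rw [mem_ball_zero_iff] at hz
  obtain ⟨s, hzs, hst⟩ := exists_between hz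
  have hs : 0 ≤ s := (norm_nonneg z).trans hzs.le
  have ht : 0 < t := hs.trans_lt hst
  have : DifferentiableOn ℂ (fun z => ∑' k, b k * z ^ k) (ball 0 s) := by
    refine Complex.differentiableOn_tsum_of_summable_norm (u := fun k => K * (s / t) ^ k)
      ((summable_geometric_of_lt_one (by positivity) ((div_lt_one ht).2 hst)).mul_left K)
      (fun k => by fun_prop) isOpen_ball fun k w hw => ?_
    rw [mem_ball_zero_iff] at hw
    rw [norm_mul, norm_pow, div_pow, mul_div_assoc', le_div_iff₀ (by positivity)]
    calc _ = ‖b k‖ * t ^ k * ‖w‖ ^ k := by ring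
      _ ≤ K * s ^ k := by gcongr; exacts [(by positivity : 0 ≤ ‖b k‖ * t ^ k).trans (hb k), hb k]
  exact (this.differentiableAt (isOpen_ball.mem_nhds (by simpa using hzs))).differentiableWithinAt

/-- If the coefficients decay, the potential extends harmonically. -/
theorem IsSource.extendsHarmonically {re R S : ℝ} {f : Plane → ℂ} (h : IsSource re R S f)
    {t K : ℝ} (hK : ∀ n : ℤ, n ≠ 0 → ‖sourceCoeff re f n‖ * t ^ n.natAbs ≤ K) :
    ExtendsHarmonically re (newtonianPotential f) (ball 0 t) := by
  have hz : ∀ k : ℤ, ‖sourceCoeff re f k‖ * t ^ k.natAbs ≤ max K 0 := by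
    intro k
    rcases eq_or_ne k 0 with rfl | hk
    · simp [sourceCoeff]
    · exact (hK k hk).trans (le_max_left _ _)
  set b₁ : ℕ → ℂ := fun k => sourceCoeff re f k with hb₁
  -- The coefficients of negative index multiply powers of conj z. Conjugating them presents this
  -- half of the series as the conjugate of a holomorphic function.
  set b₂ : ℕ → ℂ := fun k => (starRingEnd ℂ) (sourceCoeff re f (-k)) with hb₂
  have d₁ := differentiableOn_powerSeries (b := b₁) (t := t) (K := max K 0)
    (fun k => by simpa [hb₁] using hz k)
  have d₂ := differentiableOn_powerSeries (b := b₂) (t := t) (K := max K 0)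
    (fun k => by simpa [hb₂, RCLike.norm_conj] using hz (-k))
  set G₁ : ℂ → ℂ := fun z => ∑' k, b₁ k * z ^ k with hG₁
  set G₂ : ℂ → ℂ := fun z => ∑' k, b₂ k * z ^ k with hG₂
  have a₁ := d₁.analyticOnNhd isOpen_ball
  have a₂ := d₂.analyticOnNhd isOpen_ball
  refine ⟨fun x => newtonianPotential f 0
    + (-(2 * Real.pi)⁻¹ : ℝ) • (G₁ (toComplex x) + (starRingEnd ℂ) (G₂ (toComplex x))), ?_, ?_⟩
  · intro x hx
    have hx' : planeEquiv x ∈ ball (0 : ℂ) t := by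
      rw [mem_ball_zero_iff] at hx ⊢
      rwa [LinearIsometryEquiv.norm_map]
    have h1 : InnerProductSpace.HarmonicAt G₁ (planeEquiv x) := (a₁ _ hx').harmonicAt
    have h2 : InnerProductSpace.HarmonicAt (fun z => (starRingEnd ℂ) (G₂ z)) (planeEquiv x) :=
      (a₂ _ hx').harmonicAt_conj
    have h3 := ((h1.add h2).const_smul (c := (-(2 * Real.pi)⁻¹ : ℝ)))
    have h4 := (InnerProductSpace.harmonicAt_const (x := planeEquiv x)
      (newtonianPotential f 0)).add h3
    exact h4.comp_linearIsometryEquiv planeEquiv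
  · intro x hx
    rw [mem_ball_zero_iff] at hx
    have hR : 0 < R := h.re_pos.trans h.re_lt
    have hxR : ‖x‖ < R := hx.trans h.re_lt
    have h1 := h.hasSum_potential hxR
    have hAK : ∀ k : ℤ, ‖sourceCoeff re f k‖ * R ^ k.natAbs ≤ ∫ y, ‖f y‖ := by
      intro k
      rcases eq_or_ne k 0 with rfl | hk
      · simpa [sourceCoeff] using integral_nonneg fun y => norm_nonneg _
      · exact h.norm_sourceCoeff_le hk
    have hsum : ∀ b : ℕ → ℂ, (∀ k, ‖b k‖ * R ^ k ≤ ∫ y, ‖f y‖) →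
        Summable fun k => b k * toComplex x ^ k := by
      intro b hb
      refine Summable.of_norm_bounded (g := fun k => (∫ y, ‖f y‖) * (‖x‖ / R) ^ k)
        ((summable_geometric_of_lt_one (by positivity) ((div_lt_one hR).2 hxR)).mul_left _)
        fun k => ?_
      rw [norm_mul, norm_pow, norm_toComplex, div_pow, mul_div_assoc', le_div_iff₀ (by positivity)]
      calc _ = ‖b k‖ * R ^ k * ‖x‖ ^ k := by ring
        _ ≤ _ := by gcongr; exact hb k
    have s₁ := (hsum b₁ fun k => by simpa [hb₁] using hAK k).hasSum
    have s₂ := (hsum b₂ fun k => by simpa [hb₂, RCLike.norm_conj] using hAK (-k)).hasSum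
    have h2 := (s₁.add (Complex.hasSum_conj'.2 s₂)).mul_left (-((2 * Real.pi : ℂ)⁻¹))
    have h3 : newtonianPotential f x - newtonianPotential f 0 = _ := h1.unique (by
      convert! h2 using 2 with k
      simp only [hb₁, hb₂, map_mul, map_pow, Complex.conj_conj]
      ring)
    rw [sub_eq_iff_eq_add'] at h3
    simp only [h3, Complex.real_smul, hG₁, hG₂]
    push_cast
    rfl

/-! ### Bounds for the coefficients of the transmission problem -/

/-- The determinant of the transmission problem. -/
noncomputable def transmissionDet (δ x y : ℝ) : ℂ :=
  δ ^ 2 * ((y : ℂ) ^ 2 - (x : ℂ) ^ 2) + 4 * (x : ℂ) ^ 2 - 4 * Complex.I * δ * (x : ℂ) ^ 2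

/-- The real part δ²(y² - x²) + 4x² alone is large enough. Together with the reverse estimate for δ
≤ 1, the determinant is comparable to δ²y² + x², and its two terms balance at δ = x/y = ρ^m. -/
theorem le_norm_transmissionDet {δ x y κ : ℝ} (hκ : κ ≤ 1) (hxy : x ^ 2 ≤ (1 - κ) * y ^ 2) :
    κ * (δ ^ 2 * y ^ 2 + x ^ 2) ≤ ‖transmissionDet δ x y‖ := by
  have h1 : (transmissionDet δ x y).re = δ ^ 2 * (y ^ 2 - x ^ 2) + 4 * x ^ 2 := by
    have : transmissionDet δ x y = ((δ ^ 2 * (y ^ 2 - x ^ 2) + 4 * x ^ 2 : ℝ) : ℂ)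
        + ((-(4 * δ * x ^ 2) : ℝ) : ℂ) * Complex.I := by
      rw [transmissionDet]; push_cast; ring
    rw [this]
    simp only [Complex.add_re, Complex.ofReal_re, Complex.re_ofReal_mul, Complex.I_re, mul_zero,
      add_zero]
  refine le_trans ?_ ((le_abs_self _).trans (Complex.abs_re_le_norm _))
  rw [h1]
  have h2 : κ * y ^ 2 ≤ y ^ 2 - x ^ 2 := by linarith
  have h3 := mul_le_mul_of_nonneg_left h2 (sq_nonneg δ)
  nlinarith [sq_nonneg x]

theorem norm_transmissionDet_le {δ x y : ℝ} (hδ : 0 ≤ δ) (hδ1 : δ ≤ 1) (hxy : x ^ 2 ≤ y ^ 2) :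
    ‖transmissionDet δ x y‖ ≤ 8 * (δ ^ 2 * y ^ 2 + x ^ 2) := by
  have h0 : transmissionDet δ x y = ((δ ^ 2 * (y ^ 2 - x ^ 2) + 4 * x ^ 2 : ℝ) : ℂ)
      + ((-(4 * δ * x ^ 2) : ℝ) : ℂ) * Complex.I := by
    rw [transmissionDet]; push_cast; ring
  rw [h0]
  refine (norm_add_le _ _).trans ?_
  rw [norm_mul, Complex.norm_I, mul_one, Complex.norm_real, Complex.norm_real, Real.norm_eq_abs,
    Real.norm_eq_abs, abs_neg, abs_of_nonneg (by positivity : 0 ≤ 4 * δ * x ^ 2),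
    abs_of_nonneg (by have := mul_nonneg (sq_nonneg δ) (sub_nonneg.2 hxy); positivity)]
  nlinarith [sq_nonneg x, sq_nonneg (δ * y), sq_nonneg (δ * x), mul_le_mul_of_nonneg_right hδ1 (sq_nonneg x)]

/-- The coefficients of the solution of the transmission problem: `B`, `C` in the shell and `D`
outside. -/
structure IsTransmissionSolution (δ x y : ℝ) (a B C D : ℂ) : Prop where
  eq_B : B * transmissionDet δ x y = 2 * a * Complex.I * δ * (y : ℂ) ^ 2
  eq_C : C * transmissionDet δ x y = 2 * a * (x : ℂ) ^ 2 * (Complex.I * δ - 2) * (y : ℂ) ^ 2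
  eq_D : D * transmissionDet δ x y
    = a * ((y : ℂ) ^ 2 - (x : ℂ) ^ 2) * (2 * Complex.I * δ + δ ^ 2) * (y : ℂ) ^ 2

namespace IsTransmissionSolution

variable {δ x y κ : ℝ} {a B C D : ℂ}

theorem norm_B (h : IsTransmissionSolution δ x y a B C D) (hδ : 0 ≤ δ) :
    ‖B‖ * ‖transmissionDet δ x y‖ = 2 * ‖a‖ * δ * y ^ 2 := by
  rw [← norm_mul, h.eq_B]
  simp only [norm_mul, Complex.norm_ofNat, Complex.norm_I, norm_pow, Complex.norm_real,
    Real.norm_eq_abs, sq_abs, abs_of_nonneg hδ, mul_one]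

theorem norm_C (h : IsTransmissionSolution δ x y a B C D) :
    (‖C‖ * ‖transmissionDet δ x y‖) ^ 2 = 4 * ‖a‖ ^ 2 * x ^ 4 * (δ ^ 2 + 4) * y ^ 4 := by
  have h1 : ‖Complex.I * δ - 2‖ ^ 2 = δ ^ 2 + 4 := by
    rw [← Complex.normSq_eq_norm_sq, Complex.normSq_apply]
    simp
    ring
  rw [← norm_mul, h.eq_C]
  simp only [norm_mul, Complex.norm_ofNat, norm_pow, Complex.norm_real,
    Real.norm_eq_abs, sq_abs]
  rw [mul_pow, mul_pow, h1]
  ring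

theorem norm_D_le (h : IsTransmissionSolution δ x y a B C D) (hδ : 0 ≤ δ) (hxy : x ^ 2 ≤ y ^ 2) :
    ‖D‖ * ‖transmissionDet δ x y‖ ≤ ‖a‖ * y ^ 2 * (2 * δ + δ ^ 2) * y ^ 2 := by
  have h1 : ‖(2 * Complex.I * δ + δ ^ 2 : ℂ)‖ ≤ 2 * δ + δ ^ 2 := by
    refine (norm_add_le _ _).trans (le_of_eq ?_)
    simp [abs_of_nonneg hδ]
  have h2 : ‖((y : ℂ) ^ 2 - (x : ℂ) ^ 2)‖ ≤ y ^ 2 := by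
    have : ((y : ℂ) ^ 2 - (x : ℂ) ^ 2) = ((y ^ 2 - x ^ 2 : ℝ) : ℂ) := by push_cast; ring
    rw [this, Complex.norm_real, Real.norm_eq_abs, abs_of_nonneg (sub_nonneg.2 hxy)]
    linarith [sq_nonneg x]
  rw [← norm_mul, h.eq_D]
  simp only [norm_mul, norm_pow, Complex.norm_real, Real.norm_eq_abs, sq_abs]
  gcongr

/-- The factor x / y² is r^{-m} at r = r_e²/r_i. By 2δxy ≤ δ²y² + x² it compensates the resonance,
and δ²y² ≤ δ²y² + x² controls large δ, so the bound does not depend on δ. -/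
theorem norm_D_mul_le (h : IsTransmissionSolution δ x y a B C D) (hδ : 0 < δ) (hx : 0 < x)
    (hy : 0 < y) (hκ0 : 0 < κ) (hκ : κ ≤ 1) (hxy : x ^ 2 ≤ (1 - κ) * y ^ 2) :
    ‖D‖ * (x / y ^ 2) ≤ 2 / κ * (‖a‖ * y) := by
  have hxy' : x ^ 2 ≤ y ^ 2 := by nlinarith [sq_nonneg y]
  have hle : x ≤ y := (abs_le_of_sq_le_sq' hxy' hy.le).2
  have h1 := h.norm_D_le hδ.le hxy'
  have h2 := le_norm_transmissionDet (δ := δ) hκ hxy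
  have hd : 0 < δ ^ 2 * y ^ 2 + x ^ 2 := by positivity
  set d := δ ^ 2 * y ^ 2 + x ^ 2 with hdd
  have h3 : ‖D‖ * (κ * d) ≤ ‖a‖ * y ^ 2 * (2 * δ + δ ^ 2) * y ^ 2 :=
    (mul_le_mul_of_nonneg_left h2 (norm_nonneg D)).trans h1
  have h4 : (2 * δ + δ ^ 2) * (x * y ^ 2) ≤ 2 * y * d := by
    have e1 : 2 * δ * x * y ≤ d := by rw [hdd]; nlinarith [sq_nonneg (δ * y - x)]
    have e2 : δ ^ 2 * y ^ 2 ≤ d := by rw [hdd]; nlinarith [sq_nonneg x]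
    nlinarith [mul_le_mul_of_nonneg_left e1 hy.le, mul_le_mul hle e2 (by positivity) hy.le]
  have h5 : ‖D‖ * (κ * d) * x ≤ ‖a‖ * y ^ 2 * (2 * y * d) := by
    calc _ ≤ ‖a‖ * y ^ 2 * (2 * δ + δ ^ 2) * y ^ 2 * x := by gcongr
      _ = ‖a‖ * y ^ 2 * ((2 * δ + δ ^ 2) * (x * y ^ 2)) := by ring
      _ ≤ _ := by gcongr
  rw [mul_div_assoc', div_le_iff₀ (by positivity), div_mul_eq_mul_div, div_mul_eq_mul_div,
    le_div_iff₀ hκ0]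
  have : (‖D‖ * x * κ) * d ≤ (2 * (‖a‖ * y) * y ^ 2) * d := by nlinarith
  exact le_of_mul_le_mul_right this hd

/-- The energy of a mode stays bounded below the critical radius. -/
theorem shell_upper (h : IsTransmissionSolution δ x y a B C D) (hδ : 0 < δ) (hx : 0 < x)
    (hy : 0 < y) (hκ0 : 0 < κ) (hκ : κ ≤ 1) (hxy : x ^ 2 ≤ (1 - κ) * y ^ 2) :
    δ * (‖B‖ * y) ^ 2 ≤ (2 / κ) ^ 2 * (‖a‖ ^ 2 * (y ^ 3 / x)) ∧
      δ * (‖C‖ / x) ^ 2 ≤ (7 / κ) ^ 2 * (‖a‖ ^ 2 * (y ^ 3 / x)) := by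
  have hxy' : x ^ 2 ≤ y ^ 2 := by nlinarith [sq_nonneg y]
  have hle : x ≤ y := (abs_le_of_sq_le_sq' hxy' hy.le).2
  have h2 := le_norm_transmissionDet (δ := δ) hκ hxy
  have hd : 0 < δ ^ 2 * y ^ 2 + x ^ 2 := by positivity
  set d := δ ^ 2 * y ^ 2 + x ^ 2 with hdd
  have hB : (‖B‖ * (κ * d)) ^ 2 ≤ (2 * ‖a‖ * δ * y ^ 2) ^ 2 := by
    rw [← h.norm_B hδ.le]
    gcongr
  have hC : (‖C‖ * (κ * d)) ^ 2 ≤ 4 * ‖a‖ ^ 2 * x ^ 4 * (δ ^ 2 + 4) * y ^ 4 := by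
    rw [← h.norm_C]
    gcongr
  -- Each of δxy, δ²y² and x² is at most `d`; products of two of them absorb the square of the
  -- determinant.
  have e1 : δ * x * y ≤ d := by rw [hdd]; nlinarith [sq_nonneg (δ * y - x), mul_pos (mul_pos hδ hx) hy]
  have e2 : δ ^ 2 * y ^ 2 ≤ d := by rw [hdd]; nlinarith [sq_nonneg x]
  have e3 : x ^ 2 ≤ d := by rw [hdd]; nlinarith [sq_nonneg (δ * y)]
  have f1 : (δ * x * y) * (δ ^ 2 * y ^ 2) ≤ d * d := mul_le_mul e1 e2 (by positivity) hd.le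
  have f2 : (δ * x * y) * x ^ 2 ≤ d * d := mul_le_mul e1 e3 (by positivity) hd.le
  constructor
  · rw [div_pow, mul_div_assoc', div_mul_div_comm, le_div_iff₀ (by positivity)]
    have : δ * (‖B‖ * y) ^ 2 * (κ ^ 2 * x) * d ^ 2 ≤ 2 ^ 2 * (‖a‖ ^ 2 * y ^ 3) * d ^ 2 := by
      calc _ = (‖B‖ * (κ * d)) ^ 2 * (δ * x * y ^ 2) := by ring
        _ ≤ (2 * ‖a‖ * δ * y ^ 2) ^ 2 * (δ * x * y ^ 2) := by gcongr
        _ = 4 * ‖a‖ ^ 2 * y ^ 3 * ((δ * x * y) * (δ ^ 2 * y ^ 2)) := by ring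
        _ ≤ 4 * ‖a‖ ^ 2 * y ^ 3 * (d * d) := by gcongr
        _ = _ := by ring
    exact le_of_mul_le_mul_right this (by positivity)
  · rw [div_pow, div_pow, mul_div_assoc', mul_div_assoc', div_mul_div_comm,
      div_le_div_iff₀ (by positivity) (by positivity)]
    have : δ * ‖C‖ ^ 2 * (κ ^ 2 * x) * d ^ 2 ≤ 7 ^ 2 * (‖a‖ ^ 2 * y ^ 3) * x ^ 2 * d ^ 2 := by
      calc _ = (‖C‖ * (κ * d)) ^ 2 * (δ * x) := by ring
        _ ≤ 4 * ‖a‖ ^ 2 * x ^ 4 * (δ ^ 2 + 4) * y ^ 4 * (δ * x) := by gcongr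
        _ = 4 * ‖a‖ ^ 2 * y ^ 3 * x ^ 2 * ((δ * x * y) * (δ ^ 2 * x ^ 2)
            + 4 * ((δ * x * y) * x ^ 2)) := by ring
        _ ≤ 4 * ‖a‖ ^ 2 * y ^ 3 * x ^ 2 * ((δ * x * y) * (δ ^ 2 * y ^ 2)
            + 4 * ((δ * x * y) * x ^ 2)) := by gcongr
        _ ≤ 4 * ‖a‖ ^ 2 * y ^ 3 * x ^ 2 * (d * d + 4 * (d * d)) := by gcongr
        -- The constant is 4 · (1 + 4) = 20 ≤ 49.
        _ ≤ 7 ^ 2 * (‖a‖ ^ 2 * y ^ 3) * x ^ 2 * d ^ 2 := by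
          have : 0 ≤ ‖a‖ ^ 2 * y ^ 3 * x ^ 2 * d ^ 2 := by positivity
          nlinarith
    exact le_of_mul_le_mul_right this (by positivity)

/-- The energy of a mode from below. -/
theorem shell_lower (h : IsTransmissionSolution δ x y a B C D) (hδ : 0 < δ) (hδ1 : δ ≤ 1)
    (hx : 0 < x) (hy : 0 < y) (hxy : x ^ 2 ≤ y ^ 2) :
    ‖a‖ ^ 2 / (16 * (δ ^ 2 + (x / y) ^ 2)) ≤ ‖B‖ ^ 2 + ‖C‖ ^ 2 / (x ^ 2 * y ^ 2) := by
  have h2 := norm_transmissionDet_le hδ.le hδ1 hxy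
  have hd : 0 < δ ^ 2 * y ^ 2 + x ^ 2 := by positivity
  have e : δ ^ 2 + (x / y) ^ 2 = (δ ^ 2 * y ^ 2 + x ^ 2) / y ^ 2 := by field_simp
  rw [e]
  set d := δ ^ 2 * y ^ 2 + x ^ 2 with hdd
  have hB : (2 * ‖a‖ * δ * y ^ 2) ^ 2 ≤ (‖B‖ * (8 * d)) ^ 2 := by
    rw [← h.norm_B hδ.le]
    gcongr
  have hC : 4 * ‖a‖ ^ 2 * x ^ 4 * (δ ^ 2 + 4) * y ^ 4 ≤ (‖C‖ * (8 * d)) ^ 2 := by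
    rw [← h.norm_C]
    gcongr
  have hC' : 4 * ‖a‖ ^ 2 * x ^ 2 * y ^ 2 ≤ ‖C‖ ^ 2 / (x ^ 2 * y ^ 2) * (64 * d ^ 2) := by
    rw [div_mul_eq_mul_div, le_div_iff₀ (by positivity)]
    have : 0 ≤ ‖a‖ ^ 2 * x ^ 4 * y ^ 4 := by positivity
    have : 0 ≤ ‖a‖ ^ 2 * x ^ 4 * δ ^ 2 * y ^ 4 := by positivity
    nlinarith
  -- The growing part contributes δ²y² and the decaying part x²; only together do they form a full
  -- factor `d`, which cancels one power of the determinant.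
  have key : ‖a‖ ^ 2 * (4 * y ^ 2 * d) ≤ (‖B‖ ^ 2 + ‖C‖ ^ 2 / (x ^ 2 * y ^ 2)) * (64 * d ^ 2) := by
    rw [add_mul]
    calc _ = (2 * ‖a‖ * δ * y ^ 2) ^ 2 + 4 * ‖a‖ ^ 2 * x ^ 2 * y ^ 2 := by rw [hdd]; ring
      _ ≤ (‖B‖ * (8 * d)) ^ 2 + ‖C‖ ^ 2 / (x ^ 2 * y ^ 2) * (64 * d ^ 2) := add_le_add hB hC'
      _ = _ := by ring
  rw [mul_div_assoc', div_div_eq_mul_div, div_le_iff₀ (by positivity)]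
  have h3 : 0 < 4 * d := by positivity
  refine le_of_mul_le_mul_right (a := 4 * d) ?_ h3
  nlinarith
end IsTransmissionSolution

/-! ### From circles to the plane -/

theorem MeasureTheory.Integrable.ae_integrable_polarMap {h : Plane → ℂ} (hh : Integrable h) :
    ∀ᵐ r, r ∈ Set.Ioi (0 : ℝ) → Integrable (fun θ => h (polarMap (r, θ))) angularMeasure := by
  have h1 : Integrable (fun q => h (polarMap q)) (radialMeasure.prod angularMeasure) :=
    (measurePreserving_polarMap.integrable_comp hh.aestronglyMeasurable).2 hh
  rw [← ae_radialMeasure_iff]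
  exact h1.prod_right_ae

theorem MeasureTheory.LocallyIntegrable.ae_integrable_polarMap {h : Plane → ℂ}
    (hh : LocallyIntegrable h) :
    ∀ᵐ r, r ∈ Set.Ioi (0 : ℝ) → Integrable (fun θ => h (polarMap (r, θ))) angularMeasure := by
  have h1 : ∀ k : ℕ, _ := fun k => (hh.integrable_indicator_ball (k : ℝ)).ae_integrable_polarMap
  rw [← ae_all_iff] at h1
  filter_upwards [h1] with r hr hr0
  obtain ⟨k, hk⟩ := exists_nat_gt r
  refine (hr k hr0).congr (ae_of_all _ fun θ => ?_)
  refine Set.indicator_of_mem ?_ h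
  rw [mem_ball_zero_iff, norm_polarMap, abs_of_pos hr0]
  exact hk

/-- Passing from circles to the plane needs a measurable exceptional set, so `u` is first replaced
by a measurable representative. -/
theorem ae_norm_le_of_ae_ae_polarMap {u : Plane → ℂ} (hu : AEStronglyMeasurable u volume)
    {A : Set ℝ} (hA : MeasurableSet A) {C : ℝ}
    (h : ∀ᵐ r, r ∈ Set.Ioi (0 : ℝ) → r ∈ A →
      ∀ᵐ θ ∂angularMeasure, ‖u (polarMap (r, θ))‖ ≤ C) :
    ∀ᵐ x, ‖x‖ ∈ A → ‖u x‖ ≤ C := by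
  have hm := hu.stronglyMeasurable_mk.measurable
  have h1 : ∀ᵐ x, ‖x‖ ∈ A → ‖hu.mk u x‖ ≤ C := by
    refine ae_of_ae_ae_polarMap ?_ ?_
    · have : {x : Plane | ‖x‖ ∈ A → ‖hu.mk u x‖ ≤ C}
          = (norm ⁻¹' A)ᶜ ∪ (fun x => ‖hu.mk u x‖) ⁻¹' Set.Iic C := by
        ext x; simp [imp_iff_not_or]
      rw [this]
      exact (measurable_norm hA).compl.union (hm.norm measurableSet_Iic)
    · filter_upwards [h, ae_ae_polarMap hu.ae_eq_mk] with r h1 h2 hr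
      by_cases hrA : r ∈ A
      · filter_upwards [h1 hr hrA, h2 hr] with θ h3 h4 _
        rwa [← h4]
      · refine ae_of_all _ fun θ h3 => ?_
        rw [norm_polarMap, abs_of_pos hr] at h3
        exact absurd h3 hrA
  filter_upwards [h1, hu.ae_eq_mk] with x h2 h3
  rwa [h3]

theorem lintegral_eq_lintegral_polarMap {G : Plane → ℝ≥0∞} (hG : AEMeasurable G) :
    ∫⁻ x, G x = ∫⁻ r in Set.Ioi (0 : ℝ), ENNReal.ofReal r *
      ∫⁻ θ, G (polarMap (r, θ)) ∂angularMeasure := by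
  have h1 : AEMeasurable (fun q => G (polarMap q)) (radialMeasure.prod angularMeasure) :=
    hG.comp_quasiMeasurePreserving measurePreserving_polarMap.quasiMeasurePreserving
  rw [← measurePreserving_polarMap.map_eq, lintegral_map' (by
    rw [measurePreserving_polarMap.map_eq]; exact hG) measurable_polarMap.aemeasurable,
    lintegral_prod _ h1, radialMeasure,
    lintegral_withDensity_eq_lintegral_mul₀' ENNReal.measurable_ofReal.aemeasurable]
  · rfl
  · exact h1.lintegral_prod_right'

/-- Cauchy–Schwarz against the constant 1 on an interval of length 2π. It lets a single mode bound
the energy from below, with no need for Parseval's identity. -/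
theorem enorm_fourierMode_sq_le {u : Plane → ℂ} {r : ℝ} (n : ℤ)
    (hu : AEMeasurable (fun θ => u (polarMap (r, θ))) angularMeasure) :
    ‖fourierMode n u r‖ₑ ^ 2
      ≤ ENNReal.ofReal (2 * Real.pi) * ∫⁻ θ, ‖u (polarMap (r, θ))‖ₑ ^ 2 ∂angularMeasure := by
  have h1 : ‖fourierMode n u r‖ₑ ≤ ∫⁻ θ, ‖u (polarMap (r, θ))‖ₑ ∂angularMeasure := by
    refine (enorm_integral_le_lintegral_enorm _).trans (lintegral_mono fun θ => ?_)
    rw [enorm_mul, ← ofReal_norm (Complex.exp _), norm_exp_neg_I_mul]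
    simp
  have h2 := ENNReal.lintegral_mul_le_Lp_mul_Lq angularMeasure Real.HolderConjugate.two_two
    hu.enorm (aemeasurable_const (b := (1 : ℝ≥0∞)))
  have hμ : angularMeasure Set.univ = ENNReal.ofReal (2 * Real.pi) := by
    rw [← measureReal_angularMeasure, Measure.real, ENNReal.ofReal_toReal (measure_ne_top _ _)]
  simp only [Pi.mul_apply, mul_one, ENNReal.one_rpow, lintegral_const, one_mul, hμ] at h2
  have h3 := pow_le_pow_left' (h1.trans h2) 2
  refine h3.trans (le_of_eq ?_)
  rw [mul_pow, ← ENNReal.rpow_natCast, ← ENNReal.rpow_mul, ← ENNReal.rpow_natCast,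
    ← ENNReal.rpow_mul, mul_comm]
  norm_num

namespace IsDielectricSolution

variable {ri re R S δ : ℝ} {f V : Plane → ℂ} {DV : Fin 2 → Plane → ℂ}

/-- The nonzero modes of the solution. -/
theorem exists_modes (H : IsDielectricSolution ri re δ f V DV) (hf : IsSource re R S f)
    (hri : 0 < ri) (hre : ri < re) (hδ : 0 < δ) {n : ℤ} (hn : n ≠ 0) :
    ∃ B C D : ℂ,
      IsTransmissionSolution δ (ri ^ n.natAbs) (re ^ n.natAbs) (sourceCoeff re f n) B C D ∧
      (∀ᵐ r, r ∈ Set.Ioo ri re →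
        fourierMode n V r = B * (r : ℂ) ^ n.natAbs + C * ((r : ℂ) ^ n.natAbs)⁻¹ ∧
        fourierMode n (radialPart DV) r
          = n.natAbs * (B * (r : ℂ) ^ n.natAbs - C * ((r : ℂ) ^ n.natAbs)⁻¹)) ∧
      (∀ᵐ r, r ∈ Set.Ioi re →
        fourierMode n V r - fourierMode n (newtonianPotential f) r
          = D * ((r : ℂ) ^ n.natAbs)⁻¹) := by
  obtain ⟨B, C, D, h1, h2, h3, h4, h5⟩ := (H.isRadialSolution hf hri hre n).exists_shell_and_ext
    (Int.natAbs_ne_zero.2 hn) hδ.ne' rfl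
  refine ⟨B, C, D, ⟨?_, ?_, ?_⟩, h1, ?_⟩
  · rw [transmissionDet]; push_cast; exact h3
  · rw [transmissionDet]; push_cast; exact h4
  · rw [transmissionDet]; push_cast; exact h5
  · filter_upwards [h2] with r hr hrr
    rw [hr hrr, hf.mode_potential_outside hn hrr]
    ring

/-- The zeroth mode of the solution. -/
theorem mode_zero (H : IsDielectricSolution ri re δ f V DV) (hf : IsSource re R S f)
    (hri : 0 < ri) (hre : ri < re) :
    (∀ᵐ r, r ∈ Set.Ioo ri re → fourierMode 0 (radialPart DV) r = 0) ∧
      (∀ᵐ r, r ∈ Set.Ioi re → fourierMode 0 V r - fourierMode 0 (newtonianPotential f) r = 0) := by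
  have hc : (-1 + Complex.I * δ : ℂ) ≠ 0 := by
    intro h0
    have := congrArg Complex.re h0
    simp at this
  obtain ⟨h1, h2⟩ := (H.isRadialSolution hf hri hre 0).shell_and_ext_zero hc hf.integral_mode_zero
  refine ⟨h1, ?_⟩
  filter_upwards [h2] with r hr hrr
  rw [hr hrr, hf.mode_zero_potential_outside hrr, sub_self]

end IsDielectricSolution

theorem summable_natAbs_geometric {τ : ℝ} (h0 : 0 ≤ τ) (h1 : τ < 1) :
    Summable fun n : ℤ => (n.natAbs : ℝ) * τ ^ n.natAbs := by
  have h : Summable fun n : ℕ => (n : ℝ) * τ ^ n := by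
    have := summable_pow_mul_geometric_of_norm_lt_one (R := ℝ) 1
      (r := τ) (by rwa [Real.norm_eq_abs, abs_of_nonneg h0])
    simpa using this
  refine Summable.of_nat_of_neg (by simpa using h) (by simpa using h)

theorem summable_geometric_natAbs {τ : ℝ} (h0 : 0 ≤ τ) (h1 : τ < 1) :
    Summable fun n : ℤ => τ ^ n.natAbs := by
  have h := summable_geometric_of_lt_one h0 h1
  refine Summable.of_nat_of_neg (by simpa using h) (by simpa using h)

/-- A bound for a function on a circle in terms of bounds for its modes. -/
theorem ae_norm_le_of_norm_mode_le {u : ℝ → ℂ} (hu : Integrable u angularMeasure) {b : ℤ → ℝ}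
    (hb : Summable b)
    (h : ∀ n : ℤ, ‖∫ θ, u θ * Complex.exp (-(Complex.I * n * θ)) ∂angularMeasure‖ ≤ b n) :
    ∀ᵐ θ ∂angularMeasure, ‖u θ‖ ≤ (2 * Real.pi)⁻¹ * ∑' n, b n := by
  have hs := Summable.of_nonneg_of_le (fun n => norm_nonneg _) h hb
  filter_upwards [ae_norm_le_tsum_fourier hu hs] with θ hθ
  refine hθ.trans (mul_le_mul_of_nonneg_left ?_ (by positivity))
  exact hs.tsum_le_tsum h hb

/-- For m ≥ 1, ρ^{2m} ≤ ρ², so κ = 1 - ρ² serves in the determinant estimate for all nonzero modes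
at once. -/
theorem pow_sq_le {ri re : ℝ} (hri : 0 < ri) (hre : ri < re) {m : ℕ} (hm : m ≠ 0) :
    (ri ^ m) ^ 2 ≤ (1 - (1 - (ri / re) ^ 2)) * (re ^ m) ^ 2 := by
  have hre0 : 0 < re := hri.trans hre
  have h1 : ri / re ≤ 1 := (div_le_one hre0).2 hre.le
  have h2 : (ri / re) ^ m ≤ ri / re := pow_le_of_le_one (by positivity) h1 hm
  have h3 : (ri ^ m) ^ 2 = ((ri / re) ^ m) ^ 2 * (re ^ m) ^ 2 := by
    rw [div_pow, ← mul_pow, div_mul_cancel₀ _ (by positivity)]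
  rw [h3, sub_sub_cancel]
  gcongr

/-- The solutions differ from the potential by a bounded amount outside the cloaking region. -/
theorem exists_uniformlyBoundedOutside {ri re R S : ℝ} {f : Plane → ℂ} (hf : IsSource re R S f)
    (hri : 0 < ri) (hre : ri < re) {V : ℝ → Plane → ℂ} {DV : ℝ → Fin 2 → Plane → ℂ}
    (hV : ∀ δ, 0 < δ → IsDielectricSolution ri re δ f (V δ) (DV δ))
    (hF : ∃ C, BoundedOutsideBy (re ^ 2 / ri) C (newtonianPotential f)) :
    UniformlyBoundedOutside (re ^ 2 / ri) V := by
  obtain ⟨C₁, hC₁⟩ := hF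
  have hre0 : 0 < re := hri.trans hre
  have hR0 : 0 < R := hre0.trans hf.re_lt
  have hlt : re < re ^ 2 / ri := by rw [lt_div_iff₀ hri]; nlinarith
  set κ := 1 - (ri / re) ^ 2 with hκ
  have hρ : (ri / re) ^ 2 < 1 := by
    have : ri / re < 1 := (div_lt_one hre0).2 hre
    have : 0 < ri / re := by positivity
    nlinarith
  have hκ0 : 0 < κ := by rw [hκ]; linarith
  have hκ1 : κ ≤ 1 := by rw [hκ]; nlinarith [sq_nonneg (ri / re)]
  -- A summable majorant, independent of δ, for the modes of V - F; it is geometric because `re <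
  -- R`.
  set b : ℤ → ℝ := fun n => 2 / κ * (∫ y, ‖f y‖) * (re / R) ^ n.natAbs with hb
  have hbs : Summable b :=
    (summable_geometric_natAbs (by positivity) ((div_lt_one hR0).2 hf.re_lt)).mul_left _
  refine ⟨(2 * Real.pi)⁻¹ * ∑' n, b n + C₁, fun δ hδ => ?_⟩
  have H := hV δ hδ
  have hb0 : ∀ n, 0 ≤ b n := fun n => by
    have : 0 ≤ ∫ y, ‖f y‖ := integral_nonneg fun y => norm_nonneg _
    simp only [hb]; positivity
  have hmodes : ∀ n : ℤ, ∀ᵐ r, r ∈ Set.Ioi (re ^ 2 / ri) →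
      ‖fourierMode n (V δ) r - fourierMode n (newtonianPotential f) r‖ ≤ b n := by
    intro n
    rcases eq_or_ne n 0 with rfl | hn
    · filter_upwards [(H.mode_zero hf hri hre).2] with r hr hrr
      rw [hr (hlt.trans hrr), norm_zero]
      exact hb0 0
    · obtain ⟨B, C, D, h1, -, h3⟩ := H.exists_modes hf hri hre hδ hn
      filter_upwards [h3] with r hr hrr
      have hr0 : 0 < r := hre0.trans (hlt.trans hrr)
      have hm := Int.natAbs_ne_zero.2 hn
      rw [hr (hlt.trans hrr), norm_mul, norm_inv, norm_pow, Complex.norm_real, Real.norm_eq_abs,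
        abs_of_pos hr0]
      -- Here the radius r_e²/r_i enters: beyond it r⁻¹ ≤ r_i/r_e², and `norm_D_mul_le` becomes
      -- applicable.
      calc ‖D‖ * (r ^ n.natAbs)⁻¹ ≤ ‖D‖ * (ri ^ n.natAbs / (re ^ n.natAbs) ^ 2) := by
            gcongr
            rw [← pow_mul, mul_comm, pow_mul, ← div_pow, ← inv_pow]
            gcongr
            rw [inv_le_comm₀ hr0 (by positivity), inv_div]
            exact le_of_lt hrr
        _ ≤ 2 / κ * (‖sourceCoeff re f n‖ * re ^ n.natAbs) :=
            h1.norm_D_mul_le hδ (by positivity) (by positivity) hκ0 hκ1 (pow_sq_le hri hre hm)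
        _ ≤ b n := by
            simp only [hb]
            rw [mul_assoc, div_pow, mul_div_assoc']
            have := hf.norm_sourceCoeff_le hn
            gcongr
            rw [le_div_iff₀ (by positivity)]
            calc _ = ‖sourceCoeff re f n‖ * R ^ n.natAbs * re ^ n.natAbs := by ring
              _ ≤ _ := by gcongr
  rw [← ae_all_iff] at hmodes
  refine ae_norm_le_of_ae_ae_polarMap H.1.1.aestronglyMeasurable
    (measurableSet_Ioi (a := re ^ 2 / ri)) ?_
  filter_upwards [hmodes, H.1.1.ae_integrable_polarMap, ae_ae_polarMap hC₁] with r h1 h2 h3 hr hra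
  have iF := integrable_newtonianPotential_polarMap hf.integrable hf.zero_outside hr
  have iV := h2 hr
  have key := ae_norm_le_of_norm_mode_le (iV.sub iF) hbs (fun n => by
    have ie : ∀ {v : ℝ → ℂ}, Integrable v angularMeasure → Integrable
        (fun θ : ℝ => v θ * Complex.exp (-(Complex.I * n * θ))) angularMeasure := fun hv =>
      hv.mul_bdd (c := 1) (continuous_exp_neg_I_mul n).aestronglyMeasurable
        (ae_of_all _ fun θ => (norm_exp_neg_I_mul n θ).le)
    have := h1 n hra
    rw [fourierMode, fourierMode, ← integral_sub (ie iV) (ie iF)] at this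
    simpa only [Pi.sub_apply, sub_mul] using this)
  filter_upwards [key, h3 hr] with θ h4 h5
  have h6 := h5 (by rw [norm_polarMap, abs_of_pos hr]; exact hra)
  calc _ = ‖(V δ (polarMap (r, θ)) - newtonianPotential f (polarMap (r, θ)))
        + newtonianPotential f (polarMap (r, θ))‖ := by rw [sub_add_cancel]
    _ ≤ _ := (norm_add_le _ _).trans (add_le_add h4 h6)

theorem norm_sq_mul_gradient_sq (DV : Fin 2 → Plane → ℂ) (x : Plane) :
    ‖x‖ ^ 2 * (‖DV 0 x‖ ^ 2 + ‖DV 1 x‖ ^ 2)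
      = ‖radialPart DV x‖ ^ 2 + ‖angularPart DV x‖ ^ 2 := by
  have h : ‖x‖ ^ 2 = x 0 ^ 2 + x 1 ^ 2 := by
    rw [EuclideanSpace.norm_sq_eq]
    simp [Fin.sum_univ_two]
  rw [h]
  simp only [← Complex.normSq_eq_norm_sq, Complex.normSq_apply, radialPart, angularPart,
    Complex.add_re, Complex.add_im, Complex.re_ofReal_mul, Complex.im_ofReal_mul, neg_mul,
    Complex.neg_re, Complex.neg_im]
  ring

theorem measurableSet_shell (ri re : ℝ) : MeasurableSet (shell ri re) :=
  measurable_norm measurableSet_Ioo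

theorem volume_shell_lt_top (ri re : ℝ) : volume (shell ri re) < ⊤ :=
  (measure_mono fun x (hx : x ∈ shell ri re) => mem_ball_zero_iff.2 hx.2).trans_lt
    (measure_ball_lt_top (x := (0 : Plane)) (r := re))

theorem sum_enorm_sq_eq (DV : Fin 2 → Plane → ℂ) {x : Plane} (hx : x ≠ 0) :
    ∑ j, ‖DV j x‖ₑ ^ 2 = ENNReal.ofReal
      ((‖radialPart DV x‖ ^ 2 + ‖angularPart DV x‖ ^ 2) / ‖x‖ ^ 2) := by
  have h0 : ‖x‖ ^ 2 ≠ 0 := pow_ne_zero _ (norm_ne_zero_iff.2 hx)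
  rw [← norm_sq_mul_gradient_sq, mul_div_cancel_left₀ _ h0, Fin.sum_univ_two,
    ENNReal.ofReal_add (by positivity) (by positivity), ENNReal.ofReal_pow (norm_nonneg _),
    ENNReal.ofReal_pow (norm_nonneg _), ofReal_norm, ofReal_norm]

theorem criticalRadius_sq {ri re : ℝ} (hri : 0 < ri) (hre : 0 < re) :
    criticalRadius ri re ^ 2 = re ^ 3 / ri := by
  rw [criticalRadius, Real.sq_sqrt (by positivity)]

/-- The quotient y³/x in the energy bounds is r_*^{2m}. This is where the critical radius comes
from. -/
theorem pow_cube_div {ri re : ℝ} (hri : 0 < ri) (hre : 0 < re) (m : ℕ) :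
    (re ^ m) ^ 3 / ri ^ m = (criticalRadius ri re ^ m) ^ 2 := by
  rw [← pow_mul _ m 2, mul_comm m 2, pow_mul, criticalRadius_sq hri hre, div_pow, ← pow_mul,
    ← pow_mul, mul_comm]

/-- `shell_upper` bounds √δ times the amplitudes by a multiple of |a| r_*^m, and |a| is at most K
t^{-m}. The constant 9 is 2 + 7, from the parts r^m and r^{-m}. -/
theorem IsTransmissionSolution.norm_le {δ ri re κ t K : ℝ} {a B C D : ℂ} {m : ℕ}
    (h : IsTransmissionSolution δ (ri ^ m) (re ^ m) a B C D) (hδ : 0 < δ) (hri : 0 < ri)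
    (hre : ri < re) (hκ0 : 0 < κ) (hκ : κ ≤ 1)
    (hxy : (ri ^ m) ^ 2 ≤ (1 - κ) * (re ^ m) ^ 2) (ht : 0 < t) (hK : ‖a‖ * t ^ m ≤ K) {r : ℝ}
    (hr : r ∈ Set.Ioo ri re) :
    ‖B‖ * r ^ m + ‖C‖ * (r ^ m)⁻¹
      ≤ 9 * K / κ * (criticalRadius ri re / t) ^ m / Real.sqrt δ := by
  have hre0 : 0 < re := hri.trans hre
  have hr0 : 0 < r := hri.trans hr.1
  have hc : 0 < criticalRadius ri re := Real.sqrt_pos.2 (by positivity)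
  have hs : 0 < Real.sqrt δ := Real.sqrt_pos.2 hδ
  have hss : Real.sqrt δ ^ 2 = δ := Real.sq_sqrt hδ.le
  obtain ⟨h1, h2⟩ := h.shell_upper hδ (pow_pos hri m) (pow_pos hre0 m) hκ0 hκ hxy
  have ha : ‖a‖ * criticalRadius ri re ^ m ≤ K * (criticalRadius ri re / t) ^ m := by
    rw [div_pow, mul_div_assoc', le_div_iff₀ (by positivity)]
    calc _ = ‖a‖ * t ^ m * criticalRadius ri re ^ m := by ring
      _ ≤ _ := by gcongr
  have hK0 : 0 ≤ K := le_trans (by positivity) hK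
  rw [pow_cube_div hri hre0, ← mul_pow, ← mul_pow, ← hss, ← mul_pow] at h1 h2
  have h3 := (abs_le_of_sq_le_sq' h1 (by positivity)).2
  have h4 := (abs_le_of_sq_le_sq' h2 (by positivity)).2
  have h5 : ‖B‖ * r ^ m ≤ ‖B‖ * re ^ m := by gcongr; exact hr.2.le
  have h6 : ‖C‖ * (r ^ m)⁻¹ ≤ ‖C‖ / ri ^ m := by
    rw [div_eq_mul_inv]; gcongr; exact hr.1.le
  rw [le_div_iff₀ hs]
  calc _ ≤ (‖B‖ * re ^ m + ‖C‖ / ri ^ m) * Real.sqrt δ := by gcongr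
    _ = Real.sqrt δ * (‖B‖ * re ^ m) + Real.sqrt δ * (‖C‖ / ri ^ m) := by ring
    _ ≤ 2 / κ * (K * (criticalRadius ri re / t) ^ m)
        + 7 / κ * (K * (criticalRadius ri re / t) ^ m) :=
      add_le_add (h3.trans (by gcongr)) (h4.trans (by gcongr))
    _ = _ := by ring

/-- The dissipated power stays bounded if the coefficients decay fast enough. -/
theorem exists_dissipation_lt {ri re R S : ℝ} {f : Plane → ℂ} (hf : IsSource re R S f)
    (hri : 0 < ri) (hre : ri < re) {V : ℝ → Plane → ℂ} {DV : ℝ → Fin 2 → Plane → ℂ}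
    (hV : ∀ δ, 0 < δ → IsDielectricSolution ri re δ f (V δ) (DV δ)) {t K : ℝ}
    (ht : criticalRadius ri re < t)
    (hK : ∀ n : ℤ, n ≠ 0 → ‖sourceCoeff re f n‖ * t ^ n.natAbs ≤ K) :
    ∃ C : ℝ, ∀ δ, 0 < δ → dissipation ri re δ (DV δ) < ENNReal.ofReal C := by
  have hre0 : 0 < re := hri.trans hre
  have hc : 0 < criticalRadius ri re := Real.sqrt_pos.2 (by positivity)
  have ht0 : 0 < t := hc.trans ht
  set κ := 1 - (ri / re) ^ 2 with hκ
  have hρ : (ri / re) ^ 2 < 1 := by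
    have : ri / re < 1 := (div_lt_one hre0).2 hre
    have : 0 < ri / re := by positivity
    nlinarith
  have hκ0 : 0 < κ := by rw [hκ]; linarith
  have hκ1 : κ ≤ 1 := by rw [hκ]; nlinarith [sq_nonneg (ri / re)]
  -- As t > r_*, the ratio is below 1; the decay τ^m outweighs the factor m produced by
  -- differentiation.
  set τ := criticalRadius ri re / t with hτ
  set b : ℤ → ℝ := fun n => 9 * K / κ * (n.natAbs * τ ^ n.natAbs) with hb
  have hbs : Summable b :=
    (summable_natAbs_geometric (by positivity) ((div_lt_one ht0).2 ht)).mul_left _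
  have hb0 : 0 ≤ b 0 := by simp [hb]
  set M := (2 * Real.pi)⁻¹ * ∑' n, b n with hM
  have main : ∀ δ, 0 < δ → dissipation ri re δ (DV δ)
      ≤ ENNReal.ofReal (2 * M ^ 2 / ri ^ 2) * volume (shell ri re) := by
    intro δ hδ
    have H := hV δ hδ
    have hs : 0 < Real.sqrt δ := Real.sqrt_pos.2 hδ
    have hDV : ∀ j, LocallyIntegrable (DV δ j) := fun j => (H.1.2 j).1
    have iP := locallyIntegrable_radialPart hDV
    have iQ := locallyIntegrable_angularPart hDV
    have hmodes : ∀ n : ℤ, ∀ᵐ r, r ∈ Set.Ioo ri re →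
        ‖fourierMode n (radialPart (DV δ)) r‖ ≤ b n / Real.sqrt δ ∧
        ‖fourierMode n (angularPart (DV δ)) r‖ ≤ b n / Real.sqrt δ := by
      intro n
      have hQ := H.1.fourierMode_angularPart n
      rcases eq_or_ne n 0 with rfl | hn
      · filter_upwards [(H.mode_zero hf hri hre).1, hQ] with r h1 h2 hr
        rw [h1 hr, h2 (hri.trans hr.1)]
        have : 0 ≤ b 0 / Real.sqrt δ := by positivity
        simpa using this
      · obtain ⟨B, C, D, h1, h2, -⟩ := H.exists_modes hf hri hre hδ hn
        have hm := Int.natAbs_ne_zero.2 hn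
        filter_upwards [h2, hQ] with r h3 h4 hr
        have hr0 : 0 < r := hri.trans hr.1
        have h5 := h1.norm_le hδ hri hre hκ0 hκ1 (pow_sq_le hri hre hm) ht0 (hK n hn) hr
        have nr : ‖(r : ℂ)‖ = r := by rw [Complex.norm_real, Real.norm_eq_abs, abs_of_pos hr0]
        have nB : ‖B * (r : ℂ) ^ n.natAbs‖ = ‖B‖ * r ^ n.natAbs := by
          rw [norm_mul, norm_pow, nr]
        have nC : ‖C * ((r : ℂ) ^ n.natAbs)⁻¹‖ = ‖C‖ * (r ^ n.natAbs)⁻¹ := by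
          rw [norm_mul, norm_inv, norm_pow, nr]
        have e : b n / Real.sqrt δ = n.natAbs * (9 * K / κ * τ ^ n.natAbs / Real.sqrt δ) := by
          simp only [hb]; ring
        have nn : ‖(n : ℂ)‖ = n.natAbs := by
          rw [Complex.norm_intCast, Nat.cast_natAbs, Int.cast_abs]
        rw [(h3 hr).2, h4 hr0, (h3 hr).1, e]
        constructor
        · rw [norm_mul, Complex.norm_natCast]
          gcongr
          refine (norm_sub_le _ _).trans ?_
          rw [nB, nC]; exact h5
        · rw [norm_mul, norm_mul, Complex.norm_I, one_mul, nn]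
          gcongr
          refine (norm_add_le _ _).trans ?_
          rw [nB, nC]; exact h5
    rw [← ae_all_iff] at hmodes
    -- Absolute summability of the modes bounds r∂_r V and ∂_θ V by M/√δ almost everywhere in the
    -- shell. After squaring, 1/δ cancels the factor δ of the dissipated power.
    have bound : ∀ u : Plane → ℂ, LocallyIntegrable u →
        (∀ᵐ r, ∀ n : ℤ, r ∈ Set.Ioo ri re → ‖fourierMode n u r‖ ≤ b n / Real.sqrt δ) →
        ∀ᵐ x, ‖x‖ ∈ Set.Ioo ri re → ‖u x‖ ≤ M / Real.sqrt δ := by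
      intro u hu hun
      refine ae_norm_le_of_ae_ae_polarMap hu.aestronglyMeasurable measurableSet_Ioo ?_
      filter_upwards [hun, hu.ae_integrable_polarMap] with r h1 h2 hr hra
      have := ae_norm_le_of_norm_mode_le (h2 hr) (hbs.div_const (Real.sqrt δ)) fun n => h1 n hra
      rw [tsum_div_const, mul_div_assoc'] at this
      exact this
    have hP := bound _ iP (by filter_upwards [hmodes] with r hr n hrn using (hr n hrn).1)
    have hQ := bound _ iQ (by filter_upwards [hmodes] with r hr n hrn using (hr n hrn).2)
    have hsq : (M / Real.sqrt δ) ^ 2 = M ^ 2 / δ := by rw [div_pow, Real.sq_sqrt hδ.le]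
    have key : ∫⁻ x in shell ri re, ∑ j, ‖DV δ j x‖ₑ ^ 2
        ≤ ENNReal.ofReal (2 * (M ^ 2 / δ) / ri ^ 2) * volume (shell ri re) := by
      rw [← setLIntegral_const]
      refine setLIntegral_mono_ae' (measurableSet_shell ri re) ?_
      filter_upwards [hP, hQ] with x h1 h2 hx
      have hx0 : x ≠ 0 := norm_pos_iff.1 (hri.trans hx.1)
      rw [sum_enorm_sq_eq _ hx0]
      refine ENNReal.ofReal_le_ofReal ?_
      have h3 := pow_le_pow_left₀ (norm_nonneg _) (h1 hx) 2
      have h4 := pow_le_pow_left₀ (norm_nonneg _) (h2 hx) 2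
      rw [hsq] at h3 h4
      have h5 : ri ≤ ‖x‖ := hx.1.le
      gcongr
      linarith
    calc dissipation ri re δ (DV δ) ≤ ENNReal.ofReal δ *
          (ENNReal.ofReal (2 * (M ^ 2 / δ) / ri ^ 2) * volume (shell ri re)) := by
          rw [dissipation]; gcongr
      _ = _ := by
          rw [← mul_assoc, ← ENNReal.ofReal_mul hδ.le]
          congr 2
          field_simp
  have hfin : ENNReal.ofReal (2 * M ^ 2 / ri ^ 2) * volume (shell ri re) ≠ ⊤ :=
    ENNReal.mul_ne_top ENNReal.ofReal_ne_top (volume_shell_lt_top ri re).ne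
  -- Adding 1 makes the inequality strict.
  refine ⟨(ENNReal.ofReal (2 * M ^ 2 / ri ^ 2) * volume (shell ri re)).toReal + 1,
    fun δ hδ => (main δ hδ).trans_lt ?_⟩
  rw [ENNReal.lt_ofReal_iff_toReal_lt hfin]
  linarith

/-! ### Lower bounds for the dissipated power -/

/-- The squared gradient is r⁻² times the squares of the radial and angular parts. With the Jacobian
r and the constant 2π of Cauchy–Schwarz this leaves the weight 1/(2πr). -/
theorem ofReal_modes_le {DV : Fin 2 → Plane → ℂ} {r : ℝ} (hr : 0 < r) (n : ℤ)
    (hP : AEMeasurable (fun θ => radialPart DV (polarMap (r, θ))) angularMeasure)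
    (hQ : AEMeasurable (fun θ => angularPart DV (polarMap (r, θ))) angularMeasure) :
    ENNReal.ofReal ((2 * Real.pi * r)⁻¹ *
        (‖fourierMode n (radialPart DV) r‖ ^ 2 + ‖fourierMode n (angularPart DV) r‖ ^ 2))
      ≤ ENNReal.ofReal r * ∫⁻ θ, ∑ j, ‖DV j (polarMap (r, θ))‖ₑ ^ 2 ∂angularMeasure := by
  have h1 : ∀ θ, ∑ j, ‖DV j (polarMap (r, θ))‖ₑ ^ 2 = ENNReal.ofReal ((r ^ 2)⁻¹) *
      (‖radialPart DV (polarMap (r, θ))‖ₑ ^ 2 + ‖angularPart DV (polarMap (r, θ))‖ₑ ^ 2) := by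
    intro θ
    have hx : polarMap (r, θ) ≠ 0 := by
      rw [← norm_pos_iff, norm_polarMap, abs_of_pos hr]; exact hr
    rw [sum_enorm_sq_eq _ hx, norm_polarMap, abs_of_pos hr, div_eq_mul_inv, mul_comm,
      ENNReal.ofReal_mul (by positivity), ENNReal.ofReal_add (by positivity) (by positivity),
      ENNReal.ofReal_pow (norm_nonneg _), ENNReal.ofReal_pow (norm_nonneg _), ofReal_norm,
      ofReal_norm]
  simp only [h1]
  rw [lintegral_const_mul' _ _ ENNReal.ofReal_ne_top, lintegral_add_left' (hP.enorm.pow_const 2),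
    ENNReal.ofReal_mul (by positivity), ENNReal.ofReal_add (by positivity) (by positivity),
    ENNReal.ofReal_pow (norm_nonneg _), ENNReal.ofReal_pow (norm_nonneg _), ofReal_norm,
    ofReal_norm]
  calc _ ≤ ENNReal.ofReal (2 * Real.pi * r)⁻¹ *
        (ENNReal.ofReal (2 * Real.pi) * (∫⁻ θ, ‖radialPart DV (polarMap (r, θ))‖ₑ ^ 2
          ∂angularMeasure) + ENNReal.ofReal (2 * Real.pi) *
          ∫⁻ θ, ‖angularPart DV (polarMap (r, θ))‖ₑ ^ 2 ∂angularMeasure) := by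
        gcongr
        · exact enorm_fourierMode_sq_le n hP
        · exact enorm_fourierMode_sq_le n hQ
    _ = _ := by
        rw [← mul_add, ← mul_assoc, ← mul_assoc, ← ENNReal.ofReal_mul (by positivity),
          ← ENNReal.ofReal_mul hr.le]
        congr 2
        field_simp

theorem lintegral_modes_le {ri re : ℝ} (hri : 0 < ri) {DV : Fin 2 → Plane → ℂ}
    (hDV : ∀ j, LocallyIntegrable (DV j)) (n : ℤ) :
    ∫⁻ r in Set.Ioo ri re, ENNReal.ofReal ((2 * Real.pi * r)⁻¹ *
        (‖fourierMode n (radialPart DV) r‖ ^ 2 + ‖fourierMode n (angularPart DV) r‖ ^ 2))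
      ≤ ∫⁻ x in shell ri re, ∑ j, ‖DV j x‖ₑ ^ 2 := by
  have hG : AEMeasurable ((shell ri re).indicator fun x => ∑ j, ‖DV j x‖ₑ ^ 2) := by
    refine AEMeasurable.indicator ?_ (measurableSet_shell ri re)
    exact Finset.aemeasurable_fun_sum _ fun j _ =>
      (hDV j).aestronglyMeasurable.enorm.pow_const 2
  rw [← lintegral_indicator (measurableSet_shell ri re), lintegral_eq_lintegral_polarMap hG]
  have hsub : Set.Ioo ri re ⊆ Set.Ioi 0 := fun r hr => hri.trans hr.1
  refine le_trans ?_ (lintegral_mono_set hsub)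
  refine setLIntegral_mono_ae' measurableSet_Ioo ?_
  filter_upwards [(locallyIntegrable_radialPart hDV).ae_integrable_polarMap,
    (locallyIntegrable_angularPart hDV).ae_integrable_polarMap] with r h1 h2 hr
  have hr0 : 0 < r := hsub hr
  refine (ofReal_modes_le hr0 n (h1 hr0).aemeasurable (h2 hr0).aemeasurable).trans ?_
  gcongr with θ
  rw [Set.indicator_of_mem]
  show _ ∈ norm ⁻¹' Set.Ioo ri re
  rw [Set.mem_preimage, norm_polarMap, abs_of_pos hr0]
  exact hr

/-- Writing r^k / r avoids the truncated exponent k - 1. -/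
theorem hasDerivAt_pow_div (k : ℕ) {r : ℝ} (hr : r ≠ 0) :
    HasDerivAt (fun r : ℝ => r ^ k) (k * (r ^ k / r)) r := by
  convert! hasDerivAt_pow k r using 1
  rcases Nat.eq_zero_or_pos k with rfl | hk
  · simp
  · rw [← pow_sub_one_mul hk.ne' r, mul_div_cancel_right₀ _ hr]

/-- A primitive is (2π)⁻¹ m (b r^{2m} - c r^{-2m}). Because 1/x² - 1/y² = (y² - x²)/(x²y²), both
terms share the factor y² - x². -/
theorem integral_shell_modes {ri re b c : ℝ} (hri : 0 < ri) (hre : ri ≤ re) (m : ℕ) :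
    ∫ r in ri..re, (Real.pi)⁻¹ * m ^ 2 * ((b * r ^ (2 * m) + c * (r ^ (2 * m))⁻¹) / r)
      = (2 * Real.pi)⁻¹ * m * ((re ^ m) ^ 2 - (ri ^ m) ^ 2)
        * (b + c / ((ri ^ m) ^ 2 * (re ^ m) ^ 2)) := by
  have hpos : ∀ r ∈ Set.uIcc ri re, r ≠ 0 := by
    intro r hr
    rw [Set.uIcc_of_le hre] at hr
    exact (hri.trans_le hr.1).ne'
  have hd : ∀ r ∈ Set.uIcc ri re, HasDerivAt
      (fun r : ℝ => (2 * Real.pi)⁻¹ * m * (b * r ^ (2 * m) - c * (r ^ (2 * m))⁻¹))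
      ((Real.pi)⁻¹ * m ^ 2 * ((b * r ^ (2 * m) + c * (r ^ (2 * m))⁻¹) / r)) r := by
    intro r hr
    have h0 := hpos r hr
    have h1 := hasDerivAt_pow_div (2 * m) h0
    have h2 := ((h1.const_mul b).fun_sub ((h1.fun_inv (pow_ne_zero _ h0)).const_mul c)).const_mul
      ((2 * Real.pi)⁻¹ * m)
    convert! h2 using 1
    have := Real.pi_ne_zero
    push_cast
    field_simp
    ring
  have hc : ContinuousOn
      (fun r : ℝ => (Real.pi)⁻¹ * m ^ 2 * ((b * r ^ (2 * m) + c * (r ^ (2 * m))⁻¹) / r))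
      (Set.uIcc ri re) := by
    refine ContinuousOn.mul continuousOn_const (ContinuousOn.div (ContinuousOn.add (by fun_prop)
      (ContinuousOn.mul continuousOn_const (ContinuousOn.inv₀ (by fun_prop) ?_))) continuousOn_id
      hpos)
    exact fun r hr => pow_ne_zero _ (hpos r hr)
  rw [intervalIntegral.integral_eq_sub_of_hasDerivAt hd hc.intervalIntegrable]
  have h1 : ri ≠ 0 := hri.ne'
  have h2 : re ≠ 0 := (hri.trans_le hre).ne'
  have e1 : ∀ r : ℝ, r ^ (2 * m) = (r ^ m) ^ 2 := fun r => by rw [← pow_mul, mul_comm]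
  rw [e1, e1]
  have := Real.pi_ne_zero
  field_simp
  ring

/-- Each mode bounds the dissipated power from below. -/
theorem IsDielectricSolution.le_dissipation {ri re R S δ : ℝ} {f V : Plane → ℂ}
    {DV : Fin 2 → Plane → ℂ} (H : IsDielectricSolution ri re δ f V DV) (hf : IsSource re R S f)
    (hri : 0 < ri) (hre : ri < re) (hδ : 0 < δ) (hδ1 : δ ≤ 1) {n : ℤ} (hn : n ≠ 0) :
    ENNReal.ofReal ((1 - (ri / re) ^ 2) / (32 * Real.pi) *
      (δ * n.natAbs * (re ^ n.natAbs) ^ 2 * ‖sourceCoeff re f n‖ ^ 2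
        / (δ ^ 2 + ((ri / re) ^ n.natAbs) ^ 2))) ≤ dissipation ri re δ DV := by
  have hre0 : 0 < re := hri.trans hre
  have hm := Int.natAbs_ne_zero.2 hn
  have hDV : ∀ j, LocallyIntegrable (DV j) := fun j => (H.1.2 j).1
  obtain ⟨B, C, D, h1, h2, -⟩ := H.exists_modes hf hri hre hδ hn
  set m := n.natAbs with hmdef
  have hxy := pow_sq_le hri hre hm
  have hρ2 : 0 ≤ (ri / re) ^ 2 := sq_nonneg _
  have hxy' : (ri ^ m) ^ 2 ≤ (re ^ m) ^ 2 := by gcongr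
  have hlow := h1.shell_lower hδ hδ1 (pow_pos hri m) (pow_pos hre0 m) hxy'
  rw [← div_pow] at hlow
  have hcont : ContinuousOn (fun r : ℝ => (Real.pi)⁻¹ * m ^ 2 *
      ((‖B‖ ^ 2 * r ^ (2 * m) + ‖C‖ ^ 2 * (r ^ (2 * m))⁻¹) / r)) (Set.Icc ri re) := by
    have hpos : ∀ r ∈ Set.Icc ri re, r ≠ 0 := fun r hr => (hri.trans_le hr.1).ne'
    refine ContinuousOn.mul continuousOn_const (ContinuousOn.div (ContinuousOn.add (by fun_prop)
      (ContinuousOn.mul continuousOn_const (ContinuousOn.inv₀ (by fun_prop) ?_))) continuousOn_id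
      hpos)
    exact fun r hr => pow_ne_zero _ (hpos r hr)
  have hI : ENNReal.ofReal ((2 * Real.pi)⁻¹ * m * ((re ^ m) ^ 2 - (ri ^ m) ^ 2)
        * (‖B‖ ^ 2 + ‖C‖ ^ 2 / ((ri ^ m) ^ 2 * (re ^ m) ^ 2)))
      ≤ ∫⁻ x in shell ri re, ∑ j, ‖DV j x‖ₑ ^ 2 := by
    refine le_trans (le_of_eq ?_) (lintegral_modes_le hri hDV n)
    rw [← integral_shell_modes hri hre.le m, intervalIntegral.integral_of_le hre.le,
      integral_Ioc_eq_integral_Ioo, ofReal_integral_eq_lintegral_ofReal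
        ((hcont.integrableOn_Icc).mono_set Set.Ioo_subset_Icc_self)]
    · refine setLIntegral_congr_fun_ae measurableSet_Ioo ?_
      filter_upwards [h2, H.1.fourierMode_angularPart n] with r h3 h4 hr
      have hr0 : 0 < r := hri.trans hr.1
      have nn : ‖(n : ℂ)‖ = m := by
        rw [Complex.norm_intCast, hmdef, Nat.cast_natAbs, Int.cast_abs]
      have nr : ‖(r : ℂ)‖ = r := by rw [Complex.norm_real, Real.norm_eq_abs, abs_of_pos hr0]
      -- The radial part involves the difference of the two powers and the angular part their sum,
      -- so the mixed terms cancel in the energy.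
      have par := parallelogram_law_with_norm ℝ (B * (r : ℂ) ^ m) (C * ((r : ℂ) ^ m)⁻¹)
      have e1 : ‖B * (r : ℂ) ^ m‖ = ‖B‖ * r ^ m := by rw [norm_mul, norm_pow, nr]
      have e2 : ‖C * ((r : ℂ) ^ m)⁻¹‖ = ‖C‖ * (r ^ m)⁻¹ := by
        rw [norm_mul, norm_inv, norm_pow, nr]
      rw [e1, e2] at par
      congr 1
      rw [(h3 hr).2, h4 hr0, (h3 hr).1, norm_mul, norm_mul, norm_mul, Complex.norm_natCast,
        Complex.norm_I, nn, one_mul]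
      have e3 : r ^ (2 * m) = (r ^ m) ^ 2 := by rw [← pow_mul, mul_comm]
      rw [e3]
      have hπ := Real.pi_ne_zero
      have e4 : ((m : ℝ) * ‖B * (r : ℂ) ^ m - C * ((r : ℂ) ^ m)⁻¹‖) ^ 2
          + ((m : ℝ) * ‖B * (r : ℂ) ^ m + C * ((r : ℂ) ^ m)⁻¹‖) ^ 2
          = m ^ 2 * (2 * ((‖B‖ * r ^ m) ^ 2 + (‖C‖ * (r ^ m)⁻¹) ^ 2)) := by
        linear_combination (m : ℝ) ^ 2 * par
      rw [e4]
      field_simp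
    · rw [EventuallyLE, ae_restrict_iff' measurableSet_Ioo]
      refine ae_of_all _ fun r hr => ?_
      have hr0 : 0 < r := hri.trans hr.1
      simp only [Pi.zero_apply]
      positivity
  rw [dissipation]
  refine le_trans ?_ (mul_le_mul_right hI (ENNReal.ofReal δ))
  rw [← ENNReal.ofReal_mul hδ.le]
  refine ENNReal.ofReal_le_ofReal ?_
  have h5 : (1 - (ri / re) ^ 2) * (re ^ m) ^ 2 ≤ (re ^ m) ^ 2 - (ri ^ m) ^ 2 := by linarith
  have hκ : 0 ≤ 1 - (ri / re) ^ 2 := by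
    have h6 : ri / re ≤ 1 := (div_le_one hre0).2 hre.le
    have h7 : 0 ≤ ri / re := by positivity
    nlinarith
  have hd : 0 < δ ^ 2 + ((ri / re) ^ m) ^ 2 := by positivity
  calc _ = δ * ((2 * Real.pi)⁻¹ * m * ((1 - (ri / re) ^ 2) * (re ^ m) ^ 2)
        * (‖sourceCoeff re f n‖ ^ 2 / (16 * (δ ^ 2 + ((ri / re) ^ m) ^ 2)))) := by
        have hπ := Real.pi_ne_zero
        field_simp
        ring
    _ ≤ _ := by gcongr

/-! ### Resonant values of the loss parameter and the three conclusions -/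

theorem exists_isSource {re : ℝ} (hre : 0 < re) {f : Plane → ℂ} (hf_int : Integrable f)
    (hf_cpt : HasCompactSupport f) (hf_supp : tsupport f ⊆ (closedBall (0 : Plane) re)ᶜ)
    (hf_zero : ∫ x, f x = 0) : ∃ R S, IsSource re R S f := by
  have hK : IsCompact (tsupport f) := hf_cpt
  obtain ⟨S, hS⟩ := hK.isBounded.subset_closedBall (0 : Plane)
  -- Compactness of the support gives a positive gap to the closed disk. If the support is empty,
  -- any radius beyond `re` will do.
  obtain ⟨R, hR, hRf⟩ : ∃ R, re < R ∧ ∀ y ∈ tsupport f, R ≤ ‖y‖ := by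
    rcases (tsupport f).eq_empty_or_nonempty with h | h
    · exact ⟨re + 1, by linarith, by simp [h]⟩
    · obtain ⟨y, hy, hmin⟩ := hK.exists_isMinOn h continuous_norm.continuousOn
      refine ⟨‖y‖, ?_, fun z hz => hmin hz⟩
      have := hf_supp hy
      rw [Set.mem_compl_iff, mem_closedBall_zero_iff, not_le] at this
      exact this
  refine ⟨R, max S 0, hre, hR, le_max_right _ _, hf_int, fun y hy => ?_, fun y hy => ?_, hf_zero⟩
  · by_contra h
    exact absurd (hRf y (subset_tsupport _ h)) (not_le.2 hy)
  · by_contra h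
    have := hS (subset_tsupport _ h)
    rw [mem_closedBall_zero_iff] at this
    exact absurd (this.trans (le_max_left _ _)) (not_le.2 hy)

section

variable {ri re R S : ℝ} {f : Plane → ℂ} {V : ℝ → Plane → ℂ} {DV : ℝ → Fin 2 → Plane → ℂ}

/-- If |a_n| t^|n| were bounded for |n| ≥ N, the finitely many other indices could be absorbed into
the bound and the potential would extend. -/
theorem IsSource.exists_large_coeff (hf : IsSource re R S f) {t : ℝ} (ht : 0 < t)
    (hext : ¬ ExtendsHarmonically re (newtonianPotential f) (ball 0 t)) (K : ℝ) (N : ℕ) :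
    ∃ n : ℤ, n ≠ 0 ∧ N ≤ n.natAbs ∧ K < ‖sourceCoeff re f n‖ * t ^ n.natAbs := by
  by_contra! h
  refine hext (hf.extendsHarmonically (t := t) (K := max K
    (∑ k ∈ Finset.Icc (-(N : ℤ)) N, ‖sourceCoeff re f k‖ * t ^ k.natAbs)) fun n hn => ?_)
  rcases le_or_gt N n.natAbs with hN | hN
  · exact (h n hn hN).trans (le_max_left _ _)
  · refine le_trans ?_ (le_max_right _ _)
    exact Finset.single_le_sum (f := fun k : ℤ => ‖sourceCoeff re f k‖ * t ^ k.natAbs)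
      (fun k _ => by positivity) (Finset.mem_Icc.2 ⟨by omega, by omega⟩)

/-- At δ = ρ^m the two terms of the denominator are equal, and the single-mode lower bound becomes a
constant times m (|a_n| r_*^m)². Modes with arbitrarily large |n| and arbitrarily large |a_n| r_*^m
give arbitrarily small such δ. -/
theorem limsup_dissipation_eq_top (hf : IsSource re R S f) (hri : 0 < ri) (hre : ri < re)
    (hV : ∀ δ, 0 < δ → IsDielectricSolution ri re δ f (V δ) (DV δ))
    (hext : ¬ ExtendsHarmonically re (newtonianPotential f) (ball 0 (criticalRadius ri re))) :
    limsup (fun δ => dissipation ri re δ (DV δ)) (𝓝[>] (0 : ℝ)) = ⊤ := by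
  have hre0 : 0 < re := hri.trans hre
  have hrs : 0 < criticalRadius ri re := Real.sqrt_pos.2 (by positivity)
  have hρ0 : 0 < ri / re := by positivity
  have hρ1 : ri / re < 1 := (div_lt_one hre0).2 hre
  set c := (1 - (ri / re) ^ 2) / (32 * Real.pi) with hc
  have hc0 : 0 < c := by
    have : 0 < 1 - (ri / re) ^ 2 := by nlinarith
    positivity
  refine ENNReal.eq_top_of_forall_nnreal_le fun M => ?_
  refine le_limsup_of_frequently_le ?_
  rw [(nhdsGT_basis (0 : ℝ)).frequently_iff]
  intro η hη
  obtain ⟨N, hN⟩ := exists_pow_lt_of_lt_one hη hρ1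
  -- The threshold 1 ensures q ≤ m q² for q = |a_n| r_*^m; the threshold 2M/c then yields c m q²/2 ≥
  -- M.
  obtain ⟨n, hn, hNn, hK⟩ := hf.exists_large_coeff hrs hext (max 1 (2 * M / c)) N
  have hm := Int.natAbs_ne_zero.2 hn
  set m := n.natAbs with hmdef
  set δ := (ri / re) ^ m with hδ
  have hδ0 : 0 < δ := by positivity
  have hδ1 : δ ≤ 1 := pow_le_one₀ hρ0.le hρ1.le
  refine ⟨δ, ⟨hδ0, (pow_le_pow_of_le_one hρ0.le hρ1.le hNn).trans_lt hN⟩, ?_⟩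
  refine le_trans ?_ ((hV δ hδ0).le_dissipation hf hri hre hδ0 hδ1 hn)
  rw [← ENNReal.ofReal_coe_nnreal]
  refine ENNReal.ofReal_le_ofReal ?_
  rw [← hc, ← hmdef, ← hδ]
  have e1 : δ * m * (re ^ m) ^ 2 * ‖sourceCoeff re f n‖ ^ 2 / (δ ^ 2 + δ ^ 2)
      = m * (‖sourceCoeff re f n‖ * criticalRadius ri re ^ m) ^ 2 / 2 := by
    rw [mul_pow, ← pow_cube_div hri hre0, hδ, div_pow]
    field_simp
    ring
  rw [e1]
  have h1 : (1 : ℝ) ≤ m := by exact_mod_cast Nat.one_le_iff_ne_zero.2 hm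
  have h2 := (le_max_left _ _).trans hK.le
  have h3 := (le_max_right _ _).trans hK.le
  set q := ‖sourceCoeff re f n‖ * criticalRadius ri re ^ m
  rw [div_le_iff₀ hc0] at h3
  have h4 : q ≤ m * q ^ 2 := by nlinarith
  nlinarith

/-- Given a small δ, choose k with ρ^{|n_{k+1}|} ≤ δ < ρ^{|n_k|} and use the mode n_k. The
denominator is at most 2ρ^{2|n_k|}, while the factor δ in the numerator is at least
ρ^{|n_{k+1}|-|n_k|} ρ^{|n_k|}; this reproduces the expression of the gap condition. -/
theorem tendsto_dissipation_top (hf : IsSource re R S f) (hri : 0 < ri) (hre : ri < re)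
    (hV : ∀ δ, 0 < δ → IsDielectricSolution ri re δ f (V δ) (DV δ))
    (hgap : GapCondition ri re (harmonicCoeff re (newtonianPotential f))) :
    Tendsto (fun δ => dissipation ri re δ (DV δ)) (𝓝[>] (0 : ℝ)) (𝓝 ⊤) := by
  have hre0 : 0 < re := hri.trans hre
  have hrs : 0 < criticalRadius ri re := Real.sqrt_pos.2 (by positivity)
  have hρ0 : 0 < ri / re := by positivity
  have hρ1 : ri / re < 1 := (div_lt_one hre0).2 hre
  set c := (1 - (ri / re) ^ 2) / (32 * Real.pi) with hc
  have hc0 : 0 < c := by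
    have : 0 < 1 - (ri / re) ^ 2 := by nlinarith
    positivity
  obtain ⟨n, hmono, hlim⟩ := hgap
  refine ENNReal.tendsto_nhds_top fun M => ?_
  obtain ⟨k₀, hk₀⟩ := eventually_atTop.1 (hlim.eventually_ge_atTop (2 * (M + 1) / c))
  have hδ₀ : 0 < (ri / re) ^ (n k₀).natAbs := by positivity
  filter_upwards [Ioo_mem_nhdsGT hδ₀] with δ hδ
  have hδ0 : 0 < δ := hδ.1
  have hδ1 : δ ≤ 1 := hδ.2.le.trans (pow_le_one₀ hρ0.le hρ1.le)
  have hex : ∃ k, (ri / re) ^ (n k).natAbs ≤ δ := by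
    obtain ⟨N, hN⟩ := exists_pow_lt_of_lt_one hδ0 hρ1
    exact ⟨N, (pow_le_pow_of_le_one hρ0.le hρ1.le (hmono.le_apply)).trans hN.le⟩
  classical
  -- The first index whose power drops to δ or below is positive, since δ is below the power at `k₀`
  -- and hence below the one at 0.
  obtain ⟨k, hk⟩ : ∃ k, Nat.find hex = k + 1 := by
    refine Nat.exists_eq_succ_of_ne_zero fun h0 => ?_
    have h1 := Nat.find_spec hex
    rw [h0] at h1
    have h2 := pow_le_pow_of_le_one hρ0.le hρ1.le (hmono.monotone (Nat.zero_le k₀))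
    exact absurd (h2.trans h1) (not_le.2 hδ.2)
  have hkδ : (ri / re) ^ (n (k + 1)).natAbs ≤ δ := hk ▸ Nat.find_spec hex
  have hδk : δ < (ri / re) ^ (n k).natAbs := not_le.1 (Nat.find_min hex (by omega))
  have hkk₀ : k₀ ≤ k := by
    by_contra! h
    have h2 := pow_le_pow_of_le_one hρ0.le hρ1.le (hmono.monotone (Nat.succ_le_of_lt h))
    exact absurd (h2.trans hkδ) (not_le.2 hδ.2)
  have hterm := hk₀ k hkk₀
  -- The gap expression carries the factor |n_k|, so it would be 0 rather than exceed a positive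
  -- number.
  have hn : n k ≠ 0 := by
    intro h0
    rw [h0] at hterm
    simp only [Int.natAbs_zero, Nat.cast_zero, mul_zero, zero_mul] at hterm
    have : 0 < 2 * ((M : ℝ) + 1) / c := by positivity
    linarith
  have hlt : (n k).natAbs < (n (k + 1)).natAbs := hmono (Nat.lt_succ_self k)
  refine lt_of_lt_of_le ?_ ((hV δ hδ0).le_dissipation hf hri hre hδ0 hδ1 hn)
  rw [← ENNReal.ofReal_natCast, ENNReal.ofReal_lt_ofReal_iff_of_nonneg (Nat.cast_nonneg M), ← hc]
  -- The normalising factor 1/(2π) is at most 1, so the gap bound passes to the larger coefficient.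
  have hnorm : ‖harmonicCoeff re (newtonianPotential f) (n k)‖ ≤ ‖sourceCoeff re f (n k)‖ := by
    rw [hf.harmonicCoeff_eq hn, norm_mul]
    refine mul_le_of_le_one_left (norm_nonneg _) ?_
    rw [norm_inv, norm_mul, Complex.norm_real, Complex.norm_ofNat, Real.norm_eq_abs,
      abs_of_pos Real.pi_pos]
    exact inv_le_one_of_one_le₀ (by linarith [Real.pi_gt_three])
  set m := (n k).natAbs with hmdef
  set s := (ri / re) ^ m with hs
  have hs0 : 0 < s := by positivity
  set a := ‖sourceCoeff re f (n k)‖ with ha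
  have h1 : 2 * ((M : ℝ) + 1) / c
      ≤ (ri / re) ^ ((n (k + 1)).natAbs - m) * m * a ^ 2 * criticalRadius ri re ^ (2 * m) := by
    refine hterm.trans ?_
    gcongr
  have h2 : (ri / re) ^ ((n (k + 1)).natAbs - m) * s ≤ δ := by
    rw [hs, ← pow_add, Nat.sub_add_cancel hlt.le]
    exact hkδ
  have e1 : criticalRadius ri re ^ (2 * m) * s = (re ^ m) ^ 2 := by
    rw [mul_comm 2 m, pow_mul, ← pow_cube_div hri hre0, hs, div_pow]
    field_simp
  have h3 : (2 * ((M : ℝ) + 1) / c) * s ^ 2 ≤ δ * m * (re ^ m) ^ 2 * a ^ 2 := by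
    calc _ ≤ (ri / re) ^ ((n (k + 1)).natAbs - m) * m * a ^ 2 * criticalRadius ri re ^ (2 * m)
          * s ^ 2 := by gcongr
      _ = ((ri / re) ^ ((n (k + 1)).natAbs - m) * s) * m * (criticalRadius ri re ^ (2 * m) * s)
          * a ^ 2 := by ring
      _ ≤ _ := by rw [e1]; gcongr
  have h4 : δ ^ 2 + s ^ 2 ≤ 2 * s ^ 2 := by nlinarith
  have h5 : ((M : ℝ) + 1) / c ≤ δ * m * (re ^ m) ^ 2 * a ^ 2 / (δ ^ 2 + s ^ 2) := by
    rw [le_div_iff₀ (by positivity)]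
    calc _ ≤ ((M : ℝ) + 1) / c * (2 * s ^ 2) := by gcongr
      _ = (2 * ((M : ℝ) + 1) / c) * s ^ 2 := by ring
      _ ≤ _ := h3
  rw [div_le_iff₀ hc0] at h5
  linarith

end

theorem theorem4p3 (ri re : ℝ) (hri : 0 < ri) (hre : ri < re)
    (f : Plane → ℂ) (hf_int : Integrable f) (hf_cpt : HasCompactSupport f)
    (hf_supp : tsupport f ⊆ (closedBall (0 : Plane) re)ᶜ) (hf_zero : ∫ x, f x = 0)
    (V : ℝ → Plane → ℂ) (DV : ℝ → Fin 2 → Plane → ℂ)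
    (hV : ∀ δ, 0 < δ → IsDielectricSolution ri re δ f (V δ) (DV δ)) :
    -- (i) weak CALR
    (¬ ExtendsHarmonically re (newtonianPotential f) (ball 0 (criticalRadius ri re)) →
      limsup (fun δ => dissipation ri re δ (DV δ)) (𝓝[>] (0 : ℝ)) = ⊤ ∧
      ((∃ C, BoundedOutsideBy (re ^ 2 / ri) C (newtonianPotential f)) →
        UniformlyBoundedOutside (re ^ 2 / ri) V)) ∧
    -- (ii) CALR
    (GapCondition ri re (harmonicCoeff re (newtonianPotential f)) →
      Tendsto (fun δ => dissipation ri re δ (DV δ)) (𝓝[>] (0 : ℝ)) (𝓝 ⊤) ∧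
      ((∃ C, BoundedOutsideBy (re ^ 2 / ri) C (newtonianPotential f)) →
        UniformlyBoundedOutside (re ^ 2 / ri) V)) ∧
    -- (iii) no CALR
    ((∃ U : Set Plane, IsOpen U ∧ closedBall 0 (criticalRadius ri re) ⊆ U ∧
        ExtendsHarmonically re (newtonianPotential f) U) →
      ∃ C : ℝ, ∀ δ, 0 < δ → dissipation ri re δ (DV δ) < ENNReal.ofReal C) := by
  have hre0 : 0 < re := hri.trans hre
  obtain ⟨R, S, hf⟩ := exists_isSource hre0 hf_int hf_cpt hf_supp hf_zero
  have hB : (∃ C, BoundedOutsideBy (re ^ 2 / ri) C (newtonianPotential f)) →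
      UniformlyBoundedOutside (re ^ 2 / ri) V := exists_uniformlyBoundedOutside hf hri hre hV
  refine ⟨fun h => ⟨limsup_dissipation_eq_top hf hri hre hV h, hB⟩,
    fun h => ⟨tendsto_dissipation_top hf hri hre hV h, hB⟩, ?_⟩
  rintro ⟨U, hU, hsub, H, hH, hHF⟩
  -- Compactness of the closed critical disk leaves room for a disk of radius r_* + ε in `U`; half
  -- of this margin provides a radius t > r_* at which the coefficients are still controlled.
  obtain ⟨ε, hε, hεU⟩ := (isCompact_closedBall (0 : Plane) (criticalRadius ri re)).exists_thickening_subset_open hU hsub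
  have hc : re ≤ criticalRadius ri re := by
    refine Real.le_sqrt_of_sq_le ?_
    rw [le_div_iff₀ hri]
    nlinarith [sq_nonneg re]
  have hball : ball (0 : Plane) (criticalRadius ri re + ε) ⊆ U := by
    refine subset_trans ?_ hεU
    rw [thickening_closedBall hε (hre0.le.trans hc), add_comm]
  obtain ⟨K, hK⟩ := hf.exists_norm_sourceCoeff_le (t := criticalRadius ri re + ε / 2)
    ⟨H, hH.mono hball, hHF⟩ (by linarith) (by linarith : _ < criticalRadius ri re + ε)
  exact exists_dissipation_lt hf hri hre hV (by linarith) hK
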